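/- **Conventions.** Let $k$ be a field and $\Lambda$ a gentle $k$-algebra, i.e. $\Lambda$ is Morita equivalent to $kQ/I$ with $Q$ a finite quiver and $I$ an admissible ideal generated by paths of length two such that every vertex is the source of at most two and the target of at most two arrows, and for each arrow $a$ there is at most one arrow $b$ with $ba$ a path not in $I$, at most one arrow $c$ with $ac$ a path not in $I$, at most one $b$ with $ba$ a path in $I$, and at most one $c$ with $ac$ a path in $I$. Paths are read from right to left; a path in $(Q,I)$ is a path with no subpath in $I$. Write $P(x)$ for the indecomposable projective left module of a vertex $x$ (for $kQ/I$ it is $(kQ/I)e_x$, transported to $\Lambda$ by the Morita equivalence); a path $p$ from $y$ to $x$ gives a map $p\colon P(x)\to P(y)$ (right multiplication), and maps are composed from left to right. A *homotopy letter* is a nontrivial path $p$ in $(Q,I)$ (direct) or the formal inverse $\bar p$ of one (inverse). A *homotopy string* is a walk $\sigma=\sigma_n\cdots\sigma_1$ (possibly trivial, without subwalks $a\bar a$, $\bar a a$) with its decomposition into homotopy letters; i.e. if $\sigma_{i+1},\sigma_i$ are both direct, the length two path at their junction lies in $I$, and if they are both inverse, the same holds for $\bar\sigma_i\bar\sigma_{i+1}$.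 It may be infinite to the left if its letters are eventually direct arrows, and infinite to the right if its letters are eventually inverse arrows. A *homotopy band* is a nontrivial finite homotopy string that is closed, remains a homotopy string with the same letters when read cyclically, is not a proper power, and has as many direct as inverse letters. The string complex $P^\bullet_\sigma$ has a summand $P(x)$ for every end point $x$ of a letter (a *bullet*), and the letters, drawn from left to right as $\bullet\!-\!\bullet$, are the components of the differential, from left to right if direct and from right to left if inverse; the cohomological degree of one bullet is chosen freely. The band complex $B^\bullet_{\sigma,\lambda}$, $\lambda\in k^*$, is defined in the same way from the cyclic diagram of $\sigma$, with the scalar $\lambda$ placed on one letter. The mapping cone of $f^\bullet\colon X^\bullet\to Y^\bullet$ is $M^n=X^{n+1}\oplus Y^n$ with its usual differential. **Proposition.** Let $\sigma=\beta\sigma_L\sigma_R\alpha$ be a homotopy band, $\lambda\in k^*$, and let $\tau=\delta\tau_L\tau_R\gamma$ be a (possibly infinite) homotopy string, where $\sigma_L,\sigma_R$ are homotopy letters and $\tau_L$, $\tau_R$ are homotopy letters or empty ($\delta$, resp. $\gamma$, being empty if $\tau_L$, resp. $\tau_R$, is). Let $f^\bullet\colon B^\bullet_{\sigma,\lambda}\to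 P^\bullet_\tau$ be a single map with single component $f$, from the bullet between $\sigma_L$ and $\sigma_R$ to the bullet between $\tau_L$ and $\tau_R$ (which have the same cohomological degree): $f$ is a nontrivial path in $(Q,I)$ and * $\sigma_L$ is inverse, or $\sigma_L f$ has a subpath in $I$; $\tau_L$ is direct or empty, or $f\bar\tau_L$ has a subpath in $I$; * $\sigma_R$ is direct, or $\bar\sigma_R f$ has a subpath in $I$; $\tau_R$ is inverse or empty, or $f\tau_R$ has a subpath in $I$. Suppose that $\sigma$ and $\tau$ are compatibly oriented for $f^\bullet$: 1. $\sigma_L$ and $\tau_L$ do not contain $f$ as a subletter (it is enough to ask this for occurrences of $f$ at the end of the letter at which $f$ is attached); 2. if $\sigma_L$ is direct then $\sigma_L f=0$, and if $\tau_L$ is inverse then $f\bar\tau_L=0$; 3. $\sigma_R=ff_R$ and, if $\tau_R\neq\emptyset$, $\tau_R=\bar f\bar f_L$, for some (possibly trivial) paths $f_R$, $f_L$ in $(Q,I)$. Suppose moreover that $f^\bullet$ is not null-homotopic. Then the mapping cone $M^\bullet_{f^\bullet}$ is isomorphic, in the homotopy category of complexes of $\Lambda$-modules, to the string complex $P^\bullet_c$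 of the homotopy string $$c=\begin{cases}\alpha\beta\sigma_L f\bar\tau_L\bar\delta & \text{if }\tau_R=\emptyset,\\ \bar\gamma\,\bar\tau_R\bar f\sigma_R\,\alpha\beta\sigma_L f\bar\tau_L\bar\delta & \text{if }\tau_R\neq\emptyset,\end{cases}$$ where $\bar\tau_R\bar f\sigma_R$ stands for the single direct homotopy letter $f_Lff_R$; in particular $c$ is a homotopy string. Here the bullet of $c$ between $f$ and $\bar\tau_L$ (the last $f$ in the formula) sits in the same cohomological degree as the bullet of $\tau$ between $\tau_L$ and $\tau_R$. -/

import Mathlib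

open CategoryTheory

universe u

noncomputable section

namespace GentleCone

/-! ## Bound quivers, gentle algebras

`Quiver.Total V` is Mathlib's type of all arrows of the quiver `V`; for an arrow `a`, `a.left` is
its source and `a.right` its target.  Paths are read from right to left: a path `a_n ⋯ a_1`
(first `a_1`, last `a_n`) is the list `[a_n, …, a_1]`.  The set of length two paths `ba` that
generate the ideal `I` is given as a relation `R b a`. -/

section Quivers

variable {V : Type u} [Quiver.{u} V]

/-- `l = [a_n, …, a_1]` is a path in the quiver that has no subpath in `I`, that is,
a path in `(Q, I)`. The empty list is allowed; it stands for a trivial path. -/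
def IsPath (R : Quiver.Total V → Quiver.Total V → Prop) (l : List (Quiver.Total V)) : Prop :=
  l.IsChain fun b a => b.left = a.right ∧ ¬ R b a

/-- The word `l` has a subpath in `I` (some two consecutive arrows are a generating relation). -/
def HasRelation (R : Quiver.Total V → Quiver.Total V → Prop) (l : List (Quiver.Total V)) : Prop :=
  ∃ b a, R b a ∧ [b, a] <:+: l

/-- `(Q, I)` is a gentle bound quiver, where `I` is generated by the paths `ba` with `R b a`. -/
structure IsGentle (R : Quiver.Total V → Quiver.Total V → Prop) : Prop where
  /-- `I` is generated by paths of length two -/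
  composable : ∀ b a, R b a → b.left = a.right
  /-- `I` is admissible: all sufficiently long paths are in `I` -/
  admissible : ∃ N : ℕ, ∀ l : List (Quiver.Total V), IsPath R l → l.length ≤ N
  /-- at most two arrows start at each vertex -/
  starting : ∀ v : V, {a : Quiver.Total V | a.left = v}.encard ≤ 2
  /-- at most two arrows end at each vertex -/
  ending : ∀ v : V, {a : Quiver.Total V | a.right = v}.encard ≤ 2
  /-- at most one `b` with `ba` a path that is not in `I` -/
  after_notMem : ∀ a : Quiver.Total V,
    {b : Quiver.Total V | b.left = a.right ∧ ¬ R b a}.Subsingleton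
  /-- at most one `c` with `ac` a path that is not in `I` -/
  before_notMem : ∀ a : Quiver.Total V,
    {c : Quiver.Total V | a.left = c.right ∧ ¬ R a c}.Subsingleton
  /-- at most one `b` with `ba` a path that is in `I` -/
  after_mem : ∀ a : Quiver.Total V, {b : Quiver.Total V | R b a}.Subsingleton
  /-- at most one `c` with `ac` a path that is in `I` -/
  before_mem : ∀ a : Quiver.Total V, {c : Quiver.Total V | R a c}.Subsingleton

end Quivers

section Algebra

variable (k : Type u) [Field k] {V : Type u} [Quiver.{u} V] [Fintype V]

/-- The defining relations of the path algebra of a finite quiver on the generators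
`e_v` (`v` a vertex) and `a` (`a` an arrow). -/
inductive PathRel : FreeAlgebra k (V ⊕ Quiver.Total V) → FreeAlgebra k (V ⊕ Quiver.Total V) → Prop
  | idem (v : V) : PathRel (FreeAlgebra.ι k (Sum.inl v) * FreeAlgebra.ι k (Sum.inl v))
      (FreeAlgebra.ι k (Sum.inl v))
  | orth (v w : V) (h : v ≠ w) :
      PathRel (FreeAlgebra.ι k (Sum.inl v) * FreeAlgebra.ι k (Sum.inl w)) 0
  | one : PathRel (∑ v : V, FreeAlgebra.ι k (Sum.inl v)) 1
  | target (a : Quiver.Total V) :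
      PathRel (FreeAlgebra.ι k (Sum.inl a.right) * FreeAlgebra.ι k (Sum.inr a))
        (FreeAlgebra.ι k (Sum.inr a))
  | source (a : Quiver.Total V) :
      PathRel (FreeAlgebra.ι k (Sum.inr a) * FreeAlgebra.ι k (Sum.inl a.left))
        (FreeAlgebra.ι k (Sum.inr a))

variable (V) in
/-- The path algebra `kQ` of a finite quiver; the product `b * a` of arrows is the path `ba`
(first `a`, then `b`) if `s(b) = e(a)` and zero otherwise. -/
abbrev PathAlgebra : Type u := RingQuot (PathRel k (V := V))

/-- The generator of `kQ` belonging to a vertex (a trivial path) or an arrow. -/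
def PathAlgebra.gen (x : V ⊕ Quiver.Total V) : PathAlgebra k V :=
  RingQuot.mkAlgHom k (PathRel k (V := V)) (FreeAlgebra.ι k x)

/-- The two-sided ideal `I` of `kQ` generated by the paths `ba` with `R b a`. -/
def relIdeal (R : Quiver.Total V → Quiver.Total V → Prop) : TwoSidedIdeal (PathAlgebra k V) :=
  TwoSidedIdeal.span
    {z | ∃ b a, R b a ∧ z = PathAlgebra.gen k (Sum.inr b) * PathAlgebra.gen k (Sum.inr a)}

/-- The algebra `kQ/I`. -/
abbrev BoundAlgebra (R : Quiver.Total V → Quiver.Total V → Prop) : Type u :=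
  (relIdeal k R).ringCon.Quotient

variable (R : Quiver.Total V → Quiver.Total V → Prop)

/-- The idempotent `e_v` of `kQ/I`. -/
def idem (v : V) : BoundAlgebra k R :=
  (relIdeal k R).ringCon.mk' (PathAlgebra.gen k (Sum.inl v))

/-- The class of an arrow in `kQ/I`. -/
def arr (a : Quiver.Total V) : BoundAlgebra k R :=
  (relIdeal k R).ringCon.mk' (PathAlgebra.gen k (Sum.inr a))

/-- The class in `kQ/I` of a nontrivial path `[a_n, …, a_1]`. -/
def pathElt (l : List (Quiver.Total V)) : BoundAlgebra k R := (l.map (arr k R)).prod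

/-- The projective left module `P(v) = (kQ/I) e_v`. -/
abbrev Proj (v : V) : Type u := Submodule.span (BoundAlgebra k R) {idem k R v}

/-- Right multiplication by `p`, as a map of left modules `P(v) → P(w)`, `z ↦ z p e_w`; for a path
`p` from `w` to `v` one has `p e_w = p`. -/
def rmul (v w : V) (p : BoundAlgebra k R) : Proj k R v →ₗ[BoundAlgebra k R] Proj k R w where
  toFun z := ⟨z.1 * p * idem k R w,
    Submodule.mem_span_singleton.2 ⟨z.1 * p, by rw [smul_eq_mul]⟩⟩
  map_add' x y := by ext; simp [add_mul]
  map_smul' c x := by ext; simp [mul_assoc]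

end Algebra

/-! ## Homotopy letters, strings and bands -/

section Words

variable {V : Type u} [Quiver.{u} V]

/-- A (nontrivial) homotopy letter: a nontrivial path `p`, standing for the direct homotopy letter
`p` if `direct = true` and for the inverse homotopy letter `p̄` if `direct = false`. -/
@[ext] structure Letter (V : Type u) [Quiver.{u} V] where
  /-- the arrows `[a_n, …, a_1]` of the underlying path -/
  arrows : List (Quiver.Total V)
  ne_nil : arrows ≠ []
  direct : Bool

namespace Letter

/-- The inverse letter. -/
def inv (p : Letter V) : Letter V := ⟨p.arrows, p.ne_nil, !p.direct⟩

/-- The leftmost arrow `a_n` of the underlying path `a_n ⋯ a_1`. -/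
def first (p : Letter V) : Quiver.Total V := p.arrows.head p.ne_nil

/-- The rightmost arrow `a_1` of the underlying path `a_n ⋯ a_1`. -/
def last (p : Letter V) : Quiver.Total V := p.arrows.getLast p.ne_nil

/-- The vertex at the left end of the letter. -/
def leftVertex (p : Letter V) : V := if p.direct then p.first.right else p.last.left

/-- The vertex at the right end of the letter. -/
def rightVertex (p : Letter V) : V := if p.direct then p.last.left else p.first.right

/-- Change of cohomological degree along a letter from left to right. -/
def sign (p : Letter V) : ℤ := if p.direct then 1 else -1

end Letter

/-- The letter `p` may stand directly to the left of the letter `q` in a homotopy string: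
the walks compose, the resulting walk contains no `a ā` or `ā a`, and the boundary between `p` and
`q` is a boundary of homotopy letters. -/
def Junction (R : Quiver.Total V → Quiver.Total V → Prop) (p q : Letter V) : Prop :=
  p.rightVertex = q.leftVertex ∧
  (p.direct = true → q.direct = true → R p.last q.first) ∧
  (p.direct = false → q.direct = false → R q.last p.first) ∧
  (p.direct = true → q.direct = false → p.last ≠ q.last) ∧
  (p.direct = false → q.direct = true → p.first ≠ q.first)

/-- A word of homotopy letters, possibly infinite to the left or to the right, with a marked bullet
of its unfolded diagram, where the vertex `base` and the cohomological degree `deg` sit.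
`left` lists the letters to the left of the marked bullet and `right` those to the right of it,
in both cases moving away from it. -/
structure PointedWord (V : Type u) [Quiver.{u} V] where
  base : V
  deg : ℤ
  left : Stream'.Seq (Letter V)
  right : Stream'.Seq (Letter V)

namespace PointedWord

/-- The bullets of the unfolded diagram are numbered by integers from left to right, the marked
one being `0`; `letter t` is the homotopy letter between the bullets `t` and `t + 1`. -/
def letter (s : PointedWord V) : ℤ → Option (Letter V)
  | Int.ofNat n => s.right.get? n
  | Int.negSucc n => s.left.get? n

/-- The integers that number a bullet. -/
def IsBullet (s : PointedWord V) : ℤ → Prop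
  | Int.ofNat 0 => True
  | Int.ofNat (n + 1) => (s.right.get? n).isSome
  | Int.negSucc n => (s.left.get? n).isSome

/-- The vertex at a bullet. -/
def vert (s : PointedWord V) : ℤ → V
  | Int.ofNat 0 => s.base
  | Int.ofNat (n + 1) => (s.right.get? n).elim s.base Letter.rightVertex
  | Int.negSucc n => (s.left.get? n).elim s.base Letter.leftVertex

/-- The cohomological degree of a bullet. -/
def degree (s : PointedWord V) : ℤ → ℤ
  | Int.ofNat n => s.deg + ∑ m ∈ Finset.range n, (s.right.get? m).elim 0 Letter.sign
  | Int.negSucc n => s.deg - ∑ m ∈ Finset.range (n + 1), (s.left.get? m).elim 0 Letter.sign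

end PointedWord

/-- The word is a (finite or infinite, possibly trivial) homotopy string. -/
structure IsHomotopyString (R : Quiver.Total V → Quiver.Total V → Prop) (s : PointedWord V) :
    Prop where
  path : ∀ t p, s.letter t = some p → IsPath R p.arrows
  junction : ∀ t p q, s.letter t = some p → s.letter (t + 1) = some q → Junction R p q
  base_right : ∀ p, s.right.get? 0 = some p → p.leftVertex = s.base
  base_left : ∀ p, s.left.get? 0 = some p → p.rightVertex = s.base
  /-- if infinite to the left, then eventually a direct antipath -/
  antipath_left : ∃ N, ∀ n ≥ N, ∀ p, s.left.get? n = some p →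
    p.direct = true ∧ p.arrows.length = 1
  /-- if infinite to the right, then eventually an inverse antipath -/
  antipath_right : ∃ N, ∀ n ≥ N, ∀ p, s.right.get? n = some p →
    p.direct = false ∧ p.arrows.length = 1

/-- `[σ_n, …, σ_1]` is a homotopy band: a closed walk that is also reduced, with the same homotopy
letters, when it is read cyclically, that is not a proper power, and that has as many direct as
inverse letters. -/
structure IsHomotopyBand (R : Quiver.Total V → Quiver.Total V → Prop) (σ : List (Letter V)) :
    Prop where
  ne_nil : σ ≠ []
  path : ∀ p ∈ σ, IsPath R p.arrows
  junction : ∀ t : Fin σ.length, Junction R (σ.get t) (σ.get (finRotate _ t))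
  primitive : ¬ ∃ (w : List (Letter V)) (m : ℕ), 1 < m ∧ σ = (List.replicate m w).flatten
  balanced : σ.countP (fun p => p.direct) = σ.countP (fun p => !p.direct)

end Words

/-! ## Complexes of unfolded diagrams -/

section AlgebraFacts

variable {k : Type u} [Field k] {V : Type u} [Quiver.{u} V] [Fintype V]
  {R : Quiver.Total V → Quiver.Total V → Prop}

theorem gen_mul_gen_left (b : Quiver.Total V) :
    PathAlgebra.gen k (Sum.inr b) * PathAlgebra.gen k (Sum.inl b.left) =
      PathAlgebra.gen k (Sum.inr b) := by
  rw [PathAlgebra.gen, PathAlgebra.gen, ← map_mul]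
  exact RingQuot.mkAlgHom_rel k (PathRel.source b)

theorem gen_mul_gen_of_ne {v w : V} (h : v ≠ w) :
    PathAlgebra.gen k (Sum.inl v : V ⊕ Quiver.Total V) * PathAlgebra.gen k (Sum.inl w) = 0 := by
  rw [PathAlgebra.gen, PathAlgebra.gen, ← map_mul, RingQuot.mkAlgHom_rel k (PathRel.orth v w h),
    map_zero]

theorem arr_mul_arr {b a : Quiver.Total V} (h : R b a) : arr k R b * arr k R a = 0 := by
  have hm : PathAlgebra.gen k (Sum.inr b) * PathAlgebra.gen k (Sum.inr a) ∈ relIdeal k R :=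
    TwoSidedIdeal.subset_span ⟨b, a, h, rfl⟩
  rw [arr, arr, ← map_mul, ← map_zero (relIdeal k R).ringCon.mk']
  exact (RingCon.eq _).2 hm

theorem arr_mul_idem_mul_arr {b a : Quiver.Total V} (h : R b a) (v : V) :
    arr k R b * idem k R v * arr k R a = 0 := by
  classical
  by_cases hv : b.left = v
  · subst hv
    have : arr k R b * idem k R b.left = arr k R b := by
      rw [arr, idem, ← map_mul, gen_mul_gen_left]
    rw [this, arr_mul_arr h]
  · have : arr k R b * idem k R v = 0 := by
      rw [arr, idem, ← map_mul, ← gen_mul_gen_left, mul_assoc, gen_mul_gen_of_ne hv, mul_zero,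
        map_zero]
    rw [this, zero_mul]

/-- The product of two paths whose middle two arrows form a relation is zero in `kQ/I`. -/
theorem pathElt_mul_idem_mul_pathElt {p q : Letter V} (h : R p.last q.first) (v : V) :
    pathElt k R p.arrows * idem k R v * pathElt k R q.arrows = 0 := by
  have hp : p.arrows = p.arrows.dropLast ++ [p.last] :=
    (List.dropLast_append_getLast p.ne_nil).symm
  have hq : q.arrows = q.first :: q.arrows.tail := (List.cons_head_tail q.ne_nil).symm
  have key : pathElt k R p.arrows * idem k R v * pathElt k R q.arrows =
      pathElt k R p.arrows.dropLast * (arr k R p.last * idem k R v * arr k R q.first) *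
        pathElt k R q.arrows.tail := by
    conv_lhs => rw [hp, hq]
    simp only [pathElt, List.map_append, List.prod_append, List.map_cons, List.prod_cons,
      List.map_nil, List.prod_nil, mul_one, mul_assoc]
  rw [key, arr_mul_idem_mul_arr h, mul_zero, zero_mul]

end AlgebraFacts

section Complexes

variable (k : Type u) [Field k] {V : Type u} [Quiver.{u} V] [Fintype V]
  (R : Quiver.Total V → Quiver.Total V → Prop)

/-- An unfolded diagram: bullets `i`, each with a vertex and a cohomological degree, and homotopy
letters with a coefficient, where `letter i` joins the bullet `i` (on the left) to the bullet
`next i` (on the right) if it is not `none`. -/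
structure Unfolded (k : Type u) (V : Type u) [Quiver.{u} V] where
  ι : Type
  next : Equiv.Perm ι
  IsBullet : ι → Prop
  vert : ι → V
  degree : ι → ℤ
  letter : ι → Option (Letter V)
  coeff : ι → k

namespace Unfolded

variable {k}

/-- The module in degree `n`: the direct sum of the `P(v)` over all bullets of degree `n`. -/
abbrev Obj (U : Unfolded k V) (n : ℤ) : Type u :=
  DirectSum {i : U.ι // U.IsBullet i ∧ U.degree i = n} fun i => Proj k R (U.vert i.1)

open Classical in
/-- Right multiplication by `a` from a copy of `P(v)` to the summand of the bullet `j` in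
degree `n` (zero if there is no such summand). -/
def into (U : Unfolded k V) (v : V) (j : U.ι) (a : BoundAlgebra k R) (n : ℤ) :
    Proj k R v →ₗ[BoundAlgebra k R] U.Obj R n :=
  if h : U.IsBullet j ∧ U.degree j = n then
    (DirectSum.lof (BoundAlgebra k R) {i : U.ι // U.IsBullet i ∧ U.degree i = n}
      (fun i => Proj k R (U.vert i.1)) ⟨j, h⟩).comp (rmul k R v (U.vert j) a)
  else 0

/-- The part of the differential out of the bullet `i` along the letter to the right of `i`,
which is there if this letter is direct. -/
def dRight (U : Unfolded k V) (i : U.ι) (n : ℤ) :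
    Proj k R (U.vert i) →ₗ[BoundAlgebra k R] U.Obj R n :=
  match U.letter i with
  | none => 0
  | some p =>
    if p.direct then U.into R (U.vert i) (U.next i) (U.coeff i • pathElt k R p.arrows) n else 0

/-- The part of the differential out of the bullet `i` along the letter to the left of `i`,
which is there if this letter is inverse. -/
def dLeft (U : Unfolded k V) (i : U.ι) (n : ℤ) :
    Proj k R (U.vert i) →ₗ[BoundAlgebra k R] U.Obj R n :=
  match U.letter (U.next.symm i) with
  | none => 0
  | some p =>
    if p.direct then 0
    else U.into R (U.vert i) (U.next.symm i)
      (U.coeff (U.next.symm i) • pathElt k R p.arrows) n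

open Classical in
/-- The differential. -/
def d (U : Unfolded k V) (n : ℤ) : U.Obj R n →ₗ[BoundAlgebra k R] U.Obj R (n + 1) :=
  DirectSum.toModule (BoundAlgebra k R) _ _ fun i => U.dRight R i.1 (n + 1) + U.dLeft R i.1 (n + 1)

/-- Any two neighbouring letters of the diagram may be neighbours in a homotopy string. -/
def IsReduced (U : Unfolded k V) : Prop :=
  ∀ i p q, U.letter i = some p → U.letter (U.next i) = some q → Junction R p q

open Classical in
/-- The map in degree `n` whose only component is right multiplication by `a` from the summand of
the bullet `i` to the summand of the bullet `j`. -/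
def singleComponent (U U' : Unfolded k V) (i : U.ι) (j : U'.ι) (a : BoundAlgebra k R) (n : ℤ) :
    U.Obj R n →ₗ[BoundAlgebra k R] U'.Obj R n :=
  DirectSum.toModule (BoundAlgebra k R) _ _ fun s =>
    if s.1 = i then U'.into R (U.vert s.1) j a n else 0

variable {R}

theorem d_lof (U : Unfolded k V) (n : ℤ)
    [DecidableEq {i : U.ι // U.IsBullet i ∧ U.degree i = n}]
    (i : {i : U.ι // U.IsBullet i ∧ U.degree i = n}) (z : Proj k R (U.vert i.1)) :
    U.d R n (DirectSum.lof (BoundAlgebra k R) _ (fun i => Proj k R (U.vert i.1)) i z) =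
      U.dRight R i.1 (n + 1) z + U.dLeft R i.1 (n + 1) z := by
  rw [d, ← LinearMap.add_apply]
  convert DirectSum.toModule_lof (BoundAlgebra k R)
    (φ := fun i : {i : U.ι // U.IsBullet i ∧ U.degree i = n} =>
      U.dRight R i.1 (n + 1) + U.dLeft R i.1 (n + 1)) i z

theorem into_into (U : Unfolded k V) (u v : V) (j : U.ι) (a b : BoundAlgebra k R) (n : ℤ)
    (h : a * idem k R v * b = 0) (z : Proj k R u) :
    U.into R v j b n (rmul k R u v a z) = 0 := by
  unfold into
  split_ifs
  · have : rmul k R v (U.vert j) b (rmul k R u v a z) = 0 := by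
      ext
      change z.1 * a * idem k R v * b * idem k R (U.vert j) = 0
      rw [mul_assoc (z.1 * a), mul_assoc z.1, ← mul_assoc a, h, mul_zero, zero_mul]
    rw [LinearMap.comp_apply, this, map_zero]
  · rfl

theorem d_dRight (U : Unfolded k V) (hU : U.IsReduced R) (n : ℤ) (i : U.ι)
    (z : Proj k R (U.vert i)) : U.d R n (U.dRight R i n z) = 0 := by
  classical
  rcases hp : U.letter i with _ | p
  · simp [dRight, hp]
  by_cases hd : p.direct = true
  swap
  · simp [dRight, hp, hd]
  simp only [dRight, hp, hd, if_true]
  unfold into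
  split_ifs with h
  swap
  · simp
  rw [LinearMap.comp_apply, d_lof]
  have h2 : U.dLeft R (U.next i) (n + 1) = 0 := by simp [dLeft, hp, hd]
  rw [h2, LinearMap.zero_apply, add_zero]
  rcases hq : U.letter (U.next i) with _ | q
  · simp [dRight, hq]
  by_cases hd' : q.direct = true
  swap
  · simp [dRight, hq, hd']
  simp only [dRight, hq, hd', if_true]
  apply into_into
  rw [smul_mul_assoc, smul_mul_assoc, mul_smul_comm,
    pathElt_mul_idem_mul_pathElt ((hU i p q hp hq).2.1 hd hd'), smul_zero, smul_zero]

theorem d_dLeft (U : Unfolded k V) (hU : U.IsReduced R) (n : ℤ) (i : U.ι)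
    (z : Proj k R (U.vert i)) : U.d R n (U.dLeft R i n z) = 0 := by
  classical
  rcases hp : U.letter (U.next.symm i) with _ | p
  · simp [dLeft, hp]
  by_cases hd : p.direct = true
  · simp [dLeft, hp, hd]
  simp only [dLeft, hp, hd]
  unfold into
  simp only [Bool.false_eq_true, if_false]
  split_ifs with h
  swap
  · simp
  rw [LinearMap.comp_apply, d_lof]
  have h2 : U.dRight R (U.next.symm i) (n + 1) = 0 := by simp [dRight, hp, hd]
  rw [h2, LinearMap.zero_apply, zero_add]
  rcases hq : U.letter (U.next.symm (U.next.symm i)) with _ | q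
  · simp [dLeft, hq]
  by_cases hd' : q.direct = true
  · simp [dLeft, hq, hd']
  simp only [dLeft, hq, hd', Bool.false_eq_true, if_false]
  apply into_into
  rw [smul_mul_assoc, smul_mul_assoc, mul_smul_comm,
    pathElt_mul_idem_mul_pathElt ((hU _ q p hq (by simpa using hp)).2.2.1 (by simpa using hd')
      (by simpa using hd)), smul_zero, smul_zero]

theorem d_comp_d (U : Unfolded k V) (hU : U.IsReduced R) (n : ℤ) :
    (U.d R (n + 1)).comp (U.d R n) = 0 := by
  classical
  refine DirectSum.linearMap_ext _ fun i => LinearMap.ext fun z => ?_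
  rw [LinearMap.comp_apply, LinearMap.comp_apply, d_lof, map_add, U.d_dRight hU, U.d_dLeft hU,
    add_zero]
  rfl

/-- The complex of projective left `kQ/I`-modules of an unfolded diagram. -/
def complex (U : Unfolded k V) (hU : U.IsReduced R) :
    CochainComplex (ModuleCat.{u} (BoundAlgebra k R)) ℤ :=
  CochainComplex.of (fun n => ModuleCat.of (BoundAlgebra k R) (U.Obj R n))
    (fun n => ModuleCat.ofHom (U.d R n))
    (fun n => by rw [← ModuleCat.ofHom_comp, U.d_comp_d hU]; rfl)

end Unfolded

variable {R}

/-- The unfolded diagram of a homotopy string. -/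
def stringDiagram (s : PointedWord V) : Unfolded k V where
  ι := ℤ
  next := Equiv.addRight 1
  IsBullet := s.IsBullet
  vert := s.vert
  degree := s.degree
  letter := s.letter
  coeff _ := 1

/-- The unfolded diagram of a homotopy band `σ = [σ_n, …, σ_1]` with a scalar `lam` placed on the
letter at position `m` of this list. The bullet `t` is the left end of the letter at position `t`,
and the bullet `0` sits in cohomological degree `deg`. -/
def bandDiagram (σ : List (Letter V)) (lam : k) (m : Fin σ.length) (deg : ℤ) : Unfolded k V where
  ι := Fin σ.length
  next := finRotate σ.length
  IsBullet _ := True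
  vert t := (σ.get t).leftVertex
  degree t := deg + ((σ.take t).map Letter.sign).sum
  letter t := some (σ.get t)
  coeff t := if t = m then lam else 1

theorem stringDiagram_isReduced {s : PointedWord V} (hs : IsHomotopyString R s) :
    (stringDiagram k s).IsReduced R :=
  fun i p q hp hq => hs.junction i p q hp hq

theorem bandDiagram_isReduced {σ : List (Letter V)} (hσ : IsHomotopyBand R σ) (lam : k)
    (m : Fin σ.length) (deg : ℤ) : (bandDiagram k σ lam m deg).IsReduced R := by
  intro i p q hp hq
  obtain rfl := Option.some.inj hp
  obtain rfl := Option.some.inj hq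
  exact hσ.junction i

/-- The string complex `P_s`. -/
def stringComplex {s : PointedWord V} (hs : IsHomotopyString R s) :
    CochainComplex (ModuleCat.{u} (BoundAlgebra k R)) ℤ :=
  (stringDiagram k s).complex (stringDiagram_isReduced k hs)

/-- The (one-dimensional) band complex `B_{σ, lam}`, with the scalar on the letter at position
`m` and the bullet `0` in degree `deg`. -/
def bandComplex {σ : List (Letter V)} (hσ : IsHomotopyBand R σ) (lam : k) (m : Fin σ.length)
    (deg : ℤ) : CochainComplex (ModuleCat.{u} (BoundAlgebra k R)) ℤ :=
  (bandDiagram k σ lam m deg).complex (bandDiagram_isReduced k hσ lam m deg)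

end Complexes

/-! ## Single maps -/

section SingleMaps

variable {V : Type u} [Quiver.{u} V]

/-- The conditions on a nontrivial path `f` in `(Q, I)` to be the component `P(x) → P(y)` of a
single map from the bullet between the letters `σL`, `σR` (at the vertex `x`) to the bullet between
the letters `τL`, `τR` (at the vertex `y`). A missing letter is `none`. -/
structure IsSingleMap (R : Quiver.Total V → Quiver.Total V → Prop) (x y : V)
    (σL σR τL τR : Option (Letter V)) (f : List (Quiver.Total V)) : Prop where
  ne_nil : f ≠ []
  path : IsPath R f
  /-- the path `f` ends at `x` -/
  ends : ∀ h : f ≠ [], (f.head h).right = x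
  /-- the path `f` starts at `y` -/
  starts : ∀ h : f ≠ [], (f.getLast h).left = y
  L1 : ∀ p ∈ σL, p.direct = true → HasRelation R (p.arrows ++ f)
  L2 : ∀ p ∈ τL, p.direct = false → HasRelation R (f ++ p.arrows)
  R1 : ∀ p ∈ σR, p.direct = false → HasRelation R (p.arrows ++ f)
  R2 : ∀ p ∈ τR, p.direct = true → HasRelation R (f ++ p.arrows)

/-- Compatible orientation, with `σR = f fR` and `τR = f̄ f̄L`. For condition (i), that `σL` and `τL`
do not contain `f`, only the occurrences of `f` at the end of the letter where `f` is attached are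
excluded. -/
structure CompatiblyOriented (R : Quiver.Total V → Quiver.Total V → Prop)
    (σL σR τL τR : Option (Letter V)) (f fL fR : List (Quiver.Total V)) : Prop where
  not_in_σL : ∀ p ∈ σL, p.direct = false → ¬ f <+: p.arrows
  not_in_τL : ∀ p ∈ τL, p.direct = true → ¬ f <:+ p.arrows
  zero_σL : ∀ p ∈ σL, p.direct = true → HasRelation R (p.arrows ++ f)
  zero_τL : ∀ p ∈ τL, p.direct = false → HasRelation R (f ++ p.arrows)
  σR_eq : ∀ p ∈ σR, p.direct = true ∧ p.arrows = f ++ fR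
  τR_eq : ∀ p ∈ τR, p.direct = false ∧ p.arrows = fL ++ f

end SingleMaps

end GentleCone

end

/-! Let N be the number of letters of σ. Number the bullets of the unwrapped band so that the source
of f is -1, and those of τ so that its target is 0. The word c then consists of τL, δ reversed to
the right of bullet 0, the letter f, one turn of the band on the bullets -N, …, -1, and, if τR is
present, the merged letter and the rest of τ reversed to the left of -N. Hence the bullets of c
correspond to those of the mapping cone, with the same degrees, the band being shifted by one.

A chain map from the cone to P_c is a chain map W from P_τ to P_c together with a null homotopy φ of
f followed by W. Here φ sends every bullet of the band to the same bullet of c, with scalars that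
absorb the signs and λ. Then dφ + φd vanishes except at the source of f, where cutting the band
leaves two terms: f into bullet 0 and f fR into bullet -N (`coneHomotopy_spec`). So W must be a
combination of two graph maps, one r ↦ -r, the identity for r ≤ 0 and equal to fL at r = 1, and one
r ↦ -N - r, the identity for r > 0 and equal to fR at r = 0.

The crux is to continue these two maps beyond their identity parts. If fR is nontrivial, the single
component fR is enough. If it is trivial, the periodic word of the band and the word τ̄L δ̄ both
continue the letter f. They must diverge, and where they do, gentleness provides a map in one of the
two directions (`endMap_or_endMap`, `halfMap_or_halfMap`). A map from the band to τ would be a null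
homotopy of f (`exists_homotopy_of_halfMap`), which is excluded. The other direction gives the map
from τ to the band, and thereby to c. The same argument on the other side, with all letters
inverted, treats fL.

In each degree the resulting map is, under the correspondence of bullets and up to nonzero scalars,
the identity plus a map that moves bullets N steps towards the band. The latter is locally
nilpotent, so the map is bijective (`ConeSetup.bijective_of_cone`), and the cone is isomorphic to
P_c already as a complex.

That f is not null-homotopic is also needed for c to be reduced between f and τ̄L: if a direct τL
ended with the last arrow of f, then f would factor through τL (`homotopy_zero_of_suffix`). The
Morita equivalence enters only as an additive functor, which preserves homotopies and mapping cones.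
-/

namespace GentleCone

noncomputable section

/-! ### Paths and letters as elements of kQ/I. -/

section PathAlgebraElements

variable {k : Type u} [Field k] {V : Type u} [Quiver.{u} V] [Fintype V]
  {R : Quiver.Total V → Quiver.Total V → Prop}

theorem idem_mul_idem (v : V) : idem k R v * idem k R v = idem k R v := by
  rw [idem, ← map_mul, PathAlgebra.gen, ← map_mul, RingQuot.mkAlgHom_rel k (PathRel.idem v)]

theorem idem_mul_arr (a : Quiver.Total V) : idem k R a.right * arr k R a = arr k R a := by
  rw [idem, arr, ← map_mul, PathAlgebra.gen, PathAlgebra.gen, ← map_mul,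
    RingQuot.mkAlgHom_rel k (PathRel.target a)]

theorem arr_mul_idem (a : Quiver.Total V) : arr k R a * idem k R a.left = arr k R a := by
  rw [idem, arr, ← map_mul, PathAlgebra.gen, PathAlgebra.gen, ← map_mul,
    RingQuot.mkAlgHom_rel k (PathRel.source a)]

theorem pathElt_append (l m : List (Quiver.Total V)) :
    pathElt k R (l ++ m) = pathElt k R l * pathElt k R m := by
  simp [pathElt]

theorem pathElt_nil : pathElt k R ([] : List (Quiver.Total V)) = 1 := rfl

theorem idem_mul_pathElt {l : List (Quiver.Total V)} (h : l ≠ []) :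
    idem k R (l.head h).right * pathElt k R l = pathElt k R l := by
  obtain ⟨a, m, rfl⟩ := List.exists_cons_of_ne_nil h
  simp [pathElt, ← mul_assoc, idem_mul_arr]

theorem pathElt_mul_idem {l : List (Quiver.Total V)} (h : l ≠ []) :
    pathElt k R l * idem k R (l.getLast h).left = pathElt k R l := by
  obtain ⟨m, a, rfl⟩ := List.eq_nil_or_concat' l |>.resolve_left h
  simp [pathElt, mul_assoc, arr_mul_idem]

theorem pathElt_mul_pathElt_eq_zero {l m : List (Quiver.Total V)} (hl : l ≠ []) (hm : m ≠ [])
    (h : R (l.getLast hl) (m.head hm)) : pathElt k R l * pathElt k R m = 0 := by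
  have := pathElt_mul_idem_mul_pathElt (k := k) (R := R) (p := ⟨l, hl, true⟩)
    (q := ⟨m, hm, true⟩) h (l.getLast hl).left
  rwa [pathElt_mul_idem hl] at this

variable (k R) in
/-- The element of `kQ/I` of a direct letter; zero for an inverse or missing letter. -/
def dirElt : Option (Letter V) → BoundAlgebra k R
  | none => 0
  | some p => if p.direct then pathElt k R p.arrows else 0

variable (k R) in
/-- The element of `kQ/I` of an inverse letter; zero for a direct or missing letter. -/
def invElt : Option (Letter V) → BoundAlgebra k R
  | none => 0
  | some p => if p.direct then 0 else pathElt k R p.arrows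

@[simp] theorem dirElt_none : dirElt k R (none : Option (Letter V)) = 0 := rfl

@[simp] theorem invElt_none : invElt k R (none : Option (Letter V)) = 0 := rfl

theorem dirElt_of_direct {p : Letter V} (h : p.direct = true) :
    dirElt k R (some p) = pathElt k R p.arrows := by simp [dirElt, h]

theorem dirElt_of_inverse {p : Letter V} (h : p.direct = false) :
    dirElt k R (some p) = 0 := by simp [dirElt, h]

theorem invElt_of_inverse {p : Letter V} (h : p.direct = false) :
    invElt k R (some p) = pathElt k R p.arrows := by simp [invElt, h]

theorem invElt_of_direct {p : Letter V} (h : p.direct = true) :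
    invElt k R (some p) = 0 := by simp [invElt, h]

-- Inverting a letter exchanges its two roles in the differential, which is what makes reading a
-- diagram backwards possible.
@[simp] theorem dirElt_map_inv (o : Option (Letter V)) :
    dirElt k R (o.map Letter.inv) = invElt k R o := by
  rcases o with _ | p
  · rfl
  · rcases h : p.direct <;> simp [dirElt, invElt, Letter.inv, h]

@[simp] theorem invElt_map_inv (o : Option (Letter V)) :
    invElt k R (o.map Letter.inv) = dirElt k R o := by
  rcases o with _ | p
  · rfl
  · rcases h : p.direct <;> simp [dirElt, invElt, Letter.inv, h]

theorem idem_mul_dirElt {o : Option (Letter V)} {v : V}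
    (h : ∀ p, o = some p → p.leftVertex = v) : idem k R v * dirElt k R o = dirElt k R o := by
  rcases o with _ | p
  · simp
  rcases hd : p.direct
  · simp [dirElt_of_inverse hd]
  · rw [← h p rfl, dirElt_of_direct hd, Letter.leftVertex, if_pos hd]
    exact idem_mul_pathElt p.ne_nil

theorem dirElt_mul_idem {o : Option (Letter V)} {v : V}
    (h : ∀ p, o = some p → p.rightVertex = v) : dirElt k R o * idem k R v = dirElt k R o := by
  rcases o with _ | p
  · simp
  rcases hd : p.direct
  · simp [dirElt_of_inverse hd]
  · rw [← h p rfl, dirElt_of_direct hd, Letter.rightVertex, if_pos hd]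
    exact pathElt_mul_idem p.ne_nil

theorem idem_mul_invElt {o : Option (Letter V)} {v : V}
    (h : ∀ p, o = some p → p.rightVertex = v) : idem k R v * invElt k R o = invElt k R o := by
  rcases o with _ | p
  · simp
  rcases hd : p.direct
  · rw [← h p rfl, invElt_of_inverse hd, Letter.rightVertex, hd, if_neg (by simp)]
    exact idem_mul_pathElt p.ne_nil
  · simp [invElt_of_direct hd]

theorem invElt_mul_idem {o : Option (Letter V)} {v : V}
    (h : ∀ p, o = some p → p.leftVertex = v) : invElt k R o * idem k R v = invElt k R o := by
  rcases o with _ | p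
  · simp
  rcases hd : p.direct
  · rw [← h p rfl, invElt_of_inverse hd, Letter.leftVertex, hd, if_neg (by simp)]
    exact pathElt_mul_idem p.ne_nil
  · simp [invElt_of_direct hd]

end PathAlgebraElements

/-! ### Combinatorics of paths in a gentle bound quiver. -/

section GentlePaths

variable {V : Type u} [Quiver.{u} V] {R : Quiver.Total V → Quiver.Total V → Prop}

/-- Only one arrow can follow `c` outside I, and `a` already does. This is the source of most
vanishing products below. -/
theorem IsGentle.rel_of_ne_left (hR : IsGentle R) {a b c : Quiver.Total V} (hab : a ≠ b)
    (ha : a.left = c.right) (hac : ¬ R a c) (hb : b.left = c.right) : R b c := by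
  by_contra h
  exact hab (hR.after_notMem c ⟨ha, hac⟩ ⟨hb, h⟩)

theorem IsGentle.rel_of_ne_right (hR : IsGentle R) {a b c : Quiver.Total V} (hab : a ≠ b)
    (ha : c.left = a.right) (hac : ¬ R c a) (hb : c.left = b.right) : R c b := by
  by_contra h
  exact hab (hR.before_notMem c ⟨ha, hac⟩ ⟨hb, h⟩)

theorem eq_of_encard_le_two {α : Type*} {s : Set α} (hs : s.encard ≤ 2) {a b c : α}
    (ha : a ∈ s) (hb : b ∈ s) (hc : c ∈ s) (hca : c ≠ a) (hcb : c ≠ b) : a = b := by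
  by_contra hab
  have h3 : ({c, a, b} : Set α).encard = 3 := by
    rw [Set.encard_insert_of_notMem (by simp [hca, hcb]), Set.encard_pair hab]
    rfl
  have : ({c, a, b} : Set α).encard ≤ s.encard :=
    Set.encard_le_encard (by rintro x (rfl | rfl | rfl) <;> assumption)
  rw [h3] at this
  exact absurd (this.trans hs) (by decide)

/-- In a gentle quiver an arrow determines the arrow before it in a nonzero path, so two paths with
the same leftmost arrow agree for as long as both last. -/
theorem IsGentle.prefix_or_prefix (hR : IsGentle R) (a : Quiver.Total V) :
    ∀ l m : List (Quiver.Total V), IsPath R (a :: l) → IsPath R (a :: m) →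
      l <+: m ∨ m <+: l := by
  intro l
  induction l generalizing a with
  | nil => intro m _ _; exact Or.inl (List.nil_prefix)
  | cons b l ih =>
    intro m hl hm
    rcases m with _ | ⟨c, m⟩
    · exact Or.inr (List.nil_prefix)
    · rw [IsPath, List.isChain_cons_cons] at hl hm
      obtain rfl : b = c := hR.before_notMem a hl.1 hm.1
      rcases ih b m hl.2 hm.2 with h | h
      · exact Or.inl ((List.cons_prefix_cons).2 ⟨rfl, h⟩)
      · exact Or.inr ((List.cons_prefix_cons).2 ⟨rfl, h⟩)

theorem isPath_reverse {l : List (Quiver.Total V)} :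
    IsPath R l ↔ l.reverse.IsChain fun a b => b.left = a.right ∧ ¬ R b a := by
  rw [IsPath, List.isChain_reverse]

theorem IsGentle.reverse_prefix_or_prefix (hR : IsGentle R) (a : Quiver.Total V) :
    ∀ l m : List (Quiver.Total V),
      (a :: l).IsChain (fun a b => b.left = a.right ∧ ¬ R b a) →
      (a :: m).IsChain (fun a b => b.left = a.right ∧ ¬ R b a) →
      l <+: m ∨ m <+: l := by
  intro l
  induction l generalizing a with
  | nil => intro m _ _; exact Or.inl (List.nil_prefix)
  | cons b l ih =>
    intro m hl hm
    rcases m with _ | ⟨c, m⟩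
    · exact Or.inr (List.nil_prefix)
    · rw [List.isChain_cons_cons] at hl hm
      obtain rfl : b = c := hR.after_notMem a hl.1 hm.1
      rcases ih b m hl.2 hm.2 with h | h
      · exact Or.inl ((List.cons_prefix_cons).2 ⟨rfl, h⟩)
      · exact Or.inr ((List.cons_prefix_cons).2 ⟨rfl, h⟩)

theorem IsGentle.prefix_of_head_eq (hR : IsGentle R) {l m : List (Quiver.Total V)}
    (hl : IsPath R l) (hm : IsPath R m) (hl0 : l ≠ []) (hm0 : m ≠ [])
    (h : l.head hl0 = m.head hm0) : l <+: m ∨ m <+: l := by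
  obtain ⟨a, l, rfl⟩ := List.exists_cons_of_ne_nil hl0
  obtain ⟨b, m, rfl⟩ := List.exists_cons_of_ne_nil hm0
  obtain rfl : a = b := h
  simpa [List.cons_prefix_cons] using hR.prefix_or_prefix a l m hl hm

theorem IsGentle.suffix_of_getLast_eq (hR : IsGentle R) {l m : List (Quiver.Total V)}
    (hl : IsPath R l) (hm : IsPath R m) (hl0 : l ≠ []) (hm0 : m ≠ [])
    (h : l.getLast hl0 = m.getLast hm0) : l <:+ m ∨ m <:+ l := by
  rw [← List.reverse_prefix, ← List.reverse_prefix]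
  rw [isPath_reverse] at hl hm
  obtain ⟨l', a, rfl⟩ := List.eq_nil_or_concat' l |>.resolve_left hl0
  obtain ⟨m', b, rfl⟩ := List.eq_nil_or_concat' m |>.resolve_left hm0
  obtain rfl : a = b := by simpa using h
  simp only [List.reverse_append, List.reverse_cons, List.reverse_nil, List.nil_append,
    List.cons_append] at hl hm ⊢
  simpa [List.cons_prefix_cons] using hR.reverse_prefix_or_prefix a _ _ hl hm

theorem IsPath.getLast_head {l m : List (Quiver.Total V)} (h : IsPath R (l ++ m)) (hl : l ≠ [])
    (hm : m ≠ []) :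
    (l.getLast hl).left = (m.head hm).right ∧ ¬ R (l.getLast hl) (m.head hm) := by
  rw [IsPath, List.isChain_append] at h
  exact h.2.2 _ (List.getLast_mem_getLast? hl) _ (List.head_mem_head? hm)

theorem IsPath.append {l m : List (Quiver.Total V)} (hl : IsPath R l) (hm : IsPath R m)
    (h : ∀ (hl : l ≠ []) (hm : m ≠ []),
      (l.getLast hl).left = (m.head hm).right ∧ ¬ R (l.getLast hl) (m.head hm)) :
    IsPath R (l ++ m) := by
  rw [IsPath, List.isChain_append]
  refine ⟨hl, hm, fun x hx y hy => ?_⟩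
  obtain ⟨h1, rfl⟩ := List.mem_getLast?_eq_getLast hx
  have h2 : m ≠ [] := by rintro rfl; simp at hy
  rw [List.head?_eq_some_head h2] at hy
  obtain rfl := Option.some.inj hy
  exact h h1 h2

theorem IsPath.of_append_left {l m : List (Quiver.Total V)} (h : IsPath R (l ++ m)) :
    IsPath R l := (List.isChain_append.1 h).1

theorem IsPath.of_append_right {l m : List (Quiver.Total V)} (h : IsPath R (l ++ m)) :
    IsPath R m := (List.isChain_append.1 h).2.1

/-- If a product of two paths has a subpath in `I`, it is the one at the junction. -/
theorem HasRelation.junction {l m : List (Quiver.Total V)} (h : HasRelation R (l ++ m))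
    (hl : IsPath R l) (hm : IsPath R m) (hl0 : l ≠ []) (hm0 : m ≠ [])
    (hv : (l.getLast hl0).left = (m.head hm0).right) : R (l.getLast hl0) (m.head hm0) := by
  by_contra hn
  have hp : IsPath R (l ++ m) := hl.append hm fun _ _ => ⟨hv, hn⟩
  obtain ⟨b, a, hba, s, t, hst⟩ := h
  rw [← hst] at hp
  have := (hp.of_append_left).of_append_right
  rw [IsPath, List.isChain_pair] at this
  exact this.2 hba

end GentlePaths

/-! ### Maps between half-infinite words, and the dichotomy at their divergence. -/

section HalfMaps

variable {k : Type u} [Field k] {V : Type u} [Quiver.{u} V] [Fintype V]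
  {R : Quiver.Total V → Quiver.Total V → Prop}

variable (k R) in
/-- Coefficients `a` that commute with the letters of two half-infinite words `p`, `q`: they define
a morphism, away from the starting bullets, between the complexes of words beginning with `p`, `q`. -/
structure HalfMap (p q : ℕ → Option (Letter V)) (a : ℕ → BoundAlgebra k R) : Prop where
  dir : ∀ j, dirElt k R (p j) * a (j + 1) = a j * dirElt k R (q j)
  inv : ∀ j, invElt k R (p j) * a j = a (j + 1) * invElt k R (q j)
  supp : ∀ j, a j ≠ 0 → ∀ m < j, ∃ x y, p m = some x ∧ q m = some y ∧ x.direct = y.direct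
  vert : ∀ j x, p j = some x → idem k R x.rightVertex * a (j + 1) = a (j + 1)
  finite : ∃ K, ∀ j ≥ K, a j = 0

/-- A half-infinite word of homotopy letters that starts at the vertex `v`. -/
structure IsWalk (R : Quiver.Total V → Quiver.Total V → Prop) (v : V)
    (p : ℕ → Option (Letter V)) : Prop where
  path : ∀ j x, p j = some x → IsPath R x.arrows
  junction : ∀ j x y, p j = some x → p (j + 1) = some y → Junction R x y
  start : ∀ x, p 0 = some x → x.leftVertex = v

/-- The vertices of a half-infinite word. -/
def walkVertex (v : V) (p : ℕ → Option (Letter V)) : ℕ → V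
  | 0 => v
  | j + 1 => (p j).elim v Letter.rightVertex

omit [Fintype V] in
theorem IsWalk.leftVertex {v : V} {p : ℕ → Option (Letter V)} (hp : IsWalk R v p) {j : ℕ}
    {x : Letter V} (h : p j = some x) (hj : ∀ m < j, p m ≠ none) :
    x.leftVertex = walkVertex v p j := by
  rcases j with _ | j
  · exact hp.start x h
  · obtain ⟨y, hy⟩ := Option.ne_none_iff_exists'.1 (hj j (Nat.lt_succ_self j))
    rw [walkVertex, hy]
    exact (hp.junction j y x hy h).1.symm

variable (k R) in
/-- The last coefficient `μ` of a half map that is the identity up to a bullet at the vertex `v`,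
where `p`, `p'` and `q`, `q'` are the next two letters. -/
structure EndMap (p p' q q' : Option (Letter V)) (v : V) (μ : BoundAlgebra k R) : Prop where
  dir : dirElt k R p * μ = idem k R v * dirElt k R q
  inv : invElt k R p * idem k R v = μ * invElt k R q
  dir_next : μ * dirElt k R q' = 0
  inv_next : invElt k R p' * μ = 0
  supp : μ ≠ 0 → ∃ x y, p = some x ∧ q = some y ∧ x.direct = y.direct
  vert : ∀ x, p = some x → idem k R x.rightVertex * μ = μ

/-- Along the common letters the map is the identity; only the first letter in which the words
differ and its successor impose a condition, and these are the fields of `EndMap`. -/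
theorem halfMap_of_endMap {v : V} {p q : ℕ → Option (Letter V)} (hp : IsWalk R v p) {J : ℕ}
    (heq : ∀ j < J, p j = q j) (hsome : ∀ j < J, p j ≠ none) {μ : BoundAlgebra k R}
    (hμ : EndMap k R (p J) (p (J + 1)) (q J) (q (J + 1)) (walkVertex v p J) μ) :
    ∃ a, HalfMap k R p q a ∧ a 0 = idem k R v := by
  -- Bullet `J` is the near end of the divergent letter and still carries the identity; bullet `J +
  -- 1` is its far end and carries `μ`.
  let a : ℕ → BoundAlgebra k R := fun j =>
    if j < J + 1 then idem k R (walkVertex v p j) else if j = J + 1 then μ else 0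
  have ha1 : ∀ j, j < J + 1 → a j = idem k R (walkVertex v p j) := fun j h => if_pos h
  have ha2 : a (J + 1) = μ := by simp [a]
  have ha3 : ∀ j, J + 1 < j → a j = 0 := fun j h => by
    simp only [a]
    rw [if_neg (by omega), if_neg (by omega)]
  have hl : ∀ j < J, ∀ x, p j = some x → x.leftVertex = walkVertex v p j :=
    fun j hj x hx => hp.leftVertex hx fun m hm => hsome m (hm.trans hj)
  have hr : ∀ j x, p j = some x → x.rightVertex = walkVertex v p (j + 1) := by
    intro j x hx
    rw [walkVertex, hx]
    rfl
  refine ⟨a, ⟨fun j => ?_, fun j => ?_, fun j hj m hm => ?_, fun j x hx => ?_,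
    J + 2, fun j hj => ha3 j (by omega)⟩, ?_⟩
  · rcases lt_trichotomy j J with h | rfl | h
    · rw [ha1 j (by omega), ha1 (j + 1) (by omega), ← heq j h, dirElt_mul_idem (hr j),
        idem_mul_dirElt (hl j h)]
    · rw [ha1 j (by omega), ha2, hμ.dir]
    · rw [ha3 (j + 1) (by omega), mul_zero]
      rcases eq_or_ne j (J + 1) with rfl | h'
      · rw [ha2, hμ.dir_next]
      · rw [ha3 j (by omega), zero_mul]
  · rcases lt_trichotomy j J with h | rfl | h
    · rw [ha1 j (by omega), ha1 (j + 1) (by omega), ← heq j h, invElt_mul_idem (hl j h),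
        idem_mul_invElt (hr j)]
    · rw [ha1 j (by omega), ha2, hμ.inv]
    · rw [ha3 (j + 1) (by omega), zero_mul]
      rcases eq_or_ne j (J + 1) with rfl | h'
      · rw [ha2, hμ.inv_next]
      · rw [ha3 j (by omega), mul_zero]
  · rcases lt_or_ge m J with h | h
    · obtain ⟨x, hx⟩ := Option.ne_none_iff_exists'.1 (hsome m h)
      exact ⟨x, x, hx, heq m h ▸ hx, rfl⟩
    · rcases eq_or_ne j (J + 1) with rfl | h'
      · obtain rfl : m = J := by omega
        rw [ha2] at hj
        exact hμ.supp hj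
      · exact absurd (ha3 j (by omega)) hj
  · rcases lt_trichotomy j J with h | rfl | h
    · rw [ha1 (j + 1) (by omega), hr j x hx, idem_mul_idem]
    · rw [ha2, hμ.vert x hx]
    · rw [ha3 (j + 1) (by omega), mul_zero]
  · rw [ha1 0 (by omega)]
    rfl

omit [Fintype V] in
theorem Letter.rightVertex_of_direct {x : Letter V} (h : x.direct = true) :
    x.rightVertex = x.last.left := by simp [Letter.rightVertex, h]

omit [Fintype V] in
theorem Letter.rightVertex_of_inverse {x : Letter V} (h : x.direct = false) :
    x.rightVertex = x.first.right := by simp [Letter.rightVertex, h]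

omit [Fintype V] in
theorem Letter.leftVertex_of_direct {x : Letter V} (h : x.direct = true) :
    x.leftVertex = x.first.right := by simp [Letter.leftVertex, h]

omit [Fintype V] in
theorem Letter.leftVertex_of_inverse {x : Letter V} (h : x.direct = false) :
    x.leftVertex = x.last.left := by simp [Letter.leftVertex, h]

/-- A longer direct letter `y = x ν` yields a map from the word through `x` to that through `y`. -/
theorem endMap_of_direct_append (hR : IsGentle R) {x y : Letter V} {p' q' : Option (Letter V)}
    (hxd : x.direct = true) (hyd : y.direct = true) (hy : IsPath R y.arrows)
    {ν : List (Quiver.Total V)} (hν : ν ≠ []) (hxy : y.arrows = x.arrows ++ ν)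
    (hp' : ∀ z ∈ p', Junction R x z) (hq' : ∀ z ∈ q', Junction R y z) :
    EndMap k R (some x) p' (some y) q' x.leftVertex (pathElt k R ν) := by
  have hj := IsPath.getLast_head (hxy ▸ hy) x.ne_nil hν
  have hlast : y.last = ν.getLast hν := by
    simp [Letter.last, hxy, List.getLast_append_of_ne_nil, hν]
  have hfirst : y.leftVertex = x.leftVertex := by
    simp [Letter.leftVertex_of_direct hxd, Letter.leftVertex_of_direct hyd, Letter.first, hxy,
      List.head_append_of_ne_nil, x.ne_nil]
  refine ⟨?_, ?_, ?_, ?_, fun _ => ⟨x, y, rfl, rfl, hxd.trans hyd.symm⟩, ?_⟩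
  · rw [idem_mul_dirElt (by rintro _ ⟨⟩; exact hfirst), dirElt_of_direct hxd,
      dirElt_of_direct hyd, hxy, pathElt_append]
  · rw [invElt_of_direct hxd, invElt_of_direct hyd, zero_mul, mul_zero]
  · rcases q' with _ | z
    · simp
    · rcases hzd : z.direct
      · rw [dirElt_of_inverse hzd, mul_zero]
      · rw [dirElt_of_direct hzd]
        refine pathElt_mul_pathElt_eq_zero hν z.ne_nil ?_
        rw [← hlast]
        exact (hq' z rfl).2.1 hyd hzd
  · rcases p' with _ | z
    · simp
    · rcases hzd : z.direct
      · rw [invElt_of_inverse hzd]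
        refine pathElt_mul_pathElt_eq_zero z.ne_nil hν ?_
        have hz := hp' z rfl
        refine hR.rel_of_ne_left (hz.2.2.2.1 hxd hzd) hj.1 hj.2 ?_
        have := hz.1
        rw [Letter.rightVertex_of_direct hxd, Letter.leftVertex_of_inverse hzd] at this
        exact this.symm.trans hj.1
      · rw [invElt_of_direct hzd, zero_mul]
  · rintro _ ⟨⟩
    rw [Letter.rightVertex_of_direct hxd, show x.last.left = _ from hj.1]
    exact idem_mul_pathElt hν

/-- A longer inverse letter `x̄ = ȳ ν̄` yields a map from the word through `x̄` to that
through `ȳ`. -/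
theorem endMap_of_inverse_append (hR : IsGentle R) {x y : Letter V} {p' q' : Option (Letter V)}
    (hxd : x.direct = false) (hyd : y.direct = false) (hx : IsPath R x.arrows)
    {ν : List (Quiver.Total V)} (hν : ν ≠ []) (hxy : x.arrows = ν ++ y.arrows)
    (hp' : ∀ z ∈ p', Junction R x z) (hq' : ∀ z ∈ q', Junction R y z) :
    EndMap k R (some x) p' (some y) q' x.leftVertex (pathElt k R ν) := by
  have hj := IsPath.getLast_head (hxy ▸ hx) hν y.ne_nil
  have hfirst : x.first = ν.head hν := by
    simp [Letter.first, hxy, List.head_append_of_ne_nil, hν]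
  refine ⟨?_, ?_, ?_, ?_, fun _ => ⟨x, y, rfl, rfl, hxd.trans hyd.symm⟩, ?_⟩
  · rw [dirElt_of_inverse hxd, dirElt_of_inverse hyd, zero_mul, mul_zero]
  · rw [invElt_mul_idem (by rintro _ ⟨⟩; rfl), invElt_of_inverse hxd,
      invElt_of_inverse hyd, hxy, pathElt_append]
  · rcases q' with _ | z
    · simp
    · rcases hzd : z.direct
      · rw [dirElt_of_inverse hzd, mul_zero]
      · rw [dirElt_of_direct hzd]
        refine pathElt_mul_pathElt_eq_zero hν z.ne_nil ?_
        have hz := hq' z rfl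
        refine hR.rel_of_ne_right (hz.2.2.2.2 hyd hzd) hj.1 hj.2 ?_
        have := hz.1
        rw [Letter.rightVertex_of_inverse hyd, Letter.leftVertex_of_direct hzd] at this
        exact hj.1.trans this
  · rcases p' with _ | z
    · simp
    · rcases hzd : z.direct
      · rw [invElt_of_inverse hzd]
        refine pathElt_mul_pathElt_eq_zero z.ne_nil hν ?_
        rw [← hfirst]
        exact (hp' z rfl).2.2.1 hxd hzd
      · rw [invElt_of_direct hzd, zero_mul]
  · rintro _ ⟨⟩
    rw [Letter.rightVertex_of_inverse hxd, hfirst]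
    exact idem_mul_pathElt hν

omit [Fintype V] in
-- After a direct letter the next direct letter must begin with the unique arrow forming a relation.
-- After an inverse letter it must begin with an arrow ending at the same vertex and different from
-- the one just traversed, and at most two arrows end there.
theorem IsGentle.first_eq_first (hR : IsGentle R) {r x y : Letter V} (hx : Junction R r x)
    (hy : Junction R r y) (hxd : x.direct = true) (hyd : y.direct = true) :
    x.first = y.first := by
  rcases hr : r.direct
  · have h1 := hx.1
    have h2 := hy.1
    rw [Letter.rightVertex_of_inverse hr, Letter.leftVertex_of_direct hxd] at h1
    rw [Letter.rightVertex_of_inverse hr, Letter.leftVertex_of_direct hyd] at h2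
    exact eq_of_encard_le_two (hR.ending r.first.right) h1.symm h2.symm rfl
      (hx.2.2.2.2 hr hxd) (hy.2.2.2.2 hr hyd)
  · exact hR.before_mem r.last (hx.2.1 hr hxd) (hy.2.1 hr hyd)

omit [Fintype V] in
theorem IsGentle.last_eq_last (hR : IsGentle R) {r x y : Letter V} (hx : Junction R r x)
    (hy : Junction R r y) (hxd : x.direct = false) (hyd : y.direct = false) :
    x.last = y.last := by
  rcases hr : r.direct
  · exact hR.after_mem r.first (hx.2.2.1 hr hxd) (hy.2.2.1 hr hyd)
  · have h1 := hx.1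
    have h2 := hy.1
    rw [Letter.rightVertex_of_direct hr, Letter.leftVertex_of_inverse hxd] at h1
    rw [Letter.rightVertex_of_direct hr, Letter.leftVertex_of_inverse hyd] at h2
    exact eq_of_encard_le_two (hR.starting r.last.left) h1.symm h2.symm rfl
      (hx.2.2.2.1 hr hxd) (hy.2.2.2.1 hr hyd)

/-- If the source word leaves its last common bullet along a direct letter and the target word along
an inverse one (or either stops), the differentials there impose nothing, and the map may end with
the identity. -/
theorem endMap_zero {p p' q q' : Option (Letter V)} {v : V}
    (hp : ∀ x ∈ p, x.direct = true) (hq : ∀ x ∈ q, x.direct = false) :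
    EndMap k R p p' q q' v 0 := by
  have h1 : invElt k R p = 0 := by
    rcases p with _ | x
    · rfl
    · exact invElt_of_direct (hp x rfl)
  have h2 : dirElt k R q = 0 := by
    rcases q with _ | x
    · rfl
    · exact dirElt_of_inverse (hq x rfl)
  exact ⟨by simp [h2], by simp [h1], by simp, by simp, fun h => absurd rfl h, by simp⟩

/-- Where two words with a common letter `r` diverge, there is a map in one of the two
directions. -/
theorem endMap_or_endMap (hR : IsGentle R) {p p' q q' : Option (Letter V)} {v : V} (r : Letter V)
    (hpv : ∀ x ∈ p, IsPath R x.arrows) (hqv : ∀ x ∈ q, IsPath R x.arrows)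
    (hv : r.rightVertex = v)
    (hrp : ∀ x ∈ p, Junction R r x) (hrq : ∀ x ∈ q, Junction R r x)
    (hp' : ∀ x ∈ p, ∀ y ∈ p', Junction R x y) (hq' : ∀ x ∈ q, ∀ y ∈ q', Junction R x y)
    (hpq : p ≠ q) :
    (∃ μ, EndMap k R p p' q q' v μ) ∨ (∃ μ, EndMap k R q q' p p' v μ) := by
  rcases p with _ | x
  · rcases q with _ | y
    · exact absurd rfl hpq
    · rcases hy : y.direct
      · exact Or.inl ⟨0, endMap_zero (by simp) (by simpa using hy)⟩
      · exact Or.inr ⟨0, endMap_zero (by simpa using hy) (by simp)⟩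
  rcases q with _ | y
  · rcases hx : x.direct
    · exact Or.inr ⟨0, endMap_zero (by simp) (by simpa using hx)⟩
    · exact Or.inl ⟨0, endMap_zero (by simpa using hx) (by simp)⟩
  have hxv : x.leftVertex = v := (hrp x rfl).1.symm.trans hv
  have hyv : y.leftVertex = v := (hrq y rfl).1.symm.trans hv
  have hne : x.direct = y.direct → x.arrows ≠ y.arrows := fun h1 h2 =>
    hpq (congrArg some (Letter.ext h2 h1))
  -- Two letters of equal direction share the arrow at their common end, so one extends the other,
  -- and the quotient is the last coefficient: for inverse letters the longer one belongs to the
  -- source, for direct ones to the target. For opposite directions the map goes from the direct to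
  -- the inverse letter and ends with zero.
  rcases hx : x.direct <;> rcases hy : y.direct
  · have hl := hR.last_eq_last (hrp x rfl) (hrq y rfl) hx hy
    rcases hR.suffix_of_getLast_eq (hpv x rfl) (hqv y rfl) x.ne_nil y.ne_nil hl with h | h
    · obtain ⟨ν, hν⟩ := h
      refine Or.inr ⟨_, hyv ▸ endMap_of_inverse_append hR hy hx (hqv y rfl) (ν := ν) ?_ hν.symm
        (hq' y rfl) (hp' x rfl)⟩
      rintro rfl
      exact hne (hx.trans hy.symm) (by simpa using hν)
    · obtain ⟨ν, hν⟩ := h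
      refine Or.inl ⟨_, hxv ▸ endMap_of_inverse_append hR hx hy (hpv x rfl) (ν := ν) ?_ hν.symm
        (hp' x rfl) (hq' y rfl)⟩
      rintro rfl
      exact hne (hx.trans hy.symm) (by simpa using hν.symm)
  · exact Or.inr ⟨0, endMap_zero (by simpa using hy) (by simpa using hx)⟩
  · exact Or.inl ⟨0, endMap_zero (by simpa using hx) (by simpa using hy)⟩
  · have hl := hR.first_eq_first (hrp x rfl) (hrq y rfl) hx hy
    rcases hR.prefix_of_head_eq (hpv x rfl) (hqv y rfl) x.ne_nil y.ne_nil hl with h | h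
    · obtain ⟨ν, hν⟩ := h
      refine Or.inl ⟨_, hxv ▸ endMap_of_direct_append hR hx hy (hqv y rfl) (ν := ν) ?_ hν.symm
        (hp' x rfl) (hq' y rfl)⟩
      rintro rfl
      exact hne (hx.trans hy.symm) (by simpa using hν)
    · obtain ⟨ν, hν⟩ := h
      refine Or.inr ⟨_, hyv ▸ endMap_of_direct_append hR hy hx (hpv x rfl) (ν := ν) ?_ hν.symm
        (hq' y rfl) (hp' x rfl)⟩
      rintro rfl
      exact hne (hx.trans hy.symm) (by simpa using hν.symm)

/-- Let `p` be a periodic word and `q` another word that continue a common letter `r`. Then there is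
a map from `p` to `q`, or from `q` to the word `c` that runs once through `p` and continues
with `q`. -/
theorem halfMap_or_halfMap (hR : IsGentle R) {v : V} {p q c : ℕ → Option (Letter V)}
    (hp : IsWalk R v p) (hq : IsWalk R v q) (hsome : ∀ j, p j ≠ none) (r : Letter V)
    (hv : r.rightVertex = v)
    (hrp : ∀ x, p 0 = some x → Junction R r x) (hrq : ∀ x, q 0 = some x → Junction R r x)
    (hpq : ∃ j, p j ≠ q j) {n : ℕ} (hn : 2 ≤ n) (hper : ∀ j, p (j + n) = p j)
    (hc1 : ∀ j < n, c j = p j) (hc2 : ∀ j, c (j + n) = q j) :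
    (∃ a, HalfMap k R p q a ∧ a 0 = idem k R v) ∨
      (∃ a, HalfMap k R q c a ∧ a 0 = idem k R v) := by
  classical
  obtain ⟨J, hJ, hmin⟩ : ∃ J, p J ≠ q J ∧ ∀ j < J, p j = q j :=
    ⟨Nat.find hpq, Nat.find_spec hpq, fun j hj => not_not.1 (Nat.find_min hpq hj)⟩
  -- After one period `c` reads `q`, which agrees with the periodic word `p` before `J`. The letter
  -- after the divergent one is needed too, and `j - n < J` for `j ≤ J + 1` is where `2 ≤ n` enters.
  have hc : ∀ j ≤ J + 1, c j = p j := by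
    intro j hj
    rcases lt_or_ge j n with h | h
    · exact hc1 j h
    · obtain ⟨m, rfl⟩ := Nat.exists_eq_add_of_le' h
      rw [hc2, hper, hmin m (by omega)]
  have hvq : walkVertex v q J = walkVertex v p J := by
    rcases J with _ | J
    · rfl
    · rw [walkVertex, walkVertex, hmin J (by omega)]
  -- The letter just before the divergence: the common predecessor `r`, or the last letter that the
  -- two words share.
  obtain ⟨s, hs1, hs2, hs3⟩ : ∃ s : Letter V, s.rightVertex = walkVertex v p J ∧
      (∀ x, p J = some x → Junction R s x) ∧ (∀ x, q J = some x → Junction R s x) := by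
    rcases J with _ | J
    · exact ⟨r, hv, hrp, hrq⟩
    · obtain ⟨s, hs⟩ := Option.ne_none_iff_exists'.1 (hsome J)
      refine ⟨s, by rw [walkVertex, hs]; rfl, fun x hx => hp.junction J s x hs hx,
        fun x hx => hq.junction J s x ?_ hx⟩
      rw [← hmin J (by omega), hs]
  rcases endMap_or_endMap (k := k) hR s (p' := p (J + 1)) (q' := q (J + 1)) (hp.path J)
    (hq.path J) hs1 hs2 hs3 (fun x hx y hy => hp.junction J x y hx hy)
    (fun x hx y hy => hq.junction J x y hx hy) hJ with ⟨μ, hμ⟩ | ⟨μ, hμ⟩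
  · exact Or.inl (halfMap_of_endMap hp hmin (fun j _ => hsome j) hμ)
  · refine Or.inr (halfMap_of_endMap (μ := μ) hq (J := J) (fun j hj => ?_) (fun j hj => ?_) ?_)
    · rw [hc j (by omega), hmin j hj]
    · rw [← hmin j hj]
      exact hsome j
    · rw [hc J (by omega), hc (J + 1) le_rfl, hvq]
      exact hμ

end HalfMaps

/-! ### Generators of the terms of a complex, single components, and homotopies from half maps. -/

section Elements

variable {k : Type u} [Field k] {V : Type u} [Quiver.{u} V] [Fintype V]
  {R : Quiver.Total V → Quiver.Total V → Prop}

namespace Unfolded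

open Classical in
/-- The element `a e_v` of the summand `P(v)` of the bullet `j`, or zero if this bullet does not
contribute to the degree `n`. -/
def elt (U : Unfolded k V) (n : ℤ) (j : U.ι) (a : BoundAlgebra k R) : U.Obj R n :=
  if h : U.IsBullet j ∧ U.degree j = n then
    DirectSum.lof (BoundAlgebra k R) {i : U.ι // U.IsBullet i ∧ U.degree i = n}
      (fun i => Proj k R (U.vert i.1)) ⟨j, h⟩
      ⟨a * idem k R (U.vert j), Submodule.mem_span_singleton.2 ⟨a, rfl⟩⟩
  else 0

theorem elt_of_not (U : Unfolded k V) {n : ℤ} {j : U.ι} (h : ¬ (U.IsBullet j ∧ U.degree j = n))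
    (a : BoundAlgebra k R) : U.elt n j a = 0 := dif_neg h

theorem smul_elt (U : Unfolded k V) (n : ℤ) (j : U.ι) (a b : BoundAlgebra k R) :
    b • U.elt n j a = U.elt n j (b * a) := by
  unfold elt
  split_ifs
  · rw [← map_smul]
    congr 1
    ext
    simp [mul_assoc]
  · exact smul_zero b

theorem elt_add (U : Unfolded k V) (n : ℤ) (j : U.ι) (a b : BoundAlgebra k R) :
    U.elt n j (a + b) = U.elt n j a + U.elt n j b := by
  unfold elt
  split_ifs
  · rw [← map_add]
    congr 1
    ext
    simp [add_mul]
  · simp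

@[simp] theorem elt_zero (U : Unfolded k V) (n : ℤ) (j : U.ι) :
    U.elt n j (0 : BoundAlgebra k R) = 0 := by
  simpa using (U.smul_elt n j (1 : BoundAlgebra k R) 0).symm

theorem elt_mul_idem (U : Unfolded k V) (n : ℤ) (j : U.ι) (a : BoundAlgebra k R) :
    U.elt n j (a * idem k R (U.vert j)) = U.elt n j a := by
  unfold elt
  simp only [mul_assoc, idem_mul_idem]

theorem lof_eq_elt (U : Unfolded k V) (n : ℤ)
    [DecidableEq {i : U.ι // U.IsBullet i ∧ U.degree i = n}]
    (i : {i : U.ι // U.IsBullet i ∧ U.degree i = n}) (z : Proj k R (U.vert i.1)) :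
    DirectSum.lof (BoundAlgebra k R) _ (fun i => Proj k R (U.vert i.1)) i z =
      U.elt n i.1 z.1 := by
  have hz : z.1 * idem k R (U.vert i.1) = z.1 := by
    obtain ⟨b, hb⟩ := Submodule.mem_span_singleton.1 z.2
    rw [← hb, smul_eq_mul, mul_assoc, idem_mul_idem]
  rw [elt, dif_pos i.2]
  have : (⟨z.1 * idem k R (U.vert i.1), Submodule.mem_span_singleton.2 ⟨z.1, rfl⟩⟩ :
      Proj k R (U.vert i.1)) = z := Subtype.ext hz
  rw [this]
  congr!

theorem into_apply (U : Unfolded k V) (v : V) (j : U.ι) (a : BoundAlgebra k R) (n : ℤ)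
    (z : Proj k R v) : U.into R v j a n z = U.elt n j (z.1 * a) := by
  unfold into elt
  split_ifs
  · rfl
  · rfl

theorem obj_induction (U : Unfolded k V) {n : ℤ} {C : U.Obj R n → Prop} (x : U.Obj R n)
    (zero : C 0) (add : ∀ x y, C x → C y → C (x + y))
    (elt : ∀ j a, U.IsBullet j → U.degree j = n → C (U.elt n j a)) : C x := by
  classical
  induction x using DirectSum.induction_on with
  | zero => exact zero
  | add x y hx hy => exact add x y hx hy
  | of i z =>
    have := U.lof_eq_elt n i z
    rw [DirectSum.lof_eq_of] at this
    rw [this]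
    exact elt _ _ i.2.1 i.2.2

theorem hom_ext_elt (U : Unfolded k V) {n : ℤ} {X : Type*} [AddCommMonoid X]
    [Module (BoundAlgebra k R) X] {φ ψ : U.Obj R n →ₗ[BoundAlgebra k R] X}
    (h : ∀ j, U.IsBullet j → U.degree j = n → φ (U.elt n j 1) = ψ (U.elt n j 1)) : φ = ψ := by
  refine LinearMap.ext fun x => U.obj_induction (C := fun x => φ x = ψ x) x ?_ ?_ ?_
  · rw [map_zero, map_zero]
  · intro x y hx hy
    rw [map_add, map_add, hx, hy]
  · intro j a hj hd
    rw [← mul_one a, ← smul_elt, map_smul, map_smul, h j hj hd]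

open Classical in
/-- The linear map that sends the generator of the summand of the bullet `j` to `e_v y j`. -/
def lift (U : Unfolded k V) (n : ℤ) {X : Type*} [AddCommGroup X]
    [Module (BoundAlgebra k R) X] (y : U.ι → X) : U.Obj R n →ₗ[BoundAlgebra k R] X :=
  DirectSum.toModule (BoundAlgebra k R) _ _ fun i =>
    (LinearMap.toSpanSingleton (BoundAlgebra k R) X (y i.1)).comp (Submodule.subtype _)

theorem lift_elt (U : Unfolded k V) (n : ℤ) {X : Type*} [AddCommGroup X]
    [Module (BoundAlgebra k R) X] (y : U.ι → X) {j : U.ι} (hj : U.IsBullet j)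
    (hd : U.degree j = n) (a : BoundAlgebra k R) :
    U.lift n y (U.elt n j a) = (a * idem k R (U.vert j)) • y j := by
  classical
  rw [elt, dif_pos ⟨hj, hd⟩, lift]
  erw [DirectSum.toModule_lof]
  rfl

/-- The vertices and degrees of the bullets are those given by the letters. -/
structure Coherent (U : Unfolded k V) : Prop where
  left : ∀ j p, U.letter j = some p → U.IsBullet j ∧ p.leftVertex = U.vert j
  right : ∀ j p, U.letter j = some p → U.IsBullet (U.next j) ∧ p.rightVertex = U.vert (U.next j)
  degree : ∀ j p, U.letter j = some p → U.degree (U.next j) = U.degree j + p.sign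

/-- Coherence makes the bullets and degrees at the two ends of a letter fit together. So the formula
needs no hypothesis on `j`: if this bullet is missing in degree `n`, all terms are zero. -/
theorem d_elt (U : Unfolded k V) (hU : U.Coherent) (n : ℤ) (j : U.ι) (a : BoundAlgebra k R) :
    U.d R n (U.elt n j a) =
      U.elt (n + 1) (U.next j) (a * (U.coeff j • dirElt k R (U.letter j))) +
      U.elt (n + 1) (U.next.symm j)
        (a * (U.coeff (U.next.symm j) • invElt k R (U.letter (U.next.symm j)))) := by
  classical
  by_cases h : U.IsBullet j ∧ U.degree j = n
  · conv_lhs => rw [elt, dif_pos h, d_lof]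
    congr 1
    · rcases hp : U.letter j with _ | p
      · simp [dRight, hp]
      · rcases hd : p.direct
        · simp [dRight, hp, hd, dirElt]
        · simp only [dRight, hp, hd, if_true, into_apply, dirElt]
          rw [mul_assoc, mul_smul_comm, ← dirElt_of_direct (k := k) (R := R) hd,
            idem_mul_dirElt]
          rintro _ ⟨⟩
          exact (hU.left j p hp).2
    · rcases hp : U.letter (U.next.symm j) with _ | p
      · simp [dLeft, hp]
      · rcases hd : p.direct
        · simp only [dLeft, hp, hd, Bool.false_eq_true, if_false, into_apply, invElt]
          rw [mul_assoc, mul_smul_comm, ← invElt_of_inverse (k := k) (R := R) hd,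
            idem_mul_invElt]
          rintro _ ⟨⟩
          simpa using (hU.right _ p hp).2
        · simp [dLeft, hp, hd, invElt]
  · rw [U.elt_of_not h, map_zero]
    have h1 : U.elt (n + 1) (U.next j) (a * (U.coeff j • dirElt k R (U.letter j))) = 0 := by
      rcases hp : U.letter j with _ | p
      · simp
      · rcases hd : p.direct
        · simp [dirElt_of_inverse hd]
        · refine U.elt_of_not (fun h' => h ⟨(hU.left j p hp).1, ?_⟩) _
          have := hU.degree j p hp
          rw [h'.2, Letter.sign, if_pos hd] at this
          omega
    have h2 : U.elt (n + 1) (U.next.symm j)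
        (a * (U.coeff (U.next.symm j) • invElt k R (U.letter (U.next.symm j)))) = 0 := by
      rcases hp : U.letter (U.next.symm j) with _ | p
      · simp
      · rcases hd : p.direct
        · refine U.elt_of_not (fun h' => h ⟨by simpa using (hU.right _ p hp).1, ?_⟩) _
          have := hU.degree _ p hp
          rw [h'.2, Letter.sign, hd, if_neg (by simp), Equiv.apply_symm_apply] at this
          omega
        · simp [invElt_of_direct hd]
    rw [h1, h2, add_zero]

/-- The diagram read from right to left. -/
def rev (U : Unfolded k V) : Unfolded k V where
  ι := U.ι
  next := U.next.symm
  IsBullet := U.IsBullet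
  vert := U.vert
  degree := U.degree
  letter j := (U.letter (U.next.symm j)).map Letter.inv
  coeff j := U.coeff (U.next.symm j)

omit [Field k] [Fintype V] in
theorem Coherent.rev {U : Unfolded k V} (hU : U.Coherent) : U.rev.Coherent := by
  have key : ∀ (j : U.ι) p, (U.letter (U.next.symm j)).map Letter.inv = some p →
      ∃ q, U.letter (U.next.symm j) = some q ∧ q.inv = p := fun j p hp => by
    simpa using hp
  refine ⟨fun j p hp => ?_, fun j p hp => ?_, fun j p hp => ?_⟩
  · obtain ⟨q, hq, rfl⟩ := key j p hp
    have := hU.right _ q hq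
    have e : U.next (U.next.symm j) = j := U.next.apply_symm_apply j
    rw [e] at this
    refine ⟨this.1, ?_⟩
    change q.inv.leftVertex = U.vert j
    rw [← this.2]
    rcases hd : q.direct <;> simp [Letter.inv, Letter.leftVertex, Letter.rightVertex, hd,
      Letter.first, Letter.last]
  · obtain ⟨q, hq, rfl⟩ := key j p hp
    have := hU.left _ q hq
    refine ⟨this.1, ?_⟩
    change q.inv.rightVertex = U.vert (U.next.symm j)
    rw [← this.2]
    rcases hd : q.direct <;> simp [Letter.inv, Letter.leftVertex, Letter.rightVertex, hd,
      Letter.first, Letter.last]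
  · obtain ⟨q, hq, rfl⟩ := key j p hp
    have := hU.degree _ q hq
    have e : U.next (U.next.symm j) = j := U.next.apply_symm_apply j
    rw [e] at this
    change U.degree (U.next.symm j) = U.degree j + q.inv.sign
    rw [this]
    rcases hd : q.direct <;> simp [Letter.inv, Letter.sign, hd]

/-- Reading backwards swaps the two summands of the differential. Words that run to the left can
thus be handled by statements about words that run to the right. -/
theorem rev_d (U : Unfolded k V) (hU : U.Coherent) (n : ℤ) : U.rev.d R n = U.d R n := by
  refine U.hom_ext_elt fun j _ _ => ((U.rev.d_elt hU.rev n j 1).trans ?_).trans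
    (U.d_elt hU n j 1).symm
  change U.elt (n + 1) (U.next.symm j) (1 * (U.coeff (U.next.symm j) •
      dirElt k R ((U.letter (U.next.symm j)).map Letter.inv))) +
    U.elt (n + 1) (U.next j) (1 * (U.coeff (U.next.symm (U.next j)) •
      invElt k R ((U.letter (U.next.symm (U.next j))).map Letter.inv))) = _
  rw [dirElt_map_inv, invElt_map_inv, Equiv.symm_apply_apply]
  exact add_comm _ _

open Classical in
/-- The map from degree `p` to degree `q` whose only component is right multiplication by `a` from
the bullet `i` to the bullet `j`. -/
def single (U U' : Unfolded k V) (i : U.ι) (j : U'.ι) (a : BoundAlgebra k R) (p q : ℤ) :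
    U.Obj R p →ₗ[BoundAlgebra k R] U'.Obj R q :=
  U.lift p fun b => if b = i then U'.elt q j a else 0

section Single

variable (U U' : Unfolded k V) {i : U.ι} (j : U'.ι)

open Classical in
theorem single_elt {a : BoundAlgebra k R} (ha : idem k R (U.vert i) * a = a)
    (p q : ℤ) {b : U.ι} (hb : U.IsBullet b) (hd : U.degree b = p) (c : BoundAlgebra k R) :
    U.single U' i j a p q (U.elt p b c) = if b = i then U'.elt q j (c * a) else 0 := by
  rw [single, U.lift_elt p _ hb hd]
  split_ifs with h
  · subst h
    rw [smul_elt, mul_assoc, ha]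
  · rw [smul_zero]

theorem single_add (a b : BoundAlgebra k R) (p q : ℤ) :
    U.single U' i j (a + b) p q = U.single U' i j a p q + U.single U' i j b p q := by
  refine U.hom_ext_elt fun l hl hd => ?_
  rw [LinearMap.add_apply, single, single, single, U.lift_elt p _ hl hd, U.lift_elt p _ hl hd,
    U.lift_elt p _ hl hd, ← smul_add]
  split_ifs
  · rw [elt_add]
  · rw [add_zero]

theorem single_zero (p q : ℤ) : U.single U' i j (0 : BoundAlgebra k R) p q = 0 := by
  refine U.hom_ext_elt fun l hl hd => ?_
  rw [single, U.lift_elt p _ hl hd]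
  simp

theorem d_comp_single (hU' : U'.Coherent) {a : BoundAlgebra k R}
    (ha : idem k R (U.vert i) * a = a) (p q : ℤ) :
    (U'.d R q).comp (U.single U' i j a p q) =
      U.single U' i (U'.next j) (a * (U'.coeff j • dirElt k R (U'.letter j))) p (q + 1) +
      U.single U' i (U'.next.symm j)
        (a * (U'.coeff (U'.next.symm j) • invElt k R (U'.letter (U'.next.symm j))))
        p (q + 1) := by
  classical
  refine U.hom_ext_elt fun l hl hd => ?_
  rw [LinearMap.comp_apply, LinearMap.add_apply, U.single_elt U' j ha p q hl hd,
    U.single_elt U' _ (by rw [← mul_assoc, ha]) p (q + 1) hl hd,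
    U.single_elt U' _ (by rw [← mul_assoc, ha]) p (q + 1) hl hd]
  split_ifs
  · rw [U'.d_elt hU', one_mul, one_mul, one_mul]
  · rw [map_zero, add_zero]

theorem single_comp_d (hU : U.Coherent) {a : BoundAlgebra k R}
    (ha : idem k R (U.vert i) * a = a) (p q : ℤ) :
    (U.single U' i j a (p + 1) q).comp (U.d R p) =
      U.single U' (U.next.symm i) j
        (U.coeff (U.next.symm i) • dirElt k R (U.letter (U.next.symm i)) * a) p q +
      U.single U' (U.next i) j (U.coeff i • invElt k R (U.letter i) * a) p q := by
  classical
  refine U.hom_ext_elt fun l hl hd => ?_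
  -- A nonzero coefficient comes from an existing letter and so forces its end to be a bullet of the
  -- right degree; a zero coefficient needs no such information.
  have key : ∀ (b : U.ι) (c : BoundAlgebra k R),
      (c ≠ 0 → U.IsBullet b ∧ U.degree b = p + 1) →
      U.single U' i j a (p + 1) q (U.elt (p + 1) b c) =
        if b = i then U'.elt q j (c * a) else 0 := by
    intro b c h
    by_cases hc : c = 0
    · simp [hc]
    · exact U.single_elt U' j ha _ _ (h hc).1 (h hc).2 c
  have h1 : idem k R (U.vert (U.next.symm i)) *
      (U.coeff (U.next.symm i) • dirElt k R (U.letter (U.next.symm i)) * a) =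
      U.coeff (U.next.symm i) • dirElt k R (U.letter (U.next.symm i)) * a := by
    rw [← mul_assoc, mul_smul_comm, idem_mul_dirElt fun x hx => (hU.left _ x hx).2]
  have h2 : idem k R (U.vert (U.next i)) *
      (U.coeff i • invElt k R (U.letter i) * a) = U.coeff i • invElt k R (U.letter i) * a := by
    rw [← mul_assoc, mul_smul_comm, idem_mul_invElt fun x hx => (hU.right _ x hx).2]
  rw [LinearMap.comp_apply, LinearMap.add_apply, U.d_elt hU, map_add,
    U.single_elt U' j h1 p q hl hd, U.single_elt U' j h2 p q hl hd, key, key]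
  · simp only [one_mul]
    congr 1
    · by_cases h : U.next l = i
      · obtain rfl : l = U.next.symm i := by rw [← h, Equiv.symm_apply_apply]
        rw [if_pos h, if_pos rfl]
      · rw [if_neg h, if_neg]
        rintro rfl
        exact h (by simp)
    · by_cases h : U.next.symm l = i
      · obtain rfl : l = U.next i := by rw [← h, Equiv.apply_symm_apply]
        rw [if_pos h, if_pos rfl, Equiv.symm_apply_apply]
      · rw [if_neg h, if_neg]
        rintro rfl
        exact h (by simp)
  · intro h
    rcases hp : U.letter (U.next.symm l) with _ | x
    · simp [hp] at h
    rcases hx : x.direct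
    · refine ⟨(hU.left _ x hp).1, ?_⟩
      have := hU.degree _ x hp
      rw [Letter.sign, hx, if_neg (by simp), Equiv.apply_symm_apply] at this
      omega
    · simp [hp, invElt_of_direct hx] at h
  · intro h
    rcases hp : U.letter l with _ | x
    · simp [hp] at h
    rcases hx : x.direct
    · simp [hp, dirElt_of_inverse hx] at h
    · refine ⟨(hU.right _ x hp).1, ?_⟩
      have := hU.degree _ x hp
      rw [Letter.sign, if_pos hx] at this
      omega

end Single

/-- The scalars that make the components of a half map anticommute with the differentials. -/
def homotopyScalar (U : Unfolded k V) (i : U.ι) : ℕ → k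
  | 0 => 1
  | j + 1 => match U.letter (U.next^[j] i) with
    | none => 0
    | some x => if x.direct then -(U.coeff (U.next^[j] i))⁻¹ * homotopyScalar U i j
        else -U.coeff (U.next^[j] i) * homotopyScalar U i j

omit [Fintype V] in
theorem homotopyScalar_direct (U : Unfolded k V) (hc : ∀ i, U.coeff i ≠ 0) (i : U.ι) {j : ℕ}
    {x : Letter V} (h : U.letter (U.next^[j] i) = some x) (hx : x.direct = true) :
    U.homotopyScalar i j + U.coeff (U.next^[j] i) * U.homotopyScalar i (j + 1) = 0 := by
  have := hc (U.next^[j] i)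
  simp only [homotopyScalar, h, hx, if_true]
  field_simp
  ring

omit [Fintype V] in
theorem homotopyScalar_inverse (U : Unfolded k V) (i : U.ι) {j : ℕ}
    {x : Letter V} (h : U.letter (U.next^[j] i) = some x) (hx : x.direct = false) :
    U.homotopyScalar i (j + 1) + U.coeff (U.next^[j] i) * U.homotopyScalar i j = 0 := by
  simp [homotopyScalar, h, hx]

theorem HalfMap.idem_mul {U : Unfolded k V} (hU : U.Coherent) {i : U.ι}
    {q : ℕ → Option (Letter V)} {a : ℕ → BoundAlgebra k R}
    (h : HalfMap k R (fun j => U.letter (U.next^[j] i)) q a)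
    (h0 : idem k R (U.vert i) * a 0 = a 0) (j : ℕ) :
    idem k R (U.vert (U.next^[j] i)) * a j = a j := by
  rcases j with _ | j
  · exact h0
  · by_cases ha : a (j + 1) = 0
    · rw [ha, mul_zero]
    · obtain ⟨x, -, hx, -⟩ := h.supp _ ha j (Nat.lt_succ_self j)
      rw [Function.iterate_succ_apply', ← (hU.right _ x hx).2]
      exact h.vert j x hx

/-- A half map gives a null homotopy of a sum of two single maps. -/
theorem exists_homotopy_of_halfMap (U U' : Unfolded k V) (hU : U.Coherent) (hU' : U'.Coherent)
    (hc : ∀ i, U.coeff i ≠ 0) (hc' : ∀ i, U'.coeff i = 1) (i : U.ι) (i' : U'.ι)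
    {a : ℕ → BoundAlgebra k R}
    (h : HalfMap k R (fun j => U.letter (U.next^[j] i)) (fun j => U'.letter (U'.next^[j] i')) a)
    (h0 : idem k R (U.vert i) * a 0 = a 0) :
    ∃ φ : ∀ p q : ℤ, U.Obj R p →ₗ[BoundAlgebra k R] U'.Obj R q, ∀ p q : ℤ,
      (U'.d R q).comp (φ p q) + (φ (p + 1) (q + 1)).comp (U.d R p) =
        U.single U' i (U'.next.symm i') (a 0 * invElt k R (U'.letter (U'.next.symm i')))
          p (q + 1) +
        U.single U' (U.next.symm i) i'
          (U.coeff (U.next.symm i) • dirElt k R (U.letter (U.next.symm i)) * a 0) p (q + 1) := by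
  obtain ⟨K, hK⟩ := h.finite
  let s := U.homotopyScalar i
  let b : ℕ → U.ι := fun j => U.next^[j] i
  let b' : ℕ → U'.ι := fun j => U'.next^[j] i'
  have hb : ∀ j, b (j + 1) = U.next (b j) := fun j => Function.iterate_succ_apply' _ _ _
  have hb' : ∀ j, b' (j + 1) = U'.next (b' j) := fun j => Function.iterate_succ_apply' _ _ _
  have hid : ∀ j, idem k R (U.vert (b j)) * (s j • a j) = s j • a j := fun j => by
    rw [mul_smul_comm, HalfMap.idem_mul hU h h0 j]
  -- `T j` collects what the `j`-th component contributes to dφ + φd along the letters towards the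
  -- start. Its contribution along the letters away from the start is `-T (j + 1)`, so the sum
  -- telescopes to `T 0`, and `T K` vanishes because the half map is finite.
  let T : ℕ → ∀ p q : ℤ, U.Obj R p →ₗ[BoundAlgebra k R] U'.Obj R q := fun j p q =>
    U.single U' (b j) (U'.next.symm (b' j))
      ((s j • a j) * invElt k R (U'.letter (U'.next.symm (b' j)))) p q +
    U.single U' (U.next.symm (b j)) (b' j)
      (U.coeff (U.next.symm (b j)) • dirElt k R (U.letter (U.next.symm (b j))) * (s j • a j)) p q
  have step : ∀ j p q, (U'.d R q).comp (U.single U' (b j) (b' j) (s j • a j) p q) +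
      (U.single U' (b j) (b' j) (s j • a j) (p + 1) (q + 1)).comp (U.d R p) +
      T (j + 1) p (q + 1) = T j p (q + 1) := by
    intro j p q
    -- The half map commutes with the letters, whereas a homotopy has to anticommute with them; the
    -- scalars `s` make up for the sign and for the coefficients of `U`.
    have hT : U.single U' (b j) (U'.next (b' j))
            ((s j • a j) * dirElt k R (U'.letter (b' j))) p (q + 1) +
        U.single U' (U.next (b j)) (b' j)
            (U.coeff (b j) • invElt k R (U.letter (b j)) * (s j • a j)) p (q + 1) +
        T (j + 1) p (q + 1) = 0 := by
      have hdir := h.dir j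
      have hinv := h.inv j
      change dirElt k R (U.letter (b j)) * a (j + 1) = a j * dirElt k R (U'.letter (b' j)) at hdir
      change invElt k R (U.letter (b j)) * a j = a (j + 1) * invElt k R (U'.letter (b' j)) at hinv
      have e1 : U.coeff (b j) • invElt k R (U.letter (b j)) * (s j • a j) +
          (s (j + 1) • a (j + 1)) * invElt k R (U'.letter (b' j)) = 0 := by
        rw [smul_mul_assoc, smul_mul_assoc, mul_smul_comm, smul_smul, hinv, ← add_smul, add_comm]
        rcases hx : U.letter (b j) with _ | x
        · rw [← hinv, hx]; simp
        · rcases hd : x.direct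
          · rw [U.homotopyScalar_inverse i hx hd, zero_smul]
          · rw [← hinv, hx, invElt_of_direct hd]; simp
      have e2 : (s j • a j) * dirElt k R (U'.letter (b' j)) +
          U.coeff (b j) • dirElt k R (U.letter (b j)) * (s (j + 1) • a (j + 1)) = 0 := by
        rw [smul_mul_assoc, smul_mul_assoc, mul_smul_comm, smul_smul, hdir, ← add_smul]
        rcases hx : U.letter (b j) with _ | x
        · rw [← hdir, hx]; simp
        · rcases hd : x.direct
          · rw [← hdir, hx, dirElt_of_inverse hd]; simp
          · rw [U.homotopyScalar_direct hc i hx hd, zero_smul]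
      simp only [T, hb, hb', Equiv.symm_apply_apply]
      rw [add_comm (U.single U' (U.next (b j)) (b' j) _ p (q + 1)), add_add_add_comm,
        ← single_add, ← single_add, e1, e2, single_zero, single_zero, add_zero]
    rw [d_comp_single U U' _ hU' (hid j), single_comp_d U U' _ hU (hid j)]
    simp only [hc', one_smul]
    rw [← add_zero (T j p (q + 1)), ← hT]
    simp only [T]
    abel
  refine ⟨fun p q => ∑ j ∈ Finset.range K, U.single U' (b j) (b' j) (s j • a j) p q,
    fun p q => ?_⟩
  have sum : ∀ K, (U'.d R q).comp
        (∑ j ∈ Finset.range K, U.single U' (b j) (b' j) (s j • a j) p q) +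
      (∑ j ∈ Finset.range K, U.single U' (b j) (b' j) (s j • a j) (p + 1) (q + 1)).comp
        (U.d R p) + T K p (q + 1) = T 0 p (q + 1) := by
    intro K
    induction K with
    | zero => simp
    | succ K ih =>
      rw [Finset.sum_range_succ, Finset.sum_range_succ, LinearMap.comp_add, LinearMap.add_comp,
        ← ih, ← step K p q]
      abel
  have hTK : T K p (q + 1) = 0 := by
    simp only [T, hK K le_rfl, smul_zero, zero_mul, mul_zero, single_zero, add_zero]
  have hs : s 0 = 1 := rfl
  have := sum K
  rw [hTK, add_zero] at this
  rw [this]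
  simp only [T, hs, one_smul]
  rfl

end Unfolded

end Elements

/-! ### Strings and bands have coherent diagrams. -/

section Diagrams

variable {k : Type u} [Field k] {V : Type u} [Quiver.{u} V]
  {R : Quiver.Total V → Quiver.Total V → Prop}

theorem stringDiagram_coherent {s : PointedWord V} (hs : IsHomotopyString R s) :
    (stringDiagram k s).Coherent := by
  refine ⟨fun t p hp => ?_, fun t p hp => ?_, fun t p hp => ?_⟩
  · rcases t with (_ | n) | n
    · exact ⟨trivial, hs.base_right p hp⟩
    · change s.right.get? (n + 1) = some p at hp
      obtain ⟨q, hq⟩ := s.right.ge_stable (Nat.le_succ n) hp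
      refine ⟨by change (s.right.get? n).isSome; rw [hq]; rfl, ?_⟩
      change p.leftVertex = (s.right.get? n).elim s.base Letter.rightVertex
      rw [hq]
      exact (hs.junction (Int.ofNat n) q p hq hp).1.symm
    · change s.left.get? n = some p at hp
      refine ⟨by change (s.left.get? n).isSome; rw [hp]; rfl, ?_⟩
      change p.leftVertex = (s.left.get? n).elim s.base Letter.leftVertex
      rw [hp]
      rfl
  · rcases t with n | (_ | n)
    · change s.right.get? n = some p at hp
      refine ⟨by change (s.right.get? n).isSome; rw [hp]; rfl, ?_⟩
      change p.rightVertex = (s.right.get? n).elim s.base Letter.rightVertex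
      rw [hp]
      rfl
    · exact ⟨trivial, hs.base_left p hp⟩
    · have h0 : s.left.get? (n + 1) = some p := hp
      obtain ⟨q, hq⟩ := s.left.ge_stable (Nat.le_succ n) h0
      refine ⟨by change (s.left.get? n).isSome; rw [hq]; rfl, ?_⟩
      change p.rightVertex = (s.left.get? n).elim s.base Letter.leftVertex
      rw [hq]
      exact (hs.junction (Int.negSucc (n + 1)) p q hp hq).1
  · rcases t with n | (_ | n)
    · change s.right.get? n = some p at hp
      change s.deg + ∑ m ∈ Finset.range (n + 1), (s.right.get? m).elim 0 Letter.sign =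
        s.deg + ∑ m ∈ Finset.range n, (s.right.get? m).elim 0 Letter.sign + p.sign
      rw [Finset.sum_range_succ, hp, add_assoc]
      rfl
    · change s.left.get? 0 = some p at hp
      change s.deg + ∑ m ∈ Finset.range 0, (s.right.get? m).elim 0 Letter.sign =
        s.deg - ∑ m ∈ Finset.range 1, (s.left.get? m).elim 0 Letter.sign + p.sign
      simp [hp]
    · change s.left.get? (n + 1) = some p at hp
      change s.deg - ∑ m ∈ Finset.range (n + 1), (s.left.get? m).elim 0 Letter.sign =
        s.deg - ∑ m ∈ Finset.range (n + 1 + 1), (s.left.get? m).elim 0 Letter.sign + p.sign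
      rw [Finset.sum_range_succ _ (n + 1), hp]
      simp only [Option.elim_some]
      ring

theorem finRotate_val {N : ℕ} (t : Fin N) :
    (finRotate N t : ℕ) = if (t : ℕ) + 1 < N then (t : ℕ) + 1 else 0 := by
  obtain ⟨n, rfl⟩ : ∃ n, N = n + 1 := ⟨N - 1, by have := t.2; omega⟩
  split_ifs with h
  · rw [finRotate_of_lt (by omega)]
  · have : t = Fin.last n := Fin.ext (by have := t.2; rw [Fin.val_last]; omega)
    rw [this, finRotate_last]
    rfl

theorem sum_sign_eq (σ : List (Letter V)) : (σ.map Letter.sign).sum =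
    (σ.countP (fun p => p.direct) : ℤ) - σ.countP (fun p => !p.direct) := by
  induction σ with
  | nil => simp
  | cons p σ ih =>
    rcases hp : p.direct
    · simp [hp, ih, Letter.sign]; ring
    · simp [hp, ih, Letter.sign]; ring

/-- Only the return to the bullet `0` is not local: the degree closes up there because a band has as
many direct as inverse letters. -/
theorem bandDiagram_coherent {σ : List (Letter V)} (hσ : IsHomotopyBand R σ) (lam : k)
    (m : Fin σ.length) (deg : ℤ) : (bandDiagram k σ lam m deg).Coherent := by
  refine ⟨fun t p hp => ⟨trivial, ?_⟩, fun t p hp => ⟨trivial, ?_⟩, fun t p hp => ?_⟩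
  · obtain rfl := Option.some.inj hp
    rfl
  · obtain rfl := Option.some.inj hp
    exact (hσ.junction t).1
  · obtain rfl := Option.some.inj hp
    change Fin σ.length at t
    change deg + ((σ.take (finRotate σ.length t)).map Letter.sign).sum =
      deg + ((σ.take t).map Letter.sign).sum + (σ.get t).sign
    have h1 : ((σ.take (t + 1)).map Letter.sign).sum =
        ((σ.take t).map Letter.sign).sum + (σ.get t).sign := by
      rw [List.take_add_one, List.getElem?_eq_getElem t.2]
      simp
    rw [add_assoc, ← h1]
    congr 1
    rw [finRotate_val]
    split_ifs with ht
    · rfl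
    · rw [List.take_of_length_le (by omega : σ.length ≤ (t : ℕ) + 1), sum_sign_eq σ, hσ.balanced]
      simp

end Diagrams

/-! ### Chain maps and null homotopies from families of linear maps. -/

section Complexes

variable {k : Type u} [Field k] {V : Type u} [Quiver.{u} V] [Fintype V]
  {R : Quiver.Total V → Quiver.Total V → Prop}

open CochainComplex HomComplex

namespace Unfolded

variable {U U' : Unfolded k V} (hU : U.IsReduced R) (hU' : U'.IsReduced R)

/-- A linear map between the terms of two complexes as a morphism of modules. -/
abbrev homOf {p q : ℤ} (φ : U.Obj R p →ₗ[BoundAlgebra k R] U'.Obj R q) :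
    ModuleCat.of (BoundAlgebra k R) (U.Obj R p) ⟶ ModuleCat.of (BoundAlgebra k R) (U'.Obj R q) :=
  ModuleCat.ofHom φ

theorem complex_d (n : ℤ) : (U.complex hU).d n (n + 1) = homOf (U.d R n) :=
  CochainComplex.of_d (fun n => ModuleCat.of (BoundAlgebra k R) (U.Obj R n))
    (fun n => homOf (U.d R n)) n

/-- A family of linear maps as a cochain of degree `-1`. -/
def cochain (φ : ∀ p q : ℤ, U.Obj R p →ₗ[BoundAlgebra k R] U'.Obj R q) :
    Cochain (U.complex hU) (U'.complex hU') (-1) :=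
  Cochain.mk fun p q _ => homOf (φ p q)

theorem δ_cochain (φ : ∀ p q : ℤ, U.Obj R p →ₗ[BoundAlgebra k R] U'.Obj R q)
    (g : U.complex hU ⟶ U'.complex hU')
    (h : ∀ q, g.f (q + 1) = homOf ((U'.d R q).comp (φ (q + 1) q) +
      (φ (q + 1 + 1) (q + 1)).comp (U.d R (q + 1)))) :
    δ (-1) 0 (cochain hU hU' φ) = Cochain.ofHom g := by
  ext p
  -- Writing the degree as a successor makes the types of the components match without transport
  -- along an equality of degrees.
  obtain ⟨q, rfl⟩ : ∃ q, p = q + 1 := ⟨p - 1, by ring⟩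
  rw [δ_v (-1) 0 (by norm_num) _ (q + 1) (q + 1) _ q (q + 1 + 1) (by ring) rfl, Cochain.ofHom_v,
    h, complex_d, complex_d]
  simp only [Int.negOnePow_zero, one_smul]
  rfl

theorem homotopy_zero (φ : ∀ p q : ℤ, U.Obj R p →ₗ[BoundAlgebra k R] U'.Obj R q)
    (g : U.complex hU ⟶ U'.complex hU')
    (h : ∀ q, g.f (q + 1) = homOf ((U'.d R q).comp (φ (q + 1) q) +
      (φ (q + 1 + 1) (q + 1)).comp (U.d R (q + 1)))) : Nonempty (Homotopy g 0) :=
  ⟨(Cochain.equivHomotopy g 0).symm ⟨cochain hU hU' φ, by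
    rw [δ_cochain hU hU' φ g h, Cochain.ofHom_zero, add_zero]⟩⟩

/-- A chain map from its components. -/
def chainMap (φ : ∀ n : ℤ, U.Obj R n →ₗ[BoundAlgebra k R] U'.Obj R n)
    (h : ∀ n, (U'.d R n).comp (φ n) = (φ (n + 1)).comp (U.d R n)) :
    U.complex hU ⟶ U'.complex hU' where
  f n := homOf (φ n)
  comm' n m hnm := by
    obtain rfl : n + 1 = m := hnm
    rw [complex_d, complex_d]
    exact congrArg homOf (h n)

/-- The graph map that sends the bullet `i` to `g i` with coefficient `x i`. -/
def graphMap (U U' : Unfolded k V) (g : U.ι → U'.ι) (x : U.ι → BoundAlgebra k R) (n : ℤ) :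
    U.Obj R n →ₗ[BoundAlgebra k R] U'.Obj R n :=
  U.lift n fun i => U'.elt n (g i) (x i)

/-- The conditions on the coefficients of a graph map. -/
structure IsGraphMap (U U' : Unfolded k V) (g : U.ι → U'.ι) (x : U.ι → BoundAlgebra k R) :
    Prop where
  next : ∀ i, g (U.next i) = U'.next (g i)
  dir : ∀ i, dirElt k R (U.letter i) * x (U.next i) = x i * dirElt k R (U'.letter (g i))
  inv : ∀ i, invElt k R (U.letter i) * x i = x (U.next i) * invElt k R (U'.letter (g i))
  supp : ∀ i, x i ≠ 0 → U.IsBullet i ∧ U.degree i = U'.degree (g i)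
  vert : ∀ i, idem k R (U.vert i) * x i = x i

section

variable {g : U.ι → U'.ι} {x : U.ι → BoundAlgebra k R} (h : IsGraphMap U U' g x)
include h

/-- The support condition makes this valid for every index and degree: where the source element is
zero by default, so is the target element. -/
theorem IsGraphMap.graphMap_elt (n : ℤ) (i : U.ι) (a : BoundAlgebra k R) :
    U.graphMap U' g x n (U.elt n i a) = U'.elt n (g i) (a * x i) := by
  by_cases hi : U.IsBullet i ∧ U.degree i = n
  · rw [graphMap, U.lift_elt n _ hi.1 hi.2, smul_elt, mul_assoc, h.vert]
  · rw [U.elt_of_not hi, map_zero]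
    by_cases hx : x i = 0
    · rw [hx, mul_zero, elt_zero]
    · refine (U'.elt_of_not (fun h' => hi ⟨(h.supp i hx).1, ?_⟩) _).symm
      rw [(h.supp i hx).2, h'.2]

theorem IsGraphMap.comm (hU : U.Coherent) (hU' : U'.Coherent) (hc : ∀ i, U.coeff i = 1)
    (hc' : ∀ i, U'.coeff i = 1) (n : ℤ) :
    (U'.d R n).comp (U.graphMap U' g x n) = (U.graphMap U' g x (n + 1)).comp (U.d R n) := by
  refine U.hom_ext_elt fun i _ _ => ?_
  have hs : g (U.next.symm i) = U'.next.symm (g i) := by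
    rw [Equiv.eq_symm_apply, ← h.next, Equiv.apply_symm_apply]
  have hinv := h.inv (U.next.symm i)
  rw [Equiv.apply_symm_apply, hs] at hinv
  rw [LinearMap.comp_apply, LinearMap.comp_apply, h.graphMap_elt, U.d_elt hU, map_add,
    h.graphMap_elt, h.graphMap_elt, U'.d_elt hU', h.next, hs]
  simp only [hc, hc', one_smul, one_mul]
  rw [h.dir, hinv]

end

end Unfolded

end Complexes

/-! ### Unwrapping the cyclic numbering of the bullets of a band. -/

section BandBullets

/-- The bullets of the unwrapped diagram of a cyclic word, where the bullet `-1` is `i`. -/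
def bandBullet {N : ℕ} (i : Fin N) (t : ℤ) : Fin N := (finRotate N ^ (t + 1)) i

theorem bandBullet_neg_one {N : ℕ} (i : Fin N) : bandBullet i (-1) = i := rfl

theorem bandBullet_succ {N : ℕ} (i : Fin N) (t : ℤ) :
    bandBullet i (t + 1) = finRotate N (bandBullet i t) := by
  rw [bandBullet, bandBullet, add_comm (t + 1) 1, zpow_add, zpow_one, Equiv.Perm.mul_apply]

theorem finRotate_symm_bandBullet {N : ℕ} (i : Fin N) (t : ℤ) :
    (finRotate N).symm (bandBullet i t) = bandBullet i (t - 1) := by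
  rw [Equiv.symm_apply_eq, ← bandBullet_succ, sub_add_cancel]

/-- Turns the powers of the rotation into arithmetic modulo `N`; periodicity and injectivity on
short windows then follow. -/
theorem val_bandBullet {N : ℕ} (i : Fin N) (t : ℤ) :
    ((bandBullet i t : ℕ) : ℤ) = (i + t + 1) % N := by
  have hs : ∀ t : ℤ, ((bandBullet i (t + 1) : ℕ) : ℤ) = ((bandBullet i t : ℕ) + 1 : ℤ) % N := by
    intro t
    have hlt := (bandBullet i t).2
    rw [bandBullet_succ, finRotate_val]
    split_ifs with h
    · rw [Int.emod_eq_of_lt (by positivity) (by exact_mod_cast h)]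
      push_cast
      rfl
    · have : ((bandBullet i t : ℕ) : ℤ) + 1 = N := by omega
      rw [this, Int.emod_self]
      rfl
  have h0 : ((bandBullet i (-1) : ℕ) : ℤ) = (i + -1 + 1) % N := by
    rw [bandBullet_neg_one, neg_add_cancel_right, Int.emod_eq_of_lt (by positivity)]
    exact_mod_cast i.2
  have hup : ∀ n : ℕ, ((bandBullet i (-1 + n) : ℕ) : ℤ) = (i + (-1 + n) + 1) % N := by
    intro n
    induction n with
    | zero => simpa using h0
    | succ n ih =>
      have := hs (-1 + n)
      rw [ih, Int.emod_add_emod] at this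
      push_cast
      rw [← add_assoc (-1 : ℤ), this]
      congr 1
      ring
  have hdown : ∀ n : ℕ, ((bandBullet i (-1 - n) : ℕ) : ℤ) = (i + (-1 - n) + 1) % N := by
    intro n
    induction n with
    | zero => simpa using h0
    | succ n ih =>
      have := hs (-1 - ((n + 1 : ℕ) : ℤ))
      rw [show (-1 - ((n + 1 : ℕ) : ℤ) + 1) = -1 - n by push_cast; ring, ih] at this
      have hlt := (bandBullet i (-1 - ((n + 1 : ℕ) : ℤ))).2
      have h2 : ((i + (-1 - n) + 1 : ℤ)) ≡ ((bandBullet i (-1 - ((n + 1 : ℕ) : ℤ)) : ℕ) + 1 : ℤ)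
        [ZMOD N] := this
      have h3 := h2.sub_right 1
      rw [add_sub_cancel_right] at h3
      have h4 : (i + (-1 - n) : ℤ) = i + (-1 - ((n + 1 : ℕ) : ℤ)) + 1 := by
        push_cast; ring
      rw [h4, add_sub_cancel_right] at h3
      rw [h3.eq, Int.emod_eq_of_lt (by positivity) (by exact_mod_cast hlt)]
  rcases le_total (-1) t with h | h
  · obtain ⟨n, rfl⟩ : ∃ n : ℕ, t = -1 + n := ⟨(t + 1).toNat, by omega⟩
    exact hup n
  · obtain ⟨n, rfl⟩ : ∃ n : ℕ, t = -1 - n := ⟨(-1 - t).toNat, by omega⟩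
    exact hdown n

theorem bandBullet_add_length {N : ℕ} (i : Fin N) (t : ℤ) :
    bandBullet i (t + N) = bandBullet i t := by
  apply Fin.ext
  have : ((bandBullet i (t + N) : ℕ) : ℤ) = (bandBullet i t : ℕ) := by
    rw [val_bandBullet, val_bandBullet, show (i + (t + N) + 1 : ℤ) = i + t + 1 + N by ring,
      Int.add_emod_right]
  exact_mod_cast this

theorem bandBullet_inj {N : ℕ} (i : Fin N) {s t : ℤ} (h : bandBullet i s = bandBullet i t)
    (hst : |s - t| < N) : s = t := by
  have h1 : (i + s + 1 : ℤ) ≡ i + t + 1 [ZMOD N] := by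
    have := congrArg (fun x : Fin N => ((x : ℕ) : ℤ)) h
    simp only [val_bandBullet] at this
    exact this
  have h2 : s ≡ t [ZMOD N] :=
    Int.ModEq.add_left_cancel' (i : ℤ) (Int.ModEq.add_right_cancel' 1 h1)
  have h3 := Int.eq_zero_of_abs_lt_dvd h2.symm.dvd hst
  omega

/-- The number in `[-N, -1]` of a bullet. -/
def bandIndex {N : ℕ} (i b : Fin N) : ℤ := -N + ((b : ℤ) - i - 1) % N

theorem bandIndex_mem {N : ℕ} (i b : Fin N) : -(N : ℤ) ≤ bandIndex i b ∧ bandIndex i b ≤ -1 := by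
  have hN : (0 : ℤ) < N := by have := i.2; omega
  have h1 := Int.emod_nonneg ((b : ℤ) - i - 1) hN.ne'
  have h2 := Int.emod_lt_of_pos ((b : ℤ) - i - 1) hN
  rw [bandIndex]
  omega

theorem bandBullet_bandIndex {N : ℕ} (i b : Fin N) : bandBullet i (bandIndex i b) = b := by
  apply Fin.ext
  have : ((bandBullet i (bandIndex i b) : ℕ) : ℤ) = (b : ℕ) := by
    have h1 : (i + bandIndex i b + 1 : ℤ) = (i + 1 + ((b : ℤ) - i - 1) % N) + N * (-1) := by
      rw [bandIndex]; ring
    rw [val_bandBullet, h1, Int.add_mul_emod_self_left, Int.add_emod_emod,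
      show (i + 1 + ((b : ℤ) - i - 1)) = b by ring,
      Int.emod_eq_of_lt (by positivity) (by exact_mod_cast b.2)]
  exact_mod_cast this

theorem bandIndex_bandBullet {N : ℕ} (i : Fin N) {t : ℤ} (h1 : -(N : ℤ) ≤ t) (h2 : t ≤ -1) :
    bandIndex i (bandBullet i t) = t := by
  have h := bandIndex_mem i (bandBullet i t)
  refine bandBullet_inj i (bandBullet_bandIndex i _) ?_
  rw [abs_lt]
  omega

end BandBullets

/-! ### The word of the cone and why it is a homotopy string. -/

section Letters

variable {V : Type u} [Quiver.{u} V] {R : Quiver.Total V → Quiver.Total V → Prop}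

namespace Letter

@[simp] theorem inv_arrows (p : Letter V) : p.inv.arrows = p.arrows := rfl

@[simp] theorem inv_direct (p : Letter V) : p.inv.direct = !p.direct := rfl

@[simp] theorem inv_first (p : Letter V) : p.inv.first = p.first := rfl

@[simp] theorem inv_last (p : Letter V) : p.inv.last = p.last := rfl

@[simp] theorem inv_inv (p : Letter V) : p.inv.inv = p := by
  ext <;> simp

@[simp] theorem inv_leftVertex (p : Letter V) : p.inv.leftVertex = p.rightVertex := by
  rcases h : p.direct <;> simp [leftVertex, rightVertex, h]

@[simp] theorem inv_rightVertex (p : Letter V) : p.inv.rightVertex = p.leftVertex := by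
  rcases h : p.direct <;> simp [leftVertex, rightVertex, h]

@[simp] theorem inv_sign (p : Letter V) : p.inv.sign = -p.sign := by
  rcases h : p.direct <;> simp [sign, h]

end Letter

theorem Junction.inv {p q : Letter V} (h : Junction R p q) : Junction R q.inv p.inv := by
  obtain ⟨h1, h2, h3, h4, h5⟩ := h
  refine ⟨by simpa using h1.symm, ?_, ?_, ?_, ?_⟩ <;>
    simp only [Letter.inv_direct, Letter.inv_first, Letter.inv_last, Bool.not_eq_true',
      Bool.not_eq_false']
  · exact fun hq hp => h3 hp hq
  · exact fun hq hp => h2 hp hq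
  · exact fun hq hp => (h4 hp hq).symm
  · exact fun hq hp => (h5 hp hq).symm

/-- A junction only depends on the right end of the letter on the left. -/
theorem Junction.congr_left {p p' q : Letter V} (h : Junction R p q) (hd : p.direct = true)
    (hd' : p'.direct = true) (hl : p.last = p'.last) : Junction R p' q := by
  obtain ⟨h1, h2, -, h4, -⟩ := h
  refine ⟨?_, fun _ => hl ▸ h2 hd, by simp [hd'], fun _ => hl ▸ h4 hd, by simp [hd']⟩
  rw [Letter.rightVertex_of_direct hd', ← hl, ← Letter.rightVertex_of_direct hd, h1]

/-- A junction only depends on the left end of the letter on the right. -/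
theorem Junction.congr_right {p q q' : Letter V} (h : Junction R p q) (hd : q.direct = true)
    (hd' : q'.direct = true) (hl : q.first = q'.first) : Junction R p q' := by
  obtain ⟨h1, h2, -, -, h5⟩ := h
  refine ⟨?_, fun h _ => hl ▸ h2 h hd, by simp [hd'], by simp [hd'], fun h _ => hl ▸ h5 h hd⟩
  rw [Letter.leftVertex_of_direct hd', ← hl, ← Letter.leftVertex_of_direct hd, h1]

/-- The standing hypotheses on a compatibly oriented single map `f` from a band to a string: the
component starts at the bullet `i` of the band. -/
structure ConeSetup (R : Quiver.Total V → Quiver.Total V → Prop) (σ : List (Letter V))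
    (i : Fin σ.length) (τ : PointedWord V) (f : List (Quiver.Total V)) (hf : f ≠ [])
    (fL fR : List (Quiver.Total V)) : Prop where
  two_le : 2 ≤ σ.length
  band : IsHomotopyBand R σ
  string : IsHomotopyString R τ
  path : IsPath R f
  ends : (f.head hf).right = (σ.get i).leftVertex
  starts : (f.getLast hf).left = τ.base
  right_direct : (σ.get i).direct = true
  right_arrows : (σ.get i).arrows = f ++ fR
  string_right : ∀ x, τ.letter 0 = some x → x.direct = false ∧ x.arrows = fL ++ f
  left_junction : Junction R (σ.get ((finRotate _).symm i)) ⟨f, hf, true⟩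
  string_left : ∀ x, τ.letter (-1) = some x → Junction R ⟨f, hf, true⟩ x.inv

/-- The homotopy string of the mapping cone, described by its letters. -/
structure IsConeWord (σ : List (Letter V)) (i : Fin σ.length) (τ : PointedWord V)
    (f : List (Quiver.Total V)) (hf : f ≠ []) (fL fR : List (Quiver.Total V))
    (c : PointedWord V) : Prop where
  base : c.base = τ.base
  deg : c.deg = τ.deg
  nonneg : ∀ t ≥ 0, c.letter t = (τ.letter (-t - 1)).map Letter.inv
  neg_one : c.letter (-1) = some ⟨f, hf, true⟩
  band : ∀ t, -(σ.length : ℤ) ≤ t → t ≤ -2 → c.letter t = some (σ.get (bandBullet i t))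
  wrap : c.letter (-σ.length - 1) =
    (τ.letter 0).map fun _ => ⟨fL ++ f ++ fR, by simp [hf], true⟩
  below : ∀ t ≤ -(σ.length : ℤ) - 2,
    c.letter t = (τ.letter (-σ.length - t - 1)).map Letter.inv

section

variable {σ : List (Letter V)} {i : Fin σ.length} {τ : PointedWord V}
  {f : List (Quiver.Total V)} {hf : f ≠ []} {fL fR : List (Quiver.Total V)}
  {c : PointedWord V}

theorem IsHomotopyBand.junction_bandBullet (hσ : IsHomotopyBand R σ) (i : Fin σ.length) (t : ℤ) :
    Junction R (σ.get (bandBullet i t)) (σ.get (bandBullet i (t + 1))) := by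
  rw [bandBullet_succ]
  exact hσ.junction _

theorem bandBullet_neg_length (i : Fin σ.length) :
    bandBullet i (-σ.length) = bandBullet i 0 := by
  rw [← bandBullet_add_length, neg_add_cancel]

/-- Both fL f and f fR are nonzero paths and overlap in the nontrivial path f, so no relation can
occur in their union. -/
theorem ConeSetup.wrap_path (h : ConeSetup R σ i τ f hf fL fR) {x : Letter V}
    (hx : τ.letter 0 = some x) : IsPath R (fL ++ f ++ fR) := by
  have h1 : IsPath R (f ++ fR) := h.right_arrows ▸ h.band.path _ (List.get_mem _ _)
  have h2 : IsPath R (fL ++ f) := (h.string_right x hx).2 ▸ h.string.path 0 x hx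
  refine h2.append h1.of_append_right fun _ hR => ?_
  rw [List.getLast_append_of_ne_nil _ hf]
  exact h1.getLast_head hf hR

theorem ConeSetup.wrap_last (h : ConeSetup R σ i τ f hf fL fR)
    (hne : fL ++ f ++ fR ≠ []) :
    (σ.get i).last = Letter.last ⟨fL ++ f ++ fR, hne, true⟩ := by
  simp only [Letter.last, h.right_arrows, List.append_assoc]
  exact (List.getLast_append_of_ne_nil _ (by simp [hf])).symm

theorem ConeSetup.wrap_first (h : ConeSetup R σ i τ f hf fL fR) {x : Letter V}
    (hx : τ.letter 0 = some x) (hne : fL ++ f ++ fR ≠ []) :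
    x.first = Letter.first ⟨fL ++ f ++ fR, hne, true⟩ := by
  simp only [Letter.first, (h.string_right x hx).2]
  exact (List.head_append_of_ne_nil _).symm

/-- All junctions are inherited from σ and τ except those around f, which are part of `ConeSetup`,
and those of the merged letter, which depend only on its ends. The two antipath conditions are
exchanged because τ is read backwards. -/
theorem IsConeWord.isHomotopyString (hc : IsConeWord σ i τ f hf fL fR c)
    (h : ConeSetup R σ i τ f hf fL fR) : IsHomotopyString R c := by
  have hN := h.two_le
  have hpath : ∀ t p, c.letter t = some p → IsPath R p.arrows := by
    intro t p hp
    by_cases h0 : 0 ≤ t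
    · rw [hc.nonneg t h0, Option.map_eq_some_iff] at hp
      obtain ⟨x, hx, rfl⟩ := hp
      exact h.string.path _ x hx
    by_cases h1 : t = -1
    · subst h1
      rw [hc.neg_one] at hp
      obtain rfl := Option.some.inj hp
      exact h.path
    by_cases h2 : -(σ.length : ℤ) ≤ t
    · rw [hc.band t h2 (by omega)] at hp
      obtain rfl := Option.some.inj hp
      exact h.band.path _ (List.get_mem _ _)
    by_cases h3 : t = -σ.length - 1
    · subst h3
      rw [hc.wrap, Option.map_eq_some_iff] at hp
      obtain ⟨x, hx, rfl⟩ := hp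
      exact h.wrap_path hx
    · rw [hc.below t (by omega), Option.map_eq_some_iff] at hp
      obtain ⟨x, hx, rfl⟩ := hp
      exact h.string.path _ x hx
  refine ⟨hpath, ?_, ?_, ?_, ?_, ?_⟩
  · intro t p q hp hq
    by_cases h0 : 0 ≤ t
    · rw [hc.nonneg t h0, Option.map_eq_some_iff] at hp
      rw [hc.nonneg (t + 1) (by omega), Option.map_eq_some_iff] at hq
      obtain ⟨x, hx, rfl⟩ := hp
      obtain ⟨y, hy, rfl⟩ := hq
      refine (h.string.junction _ y x hy ?_).inv
      rw [← hx]
      congr 1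
      ring
    by_cases h1 : t = -1
    · subst h1
      rw [hc.neg_one] at hp
      rw [neg_add_cancel, hc.nonneg 0 le_rfl, Option.map_eq_some_iff] at hq
      obtain rfl := Option.some.inj hp
      obtain ⟨y, hy, rfl⟩ := hq
      exact h.string_left y hy
    by_cases h2 : -(σ.length : ℤ) ≤ t
    · rw [hc.band t h2 (by omega)] at hp
      obtain rfl := Option.some.inj hp
      by_cases h2' : t = -2
      · subst h2'
        rw [show (-2 + 1 : ℤ) = -1 from rfl, hc.neg_one] at hq
        obtain rfl := Option.some.inj hq
        have := h.left_junction
        rwa [← bandBullet_neg_one i, finRotate_symm_bandBullet] at this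
      · rw [hc.band (t + 1) (by omega) (by omega)] at hq
        obtain rfl := Option.some.inj hq
        exact h.band.junction_bandBullet i t
    by_cases h3 : t = -σ.length - 1
    · subst h3
      rw [hc.wrap, Option.map_eq_some_iff] at hp
      obtain ⟨x, hx, rfl⟩ := hp
      rw [sub_add_cancel, hc.band _ le_rfl (by omega), bandBullet_neg_length] at hq
      obtain rfl := Option.some.inj hq
      -- The merged letter has the right end of σR, so it meets the following band letter exactly as
      -- σR does.
      have hj := h.band.junction_bandBullet i (-1)
      rw [bandBullet_neg_one] at hj
      exact hj.congr_left h.right_direct rfl (h.wrap_last _)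
    by_cases h4 : t = -σ.length - 2
    · subst h4
      rw [hc.below _ le_rfl, Option.map_eq_some_iff] at hp
      obtain ⟨y, hy, rfl⟩ := hp
      rw [show (-(σ.length : ℤ) - 2 + 1) = -σ.length - 1 by ring, hc.wrap,
        Option.map_eq_some_iff] at hq
      obtain ⟨x, hx, rfl⟩ := hq
      -- The left end of the merged letter is that of the inverse of τR.
      have := (h.string.junction 0 x y hx (by rw [← hy]; congr 1; ring)).inv
      exact this.congr_right (by simp [(h.string_right x hx).1]) rfl (h.wrap_first hx _)
    · rw [hc.below t (by omega), Option.map_eq_some_iff] at hp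
      rw [hc.below (t + 1) (by omega), Option.map_eq_some_iff] at hq
      obtain ⟨x, hx, rfl⟩ := hp
      obtain ⟨y, hy, rfl⟩ := hq
      refine (h.string.junction _ y x hy ?_).inv
      rw [← hx]
      congr 1
      ring
  · intro p hp
    have h0 : c.letter 0 = some p := hp
    rw [hc.nonneg 0 le_rfl, Option.map_eq_some_iff] at h0
    obtain ⟨x, hx, rfl⟩ := h0
    rw [Letter.inv_leftVertex, hc.base]
    exact h.string.base_left x hx
  · intro p hp
    have h0 : c.letter (-1) = some p := hp
    rw [hc.neg_one] at h0
    obtain rfl := Option.some.inj h0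
    rw [hc.base, ← h.starts]
    rfl
  · obtain ⟨M, hM⟩ := h.string.antipath_right
    refine ⟨M + σ.length + 2, fun n hn p hp => ?_⟩
    have h0 : c.letter (Int.negSucc n) = some p := hp
    rw [hc.below _ (by omega), Option.map_eq_some_iff] at h0
    obtain ⟨x, hx, rfl⟩ := h0
    have h1 : (-(σ.length : ℤ) - Int.negSucc n - 1) = Int.ofNat (n - σ.length) := by
      rw [Int.ofNat_eq_natCast]
      omega
    rw [h1] at hx
    have := hM (n - σ.length) (by omega) x hx
    simpa using this
  · obtain ⟨M, hM⟩ := h.string.antipath_left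
    refine ⟨M, fun n hn p hp => ?_⟩
    have h0 : c.letter (Int.ofNat n) = some p := hp
    rw [hc.nonneg _ (by simp), Option.map_eq_some_iff] at h0
    obtain ⟨x, hx, rfl⟩ := h0
    have h1 : (-(Int.ofNat n) - 1) = Int.negSucc n := by
      rw [Int.ofNat_eq_natCast]
      omega
    rw [h1] at hx
    have := hM n hn x hx
    simpa using this

end

end Letters

/-! ### Matching the bullets of the cone word with those of the band and of τ. -/

section Bullets

variable {V : Type u} [Quiver.{u} V] {R : Quiver.Total V → Quiver.Total V → Prop}

theorem IsHomotopyString.coherent {s : PointedWord V} (hs : IsHomotopyString R s) {t : ℤ}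
    {p : Letter V} (hp : s.letter t = some p) :
    s.IsBullet t ∧ p.leftVertex = s.vert t ∧ s.IsBullet (t + 1) ∧
      p.rightVertex = s.vert (t + 1) ∧ s.degree (t + 1) = s.degree t + p.sign := by
  -- Coherence does not involve coefficients, so any field in the right universe will do.
  have h := stringDiagram_coherent (k := ULift.{u} ℚ) hs
  exact ⟨(h.left t p hp).1, (h.left t p hp).2, (h.right t p hp).1, (h.right t p hp).2,
    h.degree t p hp⟩

namespace PointedWord

theorem vert_zero (s : PointedWord V) : s.vert 0 = s.base := rfl

theorem degree_zero (s : PointedWord V) : s.degree 0 = s.deg := by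
  change s.deg + ∑ m ∈ Finset.range 0, (s.right.get? m).elim 0 Letter.sign = s.deg
  simp

theorem isBullet_iff_of_pos (s : PointedWord V) {t : ℤ} (ht : 0 ≤ t) :
    s.IsBullet (t + 1) ↔ s.letter t ≠ none := by
  obtain ⟨n, rfl⟩ := Int.eq_ofNat_of_zero_le ht
  change (s.right.get? n).isSome = true ↔ s.right.get? n ≠ none
  exact Option.isSome_iff_ne_none

theorem isBullet_iff_of_neg (s : PointedWord V) {t : ℤ} (ht : t < 0) :
    s.IsBullet t ↔ s.letter t ≠ none := by
  obtain ⟨n, rfl⟩ := Int.eq_negSucc_of_lt_zero ht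
  change (s.left.get? n).isSome = true ↔ s.left.get? n ≠ none
  exact Option.isSome_iff_ne_none

end PointedWord

section

variable {σ : List (Letter V)} {i : Fin σ.length} {τ : PointedWord V}
  {f : List (Quiver.Total V)} {hf : f ≠ []} {fL fR : List (Quiver.Total V)}
  {c : PointedWord V}

theorem IsConeWord.match_nonneg (hc : IsConeWord σ i τ f hf fL fR c)
    (h : ConeSetup R σ i τ f hf fL fR) (n : ℕ) :
    (c.IsBullet n ↔ τ.IsBullet (-n)) ∧
      (c.IsBullet n → c.vert n = τ.vert (-n) ∧ c.degree n = τ.degree (-n)) := by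
  have hcs := hc.isHomotopyString h
  induction n with
  | zero =>
    refine ⟨⟨fun _ => trivial, fun _ => trivial⟩, fun _ => ⟨hc.base, ?_⟩⟩
    change c.degree 0 = τ.degree 0
    rw [c.degree_zero, τ.degree_zero, hc.deg]
  | succ n ih =>
    have e : -((n + 1 : ℕ) : ℤ) = -n - 1 := by push_cast; ring
    have hl := hc.nonneg n (by positivity)
    rw [e]
    push_cast
    rw [c.isBullet_iff_of_pos (by positivity), τ.isBullet_iff_of_neg (by omega), hl]
    refine ⟨by simp, fun hne => ?_⟩
    obtain ⟨x, hx⟩ := Option.ne_none_iff_exists'.1 hne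
    obtain ⟨y, hy, rfl⟩ := Option.map_eq_some_iff.1 hx
    have hcx := hcs.coherent (hl.trans hx)
    have hty := h.string.coherent hy
    have hd := (ih.2 hcx.1).2
    rw [sub_add_cancel] at hty
    refine ⟨?_, ?_⟩
    · rw [← hcx.2.2.2.1, ← hty.2.1, Letter.inv_rightVertex]
    · rw [hcx.2.2.2.2, hd, hty.2.2.2.2, Letter.inv_sign]
      ring

/-- The degree is one less than in the band, in accordance with the shift in the cone. It is fixed
at bullet -1 by the direct letter f, which ends in degree `τ.deg`, and then propagates along the
common letters. -/
theorem IsConeWord.match_band {k : Type u} [Field k] (hc : IsConeWord σ i τ f hf fL fR c)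
    (h : ConeSetup R σ i τ f hf fL fR) (lam : k) (m : Fin σ.length) (deg : ℤ)
    (hdeg : (bandDiagram k σ lam m deg).degree i = τ.deg) (n : ℕ) (hn : n < σ.length) :
    c.IsBullet (-1 - n) ∧
      c.vert (-1 - n) = (bandDiagram k σ lam m deg).vert (bandBullet i (-1 - n)) ∧
      c.degree (-1 - n) = (bandDiagram k σ lam m deg).degree (bandBullet i (-1 - n)) - 1 := by
  have hcs := hc.isHomotopyString h
  have hN := h.two_le
  have hB := bandDiagram_coherent h.band lam m deg
  induction n with
  | zero =>
    have h1 := hcs.coherent hc.neg_one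
    rw [neg_add_cancel, c.degree_zero, hc.deg] at h1
    simp only [Nat.cast_zero, sub_zero]
    refine ⟨h1.1, ?_, ?_⟩
    · rw [← h1.2.1]
      exact h.ends
    · rw [bandBullet_neg_one, hdeg, h1.2.2.2.2, Letter.sign, if_pos rfl, add_sub_cancel_right]
  | succ n ih =>
    have e : -1 - ((n + 1 : ℕ) : ℤ) = -1 - n - 1 := by push_cast; ring
    have hl := hc.band (-1 - n - 1) (by omega) (by omega)
    have h1 := hcs.coherent hl
    have h2 := hB.degree (bandBullet i (-1 - n - 1)) _ rfl
    have h3 : (bandDiagram k σ lam m deg).next (bandBullet i (-1 - n - 1)) =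
        bandBullet i (-1 - n) := by
      rw [← sub_add_cancel (-1 - n : ℤ) 1, bandBullet_succ, sub_add_cancel]
      rfl
    rw [h3] at h2
    rw [sub_add_cancel, (ih (by omega)).2.2] at h1
    rw [e]
    refine ⟨h1.1, h1.2.1.symm, ?_⟩
    have h4 := h1.2.2.2.2
    rw [h2] at h4
    linarith

theorem IsConeWord.match_below {k : Type u} [Field k] (hc : IsConeWord σ i τ f hf fL fR c)
    (h : ConeSetup R σ i τ f hf fL fR) (lam : k) (m : Fin σ.length) (deg : ℤ)
    (hdeg : (bandDiagram k σ lam m deg).degree i = τ.deg) (n : ℕ) :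
    (c.IsBullet (-σ.length - (n + 1)) ↔ τ.IsBullet (n + 1)) ∧
      (c.IsBullet (-σ.length - (n + 1)) → c.vert (-σ.length - (n + 1)) = τ.vert (n + 1) ∧
        c.degree (-σ.length - (n + 1)) = τ.degree (n + 1)) := by
  have hcs := hc.isHomotopyString h
  have hN := h.two_le
  have hB := bandDiagram_coherent h.band lam m deg
  induction n with
  | zero =>
    have hl := hc.wrap
    simp only [Nat.cast_zero, zero_add]
    rw [c.isBullet_iff_of_neg (by omega), ← zero_add (1 : ℤ), τ.isBullet_iff_of_pos le_rfl,
      zero_add, hl]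
    refine ⟨by simp, fun hne => ?_⟩
    obtain ⟨x, hx⟩ := Option.ne_none_iff_exists'.1 hne
    obtain ⟨y, hy, rfl⟩ := Option.map_eq_some_iff.1 hx
    have hcx := hcs.coherent (hl.trans hx)
    have hty := h.string.coherent hy
    rw [zero_add, τ.degree_zero] at hty
    -- Crossing σR in the band raises the degree by one, which cancels the shift, so bullet -N of c
    -- sits in degree `τ.deg`. The direct merged letter and the inverse letter τR then give the same
    -- degree to their far ends.
    have hd := hc.match_band h lam m deg hdeg (σ.length - 1) (by omega)
    have e : (-1 - ((σ.length - 1 : ℕ) : ℤ)) = -σ.length := by omega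
    rw [e, bandBullet_neg_length] at hd
    have h2 := hB.degree i _ rfl
    have h3 : (bandDiagram k σ lam m deg).next i = bandBullet i 0 := rfl
    rw [h3, hdeg, Letter.sign, if_pos h.right_direct] at h2
    rw [sub_add_cancel, hd.2.2, h2, Letter.sign, if_pos rfl] at hcx
    refine ⟨?_, ?_⟩
    · rw [← hcx.2.1, ← hty.2.2.2.1, Letter.rightVertex_of_inverse (h.string_right y hy).1,
        Letter.leftVertex_of_direct rfl, h.wrap_first hy]
    · rw [hty.2.2.2.2, Letter.sign, (h.string_right y hy).1]
      simp only [Bool.false_eq_true, if_false]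
      linarith [hcx.2.2.2.2]
  | succ n ih =>
    have e : (((n + 1 : ℕ) : ℤ) + 1) = (n + 1) + 1 := by push_cast; ring
    have e' : (-(σ.length : ℤ) - (n + 1 + 1)) + 1 = -σ.length - (n + 1) := by ring
    have hl := hc.below (-σ.length - (n + 1 + 1)) (by omega)
    have e'' : (-(σ.length : ℤ) - (-σ.length - (n + 1 + 1)) - 1) = n + 1 := by ring
    rw [e''] at hl
    rw [e, c.isBullet_iff_of_neg (by omega), τ.isBullet_iff_of_pos (by omega), hl]
    refine ⟨by simp, fun hne => ?_⟩
    obtain ⟨x, hx⟩ := Option.ne_none_iff_exists'.1 hne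
    obtain ⟨y, hy, rfl⟩ := Option.map_eq_some_iff.1 hx
    have hcx := hcs.coherent (hl.trans hx)
    have hty := h.string.coherent hy
    rw [e'] at hcx
    have hd := (ih.2 hcx.2.2.1).2
    refine ⟨?_, ?_⟩
    · rw [← hcx.2.1, ← hty.2.2.2.1, Letter.inv_leftVertex]
    · have := hcx.2.2.2.2
      rw [hd, Letter.inv_sign] at this
      rw [hty.2.2.2.2]
      linarith

end

end Bullets

/-! ### Continuing the maps from τ to the cone word beyond their identity parts. -/

section HalfMapsOfSetup

variable {k : Type u} [Field k] {V : Type u} [Quiver.{u} V] [Fintype V]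
  {R : Quiver.Total V → Quiver.Total V → Prop}
  {σ : List (Letter V)} {i : Fin σ.length} {τ : PointedWord V}
  {f : List (Quiver.Total V)} {hf : f ≠ []} {fL fR : List (Quiver.Total V)}
  {c : PointedWord V}

/-- A map may stop right at its first bullet if its coefficient is annihilated by the letter leaving
in either word. -/
theorem halfMap_single {p q : ℕ → Option (Letter V)} {μ : BoundAlgebra k R}
    (h1 : μ * dirElt k R (q 0) = 0) (h2 : invElt k R (p 0) * μ = 0) :
    HalfMap k R p q (fun j => if j = 0 then μ else 0) := by
  refine ⟨fun j => ?_, fun j => ?_, fun j hj m hm => ?_, fun j x _ => by simp, 1, fun j hj => ?_⟩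
  · rcases j with _ | j
    · simpa using h1.symm
    · simp
  · rcases j with _ | j
    · simpa using h2
    · simp
  · rcases j with _ | j
    · omega
    · simp at hj
  · rw [if_neg (by omega)]

omit [Fintype V] in
theorem bandBullet_add_mul (i : Fin σ.length) (t : ℤ) (M : ℕ) :
    bandBullet i (t + M * σ.length) = bandBullet i t := by
  induction M with
  | zero => simp
  | succ M ih =>
    rw [show t + ((M + 1 : ℕ) : ℤ) * σ.length = t + M * σ.length + σ.length by push_cast; ring,
      bandBullet_add_length, ih]

/-- If fR is trivial, σR equals f, and the periodic band word after σR is compared with τ̄L δ̄,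
which also continues f. The alternative excluded by `hno` is the one that makes f null-homotopic. If
fR is nontrivial, that one component suffices. -/
theorem ConeSetup.exists_halfMap_right (hR : IsGentle R) (h : ConeSetup R σ i τ f hf fL fR)
    (hc : IsConeWord σ i τ f hf fL fR c)
    (hno : fR = [] → ¬ ∃ a, HalfMap k R (fun j : ℕ => some (σ.get (bandBullet i j)))
      (fun j : ℕ => (τ.letter (-j - 1)).map Letter.inv) a ∧ a 0 = idem k R τ.base) :
    ∃ a, HalfMap k R (fun j : ℕ => (τ.letter (-j - 1)).map Letter.inv)
      (fun j : ℕ => c.letter (-σ.length + j)) a ∧ a 0 = idem k R τ.base * pathElt k R fR := by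
  have hN := h.two_le
  have hj0 := h.band.junction_bandBullet i (-1)
  rw [bandBullet_neg_one, neg_add_cancel] at hj0
  by_cases hfR : fR = []
  · have hσR : σ.get i = ⟨f, hf, true⟩ := by
      refine Letter.ext ?_ h.right_direct
      rw [h.right_arrows, hfR, List.append_nil]
    rw [hσR] at hj0
    have hv : Letter.rightVertex ⟨f, hf, true⟩ = τ.base := h.starts
    rw [hfR, pathElt_nil, mul_one]
    refine (halfMap_or_halfMap (k := k) hR (v := τ.base) (n := σ.length)
      (p := fun j : ℕ => some (σ.get (bandBullet i j))) ?_ ?_ (fun _ => by simp)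
      ⟨f, hf, true⟩ hv ?_ ?_ ?_ hN (fun j => ?_) (fun j hj => ?_) fun j => ?_).resolve_left
        (hno hfR)
    · refine ⟨fun j x hx => ?_, fun j x y hx hy => ?_, fun x hx => ?_⟩
      · obtain rfl := Option.some.inj hx
        exact h.band.path _ (List.get_mem _ _)
      · obtain rfl := Option.some.inj hx
        obtain rfl := Option.some.inj hy
        push_cast
        exact h.band.junction_bandBullet i j
      · obtain rfl := Option.some.inj hx
        exact hj0.1.symm.trans hv
    · refine ⟨fun j x hx => ?_, fun j x y hx hy => ?_, fun x hx => ?_⟩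
      · obtain ⟨z, hz, rfl⟩ := Option.map_eq_some_iff.1 hx
        exact h.string.path _ z hz
      · obtain ⟨z, hz, rfl⟩ := Option.map_eq_some_iff.1 hx
        obtain ⟨w, hw, rfl⟩ := Option.map_eq_some_iff.1 hy
        refine (h.string.junction _ w z hw ?_).inv
        rw [← hz]
        congr 1
        push_cast
        ring
      · obtain ⟨z, hz, rfl⟩ := Option.map_eq_some_iff.1 hx
        rw [Letter.inv_leftVertex]
        exact h.string.base_left z hz
    · intro x hx
      obtain rfl := Option.some.inj hx
      exact hj0
    · intro x hx
      obtain ⟨z, hz, rfl⟩ := Option.map_eq_some_iff.1 hx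
      exact h.string_left z hz
    -- The words differ because the direct letter σR recurs in every period, whereas τ̄L δ̄, if
    -- infinite, is eventually inverse. The chosen `j` is an occurrence of σR beyond the bound `M`.
    · obtain ⟨M, hM⟩ := h.string.antipath_left
      obtain ⟨j, hj⟩ : ∃ j : ℕ, (j : ℤ) = -1 + (M + 1 : ℕ) * σ.length :=
        ⟨(M + 1) * σ.length - 1, by
          have : 1 ≤ (M + 1) * σ.length := Nat.mul_pos (Nat.succ_pos M) (by omega)
          push_cast [Nat.cast_sub this]
          ring⟩
      refine ⟨j, fun heq => ?_⟩
      have hjM : M ≤ j := by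
        have : ((M + 1 : ℕ) : ℤ) * 1 ≤ (M + 1 : ℕ) * σ.length :=
          mul_le_mul_of_nonneg_left (by omega) (by positivity)
        omega
      obtain ⟨z, hz, hz'⟩ := Option.map_eq_some_iff.1 heq.symm
      have := (hM j hjM z (by
        rw [show (-(j : ℤ) - 1) = Int.negSucc j by omega] at hz
        exact hz)).1
      rw [hj, bandBullet_add_mul, bandBullet_neg_one, hσR] at hz'
      have h3 := congrArg Letter.direct hz'
      simp [this] at h3
    · simp only [Nat.cast_add, bandBullet_add_length]
    · by_cases hj' : (j : ℤ) ≤ σ.length - 2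
      · rw [hc.band _ (by omega) (by omega), add_comm, ← bandBullet_add_length,
          neg_add_cancel_right]
      · have e : (j : ℤ) = -1 + σ.length := by omega
        rw [e, bandBullet_add_length, bandBullet_neg_one, hσR,
          show (-(σ.length : ℤ) + (-1 + σ.length)) = -1 by ring, hc.neg_one]
    · rw [show (-(σ.length : ℤ) + ((j + σ.length : ℕ) : ℤ)) = j by push_cast; ring,
        hc.nonneg j (by positivity)]
  · have hpath : IsPath R (f ++ fR) := h.right_arrows ▸ h.band.path _ (List.get_mem _ _)
    have hg := hpath.getLast_head hf hfR
    have hv : idem k R τ.base * pathElt k R fR = pathElt k R fR := by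
      rw [← h.starts, hg.1, idem_mul_pathElt hfR]
    rw [hv]
    refine ⟨_, halfMap_single (μ := pathElt k R fR) ?_ ?_, rfl⟩
    · simp only [Nat.cast_zero, add_zero]
      rw [hc.band _ le_rfl (by omega), bandBullet_neg_length]
      rcases hd : (σ.get (bandBullet i 0)).direct
      · rw [dirElt_of_inverse hd, mul_zero]
      · rw [dirElt_of_direct hd]
        refine pathElt_mul_pathElt_eq_zero hfR (Letter.ne_nil _) ?_
        have := hj0.2.1 h.right_direct hd
        simp only [Letter.last, h.right_arrows, List.getLast_append_of_ne_nil _ hfR] at this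
        exact this
    · simp only [Nat.cast_zero, neg_zero, zero_sub]
      rcases hx : τ.letter (-1) with _ | x
      · simp
      · rw [Option.map_some]
        have hj := h.string_left x hx
        rcases hd : x.direct
        · rw [invElt_of_direct (by simp [hd]), zero_mul]
        · rw [invElt_of_inverse (by simp [hd])]
          refine pathElt_mul_pathElt_eq_zero x.ne_nil hfR ?_
          -- A direct τL and f end with different arrows. Since f fR is nonzero, the last arrow of
          -- τL forms a relation with fR.
          refine hR.rel_of_ne_left (hj.2.2.2.1 rfl (by simp [hd])) hg.1 hg.2 ?_
          have := hj.1
          rw [Letter.inv_leftVertex, Letter.rightVertex_of_direct rfl,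
            Letter.rightVertex_of_direct hd] at this
          exact this.symm.trans hg.1

omit [Field k] [Fintype V] in
theorem IsHomotopyBand.exists_inverse (hσ : IsHomotopyBand R σ) (hi : (σ.get i).direct = true) :
    ∃ j : Fin σ.length, (σ.get j).direct = false := by
  have h1 : 0 < σ.countP (fun p => p.direct) :=
    List.countP_pos_iff.2 ⟨_, List.get_mem σ i, hi⟩
  rw [hσ.balanced] at h1
  obtain ⟨p, hp, hd⟩ := List.countP_pos_iff.1 h1
  obtain ⟨j, rfl⟩ := List.get_of_mem hp
  exact ⟨j, by simpa using hd⟩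

/-- The mirror image: for trivial fL the letter τR is f̄, and the band inverted and read leftwards
from σL is compared with γ, both continuing f̄. Without τR there is nothing to map, and the zero map
serves. -/
theorem ConeSetup.exists_halfMap_left (hR : IsGentle R) (h : ConeSetup R σ i τ f hf fL fR)
    (hc : IsConeWord σ i τ f hf fL fR c)
    (hno : ∀ x, τ.letter 0 = some x → fL = [] → ¬ ∃ a,
      HalfMap k R (fun j : ℕ => some (σ.get (bandBullet i (-2 - j))).inv)
        (fun j : ℕ => τ.letter (j + 1)) a ∧ a 0 = idem k R x.rightVertex) :
    ∃ a, HalfMap k R (fun j : ℕ => τ.letter (j + 1))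
      (fun j : ℕ => (c.letter (-2 - j)).map Letter.inv) a ∧
      (τ.letter 0 = none → a 0 = 0) ∧
      ∀ x, τ.letter 0 = some x → a 0 = idem k R x.rightVertex * pathElt k R fL := by
  have hN := h.two_le
  have hj0 := h.left_junction
  nth_rw 1 [← bandBullet_neg_one i] at hj0
  rw [finRotate_symm_bandBullet, show (-1 - 1 : ℤ) = -2 from rfl] at hj0
  rcases hx : τ.letter 0 with _ | x
  · exact ⟨_, halfMap_single (μ := 0) (by simp) (by simp), by simp, by simp⟩
  suffices H : ∃ a, HalfMap k R (fun j : ℕ => τ.letter (j + 1))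
      (fun j : ℕ => (c.letter (-2 - j)).map Letter.inv) a ∧
      a 0 = idem k R x.rightVertex * pathElt k R fL by
    obtain ⟨a, ha, ha0⟩ := H
    exact ⟨a, ha, by simp, by rintro _ ⟨⟩; exact ha0⟩
  have hxf := h.string_right x hx
  by_cases hfL : fL = []
  · have hxe : x = Letter.inv ⟨f, hf, true⟩ := by
      refine Letter.ext ?_ hxf.1
      rw [hxf.2, hfL]
      rfl
    rw [hfL, pathElt_nil, mul_one]
    refine (halfMap_or_halfMap (k := k) hR (v := x.rightVertex) (n := σ.length)
      (p := fun j : ℕ => some (σ.get (bandBullet i (-2 - j))).inv) ?_ ?_ (fun _ => by simp)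
      x rfl ?_ ?_ ?_ hN (fun j => ?_) (fun j hj => ?_) fun j => ?_).resolve_left
        (hno x hx hfL)
    · refine ⟨fun j y hy => ?_, fun j y z hy hz => ?_, fun y hy => ?_⟩
      · obtain rfl := Option.some.inj hy
        exact h.band.path (σ.get (bandBullet i (-2 - j))) (List.get_mem _ _)
      · obtain rfl := Option.some.inj hy
        obtain rfl := Option.some.inj hz
        have := (h.band.junction_bandBullet i (-2 - (j + 1))).inv
        rw [show (-2 - ((j : ℤ) + 1) + 1) = -2 - j by ring] at this
        push_cast
        exact this
      · obtain rfl := Option.some.inj hy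
        rw [hxe, Letter.inv_leftVertex, Letter.inv_rightVertex]
        exact hj0.1
    · refine ⟨fun j y hy => h.string.path _ y hy, fun j y z hy hz => ?_, fun y hy => ?_⟩
      · refine h.string.junction (j + 1) y z hy ?_
        rw [← hz]
        push_cast
        rfl
      · exact (h.string.junction 0 x y hx hy).1.symm
    · intro y hy
      obtain rfl := Option.some.inj hy
      rw [hxe]
      exact hj0.inv
    · intro y hy
      exact h.string.junction 0 x y hx hy
    · obtain ⟨M, hM⟩ := h.string.antipath_right
      -- Here γ is eventually inverse if infinite, so a recurring direct letter of the inverted band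
      -- is needed. It comes from an inverse letter of σ, which exists because σ is balanced and σR
      -- is direct.
      obtain ⟨b, hb⟩ := h.band.exists_inverse h.right_direct
      have hbm := bandIndex_mem i b
      obtain ⟨j, hj⟩ : ∃ j : ℕ, (j : ℤ) = -2 - bandIndex i b + (M + 1 : ℕ) * σ.length := by
        refine ⟨(-2 - bandIndex i b + (M + 1 : ℕ) * σ.length).toNat, Int.toNat_of_nonneg ?_⟩
        have : ((M + 1 : ℕ) : ℤ) * 1 ≤ (M + 1 : ℕ) * σ.length :=
          mul_le_mul_of_nonneg_left (by omega) (by positivity)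
        omega
      refine ⟨j, fun heq => ?_⟩
      have hjM : M ≤ j + 1 := by
        have : ((M + 1 : ℕ) : ℤ) * 1 ≤ (M + 1 : ℕ) * σ.length :=
          mul_le_mul_of_nonneg_left (by omega) (by positivity)
        omega
      have h1 := (hM (j + 1) hjM _ heq.symm).1
      have h2 : bandBullet i (-2 - j) = b := by
        rw [← bandBullet_add_mul i _ (M + 1), hj,
          show (-2 - (-2 - bandIndex i b + ((M + 1 : ℕ) : ℤ) * σ.length) +
            ((M + 1 : ℕ) : ℤ) * σ.length) = bandIndex i b by ring, bandBullet_bandIndex]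
      rw [h2, Letter.inv_direct, hb] at h1
      exact Bool.noConfusion h1
    · rw [← bandBullet_add_length i (-2 - ((j + σ.length : ℕ) : ℤ)),
        show (-2 - ((j + σ.length : ℕ) : ℤ) + σ.length) = -2 - j by push_cast; ring]
    · by_cases hj' : (j : ℤ) ≤ σ.length - 2
      · rw [hc.band _ (by omega) (by omega), Option.map_some]
      -- The last letter of the period is the merged one; as fL is trivial, it is σR itself.
      · have e : (-2 - (j : ℤ)) = -σ.length - 1 := by omega
        have e' : bandBullet i (-(σ.length : ℤ) - 1) = i := by
          rw [← bandBullet_add_length, show (-(σ.length : ℤ) - 1 + σ.length) = -1 by ring,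
            bandBullet_neg_one]
        rw [e, e', hc.wrap, hx, Option.map_some, Option.map_some]
        congr 2
        refine Letter.ext ?_ h.right_direct.symm
        simp only [hfL, List.nil_append]
        exact h.right_arrows.symm
    · rw [hc.below _ (by push_cast; omega), Option.map_map,
        show (-(σ.length : ℤ) - (-2 - ((j + σ.length : ℕ) : ℤ)) - 1) = j + 1 by push_cast; ring]
      have : (Letter.inv ∘ Letter.inv : Letter V → Letter V) = id := by
        funext y
        simp
      rw [this, Option.map_id]
      rfl
  · have hpath : IsPath R (fL ++ f) := hxf.2 ▸ h.string.path _ x hx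
    have hg := hpath.getLast_head hfL hf
    have hfirst : x.first = fL.head hfL := by
      simp only [Letter.first, hxf.2, List.head_append_of_ne_nil hfL]
    have hv : idem k R x.rightVertex * pathElt k R fL = pathElt k R fL := by
      rw [Letter.rightVertex_of_inverse hxf.1, hfirst, idem_mul_pathElt hfL]
    rw [hv]
    refine ⟨_, halfMap_single (μ := pathElt k R fL) ?_ ?_, rfl⟩
    · simp only [Nat.cast_zero, sub_zero]
      rw [hc.band _ (by omega) le_rfl, dirElt_map_inv]
      rcases hd : (σ.get (bandBullet i (-2))).direct
      · rw [invElt_of_inverse hd]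
        refine pathElt_mul_pathElt_eq_zero hfL (Letter.ne_nil _) ?_
        refine hR.rel_of_ne_right (hj0.2.2.2.2 hd rfl).symm hg.1 hg.2 ?_
        have := hj0.1
        rw [Letter.rightVertex_of_inverse hd] at this
        exact hg.1.trans this.symm
      · rw [invElt_of_direct hd, mul_zero]
    · simp only [Nat.cast_zero, zero_add]
      rcases hy : τ.letter 1 with _ | y
      · simp
      · rcases hd : y.direct
        · rw [invElt_of_inverse hd]
          refine pathElt_mul_pathElt_eq_zero y.ne_nil hfL ?_
          rw [← hfirst]
          exact (h.string.junction 0 x y hx hy).2.2.1 hxf.1 hd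
        · rw [invElt_of_direct hd, zero_mul]

end HalfMapsOfSetup

/-! ### The two graph maps from the string complex of τ to that of the cone word. -/

section GraphMapsOfSetup

variable {k : Type u} [Field k] {V : Type u} [Quiver.{u} V] [Fintype V]
  {R : Quiver.Total V → Quiver.Total V → Prop}
  {σ : List (Letter V)} {i : Fin σ.length} {τ : PointedWord V}
  {f : List (Quiver.Total V)} {hf : f ≠ []} {fL fR : List (Quiver.Total V)}
  {c : PointedWord V}

open Unfolded

/-- Covers the identity part of the graph maps: idempotents commute with a common letter. The
coefficients are prescribed only at actual bullets, since a missing letter imposes nothing. -/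
theorem string_edge {s : PointedWord V} (hs : IsHomotopyString R s) (r : ℤ)
    (o : Option (Letter V)) (ho : o = (s.letter (r - 1)).map Letter.inv)
    {x y : BoundAlgebra k R} (hx : s.IsBullet (r - 1) → x = idem k R (s.vert (r - 1)))
    (hy : s.IsBullet r → y = idem k R (s.vert r)) :
    dirElt k R ((s.letter (r - 1)).map Letter.inv) * x = y * dirElt k R o ∧
      invElt k R ((s.letter (r - 1)).map Letter.inv) * y = x * invElt k R o := by
  subst ho
  rcases hl : s.letter (r - 1) with _ | z
  · simp
  · have h := hs.coherent hl
    rw [sub_add_cancel] at h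
    rw [hx h.1, hy h.2.2.1, Option.map_some]
    constructor
    · rw [dirElt_mul_idem, idem_mul_dirElt]
      · rintro _ ⟨⟩
        rw [Letter.inv_leftVertex, h.2.2.2.1]
      · rintro _ ⟨⟩
        rw [Letter.inv_rightVertex, h.2.1]
    · rw [invElt_mul_idem, idem_mul_invElt]
      · rintro _ ⟨⟩
        rw [Letter.inv_rightVertex, h.2.1]
      · rintro _ ⟨⟩
        rw [Letter.inv_leftVertex, h.2.2.2.1]

open Classical in
-- The identity on the left part of τ and the half map `l` on the right part fit together along τR,
-- because f at the end of τR is the letter of c next to bullet 0 and the rest fL is the first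
-- coefficient of `l`.
theorem exists_graphMap_left (hc : IsConeWord σ i τ f hf fL fR c)
    (h : ConeSetup R σ i τ f hf fL fR) (lam : k) (m : Fin σ.length) (deg : ℤ)
    (hdeg : (bandDiagram k σ lam m deg).degree i = τ.deg) {l : ℕ → BoundAlgebra k R}
    (hl : HalfMap k R (fun j : ℕ => τ.letter (j + 1))
      (fun j : ℕ => (c.letter (-2 - j)).map Letter.inv) l)
    (hl0 : τ.letter 0 = none → l 0 = 0)
    (hl1 : ∀ x, τ.letter 0 = some x → l 0 = idem k R x.rightVertex * pathElt k R fL) :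
    ∃ x : ℤ → BoundAlgebra k R,
      IsGraphMap (stringDiagram k τ).rev (stringDiagram k c) (fun r : ℤ => -r) x ∧
      ∀ r ≤ 0, τ.IsBullet r → x r = idem k R (τ.vert r) := by
  have hcs := hc.isHomotopyString h
  let x : ℤ → BoundAlgebra k R := fun r =>
    if r ≤ 0 then (if τ.IsBullet r then idem k R (τ.vert r) else 0) else l (r - 1).toNat
  have hx1 : ∀ r ≤ 0, τ.IsBullet r → x r = idem k R (τ.vert r) := fun r hr hb => by
    simp only [x, if_pos hr, if_pos hb]
  have hx2 : ∀ j : ℕ, x (j + 1) = l j := fun j => by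
    simp only [x]
    rw [if_neg (by omega), show ((j : ℤ) + 1 - 1).toNat = j by omega]
  have hedge : ∀ r : ℤ,
      dirElt k R ((τ.letter (r - 1)).map Letter.inv) * x (r - 1) =
        x r * dirElt k R (c.letter (-r)) ∧
      invElt k R ((τ.letter (r - 1)).map Letter.inv) * x r =
        x (r - 1) * invElt k R (c.letter (-r)) := by
    intro r
    rcases lt_trichotomy r 1 with hr | rfl | hr
    · refine string_edge h.string r _ ?_ (hx1 _ (by omega)) (hx1 _ (by omega))
      rw [hc.nonneg (-r) (by omega), neg_neg]
    · rw [sub_self, hc.neg_one, hx1 0 le_rfl trivial, dirElt_of_direct rfl, invElt_of_direct rfl,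
        mul_zero, dirElt_map_inv, invElt_map_inv]
      have := hx2 0
      rw [Nat.cast_zero, zero_add] at this
      rw [this]
      rcases hz : τ.letter 0 with _ | z
      · simp [hl0 hz]
      · have hzf := h.string_right z hz
        rw [hl1 z hz, invElt_of_inverse hzf.1, dirElt_of_inverse hzf.1, zero_mul, hzf.2,
          mul_assoc, ← pathElt_append]
        refine ⟨?_, rfl⟩
        have h1 := idem_mul_invElt (k := k) (R := R) (o := some z) (v := z.rightVertex)
          (by rintro _ ⟨⟩; rfl)
        have h2 := invElt_mul_idem (k := k) (R := R) (o := some z) (v := τ.vert 0)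
          (by rintro _ ⟨⟩; exact h.string.base_right z hz)
        rw [invElt_of_inverse hzf.1, hzf.2] at h1 h2
        rw [h1, h2]
    · obtain ⟨j, rfl⟩ : ∃ j : ℕ, r = j + 1 + 1 := ⟨(r - 2).toNat, by omega⟩
      have h1 := hx2 (j + 1)
      push_cast at h1
      rw [add_sub_cancel_right, hx2 j, h1, dirElt_map_inv, invElt_map_inv,
        ← dirElt_map_inv (c.letter _), ← invElt_map_inv (c.letter _)]
      have e : (-((j : ℤ) + 1 + 1)) = -2 - j := by ring
      rw [e]
      -- The half map is stated for inverted letters of c and uninverted letters of τ, so its two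
      -- conditions change places.
      exact ⟨hl.inv j, hl.dir j⟩
  -- Where the half map is nonzero, all earlier letters of the two words exist and have the same
  -- direction, so equality of degrees is carried along from the first bullet.
  have hsupp : ∀ j : ℕ, l j ≠ 0 → ∀ j' ≤ j,
      τ.IsBullet (j' + 1) ∧ τ.degree (j' + 1) = c.degree (-(j' + 1)) := by
    intro j hj j' hj'
    induction j' with
    | zero =>
      have hb : τ.IsBullet ((0 : ℤ) + 1) := by
        rcases j with _ | j
        · rw [τ.isBullet_iff_of_pos le_rfl]
          exact fun h0 => hj (hl0 h0)
        · obtain ⟨z, -, hz, -⟩ := hl.supp _ hj 0 (Nat.succ_pos j)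
          exact (h.string.coherent hz).1
      refine ⟨hb, ?_⟩
      rw [τ.isBullet_iff_of_pos le_rfl] at hb
      obtain ⟨z, hz⟩ := Option.ne_none_iff_exists'.1 hb
      have h1 := (h.string.coherent hz).2.2.2.2
      have h2 := (hc.match_band h lam m deg hdeg 0 (by have := h.two_le; omega)).2.2
      rw [Letter.sign, (h.string_right z hz).1, if_neg (by simp), τ.degree_zero] at h1
      simp only [Nat.cast_zero, sub_zero, bandBullet_neg_one, hdeg] at h2
      change τ.degree (0 + 1) = c.degree (-1)
      rw [h1, h2]
      ring
    | succ j' ih =>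
      obtain ⟨y, z, hy, hz, hyz⟩ := hl.supp _ hj j' (by omega)
      obtain ⟨z, hz', rfl⟩ := Option.map_eq_some_iff.1 hz
      have h1 := h.string.coherent hy
      have h2 := hcs.coherent hz'
      have hyz' : y.sign = z.inv.sign := by rw [Letter.sign, Letter.sign, hyz]
      have h3 := (ih (by omega)).2
      rw [show (-2 - (j' : ℤ) + 1) = -(j' + 1) by ring, ← h3] at h2
      have e : -(((j' + 1 : ℕ) : ℤ) + 1) = -2 - j' := by push_cast; ring
      rw [e]
      push_cast
      refine ⟨h1.2.2.1, ?_⟩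
      have h4 := h1.2.2.2.2
      have h5 := h2.2.2.2.2
      rw [hyz', Letter.inv_sign] at h4
      rw [h4, h5]
      ring
  refine ⟨x, ⟨fun (r : ℤ) => ?_, fun r => (hedge r).1, fun r => (hedge r).2,
    fun (r : ℤ) hr => ?_, fun (r : ℤ) => ?_⟩, hx1⟩
  · change -((r : ℤ) - 1) = -r + 1
    ring
  · change τ.IsBullet r ∧ τ.degree r = c.degree (-r)
    by_cases h0 : r ≤ 0
    · have hb : τ.IsBullet r := by
        by_contra hb
        exact hr (by simp only [x, if_pos h0, if_neg hb])
      obtain ⟨n, rfl⟩ : ∃ n : ℕ, r = -n := ⟨(-r).toNat, by omega⟩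
      have h1 := hc.match_nonneg h n
      rw [neg_neg]
      exact ⟨hb, (h1.2 (h1.1.2 hb)).2.symm⟩
    · obtain ⟨j, rfl⟩ : ∃ j : ℕ, r = j + 1 := ⟨(r - 1).toNat, by omega⟩
      rw [hx2] at hr
      exact hsupp j hr j le_rfl
  · change idem k R (τ.vert r) * x r = x r
    by_cases h0 : r ≤ 0
    · simp only [x, if_pos h0]
      split_ifs
      · rw [idem_mul_idem]
      · rw [mul_zero]
    · obtain ⟨j, rfl⟩ : ∃ j : ℕ, r = j + 1 := ⟨(r - 1).toNat, by omega⟩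
      rw [hx2]
      by_cases hz : l j = 0
      · rw [hz, mul_zero]
      · have hb := (hsupp j hz j le_rfl).1
        rw [τ.isBullet_iff_of_pos (by positivity)] at hb
        obtain ⟨y, hy⟩ := Option.ne_none_iff_exists'.1 hb
        rw [← (h.string.coherent hy).2.2.2.1]
        rcases j with _ | j
        · rw [hl1 y hy, ← mul_assoc, idem_mul_idem]
        · refine hl.vert j y ?_
          rw [← hy]
          push_cast
          rfl

open Classical in
-- Now the identity sits on the right part of τ. Along τR the two parts fit because fL f followed by
-- fR is the merged letter of c.
theorem exists_graphMap_right (hc : IsConeWord σ i τ f hf fL fR c)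
    (h : ConeSetup R σ i τ f hf fL fR) (lam : k) (m : Fin σ.length) (deg : ℤ)
    (hdeg : (bandDiagram k σ lam m deg).degree i = τ.deg) {l : ℕ → BoundAlgebra k R}
    (hl : HalfMap k R (fun j : ℕ => (τ.letter (-j - 1)).map Letter.inv)
      (fun j : ℕ => c.letter (-σ.length + j)) l)
    (hl0 : l 0 = idem k R τ.base * pathElt k R fR) :
    ∃ x : ℤ → BoundAlgebra k R,
      IsGraphMap (stringDiagram k τ).rev (stringDiagram k c) (fun r : ℤ => -(σ.length : ℤ) - r) x ∧
      (∀ r > 0, τ.IsBullet r → x r = idem k R (τ.vert r)) ∧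
      x 0 = idem k R τ.base * pathElt k R fR := by
  have hcs := hc.isHomotopyString h
  let x : ℤ → BoundAlgebra k R := fun r =>
    if 0 < r then (if τ.IsBullet r then idem k R (τ.vert r) else 0) else l (-r).toNat
  have hx1 : ∀ r > 0, τ.IsBullet r → x r = idem k R (τ.vert r) := fun r hr hb => by
    simp only [x, if_pos hr, if_pos hb]
  have hx2 : ∀ j : ℕ, x (-j) = l j := fun j => by
    simp only [x]
    rw [if_neg (by omega), neg_neg, Int.toNat_natCast]
  have hx0 : x 0 = l 0 := hx2 0
  have hedge : ∀ r : ℤ,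
      dirElt k R ((τ.letter (r - 1)).map Letter.inv) * x (r - 1) =
        x r * dirElt k R (c.letter (-σ.length - r)) ∧
      invElt k R ((τ.letter (r - 1)).map Letter.inv) * x r =
        x (r - 1) * invElt k R (c.letter (-σ.length - r)) := by
    intro r
    rcases lt_trichotomy r 1 with hr | rfl | hr
    · obtain ⟨j, rfl⟩ : ∃ j : ℕ, r = -j := ⟨(-r).toNat, by omega⟩
      have h1 := hx2 (j + 1)
      rw [show (-((j + 1 : ℕ) : ℤ)) = -j - 1 by push_cast; ring] at h1
      rw [h1, hx2, sub_neg_eq_add]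
      exact ⟨hl.dir j, hl.inv j⟩
    · rw [sub_self, hc.wrap, hx0, hl0, dirElt_map_inv, invElt_map_inv]
      rcases hz : τ.letter 0 with _ | z
      · simp
      · have hzf := h.string_right z hz
        have hb : τ.IsBullet (0 + 1) := (h.string.coherent hz).2.2.1
        have hv : z.rightVertex = τ.vert (0 + 1) := (h.string.coherent hz).2.2.2.1
        rw [zero_add] at hb hv
        rw [hx1 1 one_pos hb, invElt_of_inverse hzf.1, dirElt_of_inverse hzf.1, Option.map_some,
          dirElt_of_direct rfl, invElt_of_direct rfl, mul_zero, zero_mul, pathElt_append]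
        refine ⟨?_, rfl⟩
        have h1 := idem_mul_invElt (k := k) (R := R) (o := some z) (v := z.rightVertex)
          (by rintro _ ⟨⟩; rfl)
        have h2 := invElt_mul_idem (k := k) (R := R) (o := some z) (v := τ.base)
          (by rintro _ ⟨⟩; exact h.string.base_right z hz)
        rw [invElt_of_inverse hzf.1, hzf.2] at h1 h2
        rw [hzf.2, ← mul_assoc, h2, ← mul_assoc, ← hv, h1]
    · refine string_edge h.string r _ ?_ (hx1 _ (by omega)) (hx1 _ (by omega))
      rw [hc.below _ (by omega)]
      congr 2
      ring
  have hsupp : ∀ j : ℕ, l j ≠ 0 → ∀ j' ≤ j,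
      τ.IsBullet (-j') ∧ τ.degree (-j') = c.degree (-σ.length + j') := by
    intro j hj j' hj'
    induction j' with
    | zero =>
      refine ⟨trivial, ?_⟩
      have hN := h.two_le
      have h2 := (hc.match_band h lam m deg hdeg (σ.length - 1) (by omega)).2.2
      rw [show (-1 - ((σ.length - 1 : ℕ) : ℤ)) = -σ.length by omega, bandBullet_neg_length] at h2
      have h3 := (bandDiagram_coherent h.band lam m deg).degree i _ rfl
      have h4 : (bandDiagram k σ lam m deg).next i = bandBullet i 0 := rfl
      rw [h4, hdeg, Letter.sign, if_pos h.right_direct] at h3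
      rw [h3, add_sub_cancel_right] at h2
      rw [Nat.cast_zero, neg_zero, add_zero, h2, τ.degree_zero]
    | succ j' ih =>
      obtain ⟨y, z, hy, hz, hyz⟩ := hl.supp _ hj j' (by omega)
      obtain ⟨y, hy', rfl⟩ := Option.map_eq_some_iff.1 hy
      have h1 := h.string.coherent hy'
      have h2 := hcs.coherent hz
      have hyz' : y.inv.sign = z.sign := by rw [Letter.sign, Letter.sign, hyz]
      have h3 := (ih (by omega)).2
      rw [sub_add_cancel, h3] at h1
      have e : -((j' + 1 : ℕ) : ℤ) = -j' - 1 := by push_cast; ring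
      rw [e]
      push_cast
      rw [← add_assoc]
      refine ⟨h1.1, ?_⟩
      have h4 := h1.2.2.2.2
      rw [h2.2.2.2.2, ← hyz', Letter.inv_sign]
      linarith
  refine ⟨x, ⟨fun (r : ℤ) => ?_, fun r => (hedge r).1, fun r => (hedge r).2,
    fun (r : ℤ) hr => ?_, fun (r : ℤ) => ?_⟩, hx1, hx0.trans hl0⟩
  · change -(σ.length : ℤ) - ((r : ℤ) - 1) = -σ.length - r + 1
    ring
  · change τ.IsBullet r ∧ τ.degree r = c.degree (-σ.length - r)
    by_cases h0 : 0 < r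
    · have hb : τ.IsBullet r := by
        by_contra hb
        exact hr (by simp only [x, if_pos h0, if_neg hb])
      obtain ⟨n, rfl⟩ : ∃ n : ℕ, r = n + 1 := ⟨(r - 1).toNat, by omega⟩
      have h1 := hc.match_below h lam m deg hdeg n
      exact ⟨hb, (h1.2 (h1.1.2 hb)).2.symm⟩
    · obtain ⟨j, rfl⟩ : ∃ j : ℕ, r = -j := ⟨(-r).toNat, by omega⟩
      rw [hx2] at hr
      rw [sub_neg_eq_add]
      exact hsupp j hr j le_rfl
  · change idem k R (τ.vert r) * x r = x r
    by_cases h0 : 0 < r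
    · simp only [x, if_pos h0]
      split_ifs
      · rw [idem_mul_idem]
      · rw [mul_zero]
    · obtain ⟨j, rfl⟩ : ∃ j : ℕ, r = -j := ⟨(-r).toNat, by omega⟩
      rw [hx2]
      by_cases hz : l j = 0
      · rw [hz, mul_zero]
      · rcases j with _ | j
        · rw [hl0, Nat.cast_zero, neg_zero, τ.vert_zero, ← mul_assoc, idem_mul_idem]
        · obtain ⟨y, z, hy, -, -⟩ := hl.supp _ hz j (Nat.lt_succ_self j)
          have hv := hl.vert j y hy
          obtain ⟨y, hy', rfl⟩ := Option.map_eq_some_iff.1 hy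
          rw [Letter.inv_rightVertex, (h.string.coherent hy').2.1] at hv
          rw [show (-((j + 1 : ℕ) : ℤ)) = -j - 1 by push_cast; ring]
          exact hv

end GraphMapsOfSetup

/-! ### Bijectivity up to a locally nilpotent map. -/

section LocallyNilpotent

variable {A : Type*} [Ring A] {X Y : Type*} [AddCommGroup X] [Module A X] [AddCommGroup Y]
  [Module A Y]

/-- A linear map is bijective if, up to a locally nilpotent map, it has a surjective right
inverse. -/
theorem bijective_of_locally_nilpotent (Ψ : X →ₗ[A] Y) (J : Y →ₗ[A] X) (D : Y →ₗ[A] Y)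
    (hJ : Function.Surjective J) (hΨ : ∀ y, Ψ (J y) = y + D y)
    (hD : ∀ y, ∃ K : ℕ, (D ^ K) y = 0) : Function.Bijective Ψ := by
  refine ⟨(injective_iff_map_eq_zero Ψ).2 fun x hx => ?_, fun y => ?_⟩
  · obtain ⟨y, rfl⟩ := hJ x
    rw [hΨ] at hx
    -- On such `y` every power of `D` acts by a sign, so local nilpotency forces `y = 0`.
    have h1 : D y = -y := by rw [add_comm] at hx; exact eq_neg_of_add_eq_zero_left hx
    have h2 : ∀ K : ℕ, (D ^ K) y = 0 → y = 0 := by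
      intro K
      induction K with
      | zero => exact id
      | succ K ih =>
        intro h
        rw [pow_succ, Module.End.mul_apply, h1, map_neg, neg_eq_zero] at h
        exact ih h
    obtain ⟨K, hK⟩ := hD y
    rw [h2 K hK, map_zero]
  · have h2 : ∀ (K : ℕ) (y : Y), (D ^ K) y = 0 → y ∈ LinearMap.range Ψ := by
      intro K
      induction K with
      | zero =>
        intro y h
        rw [show y = 0 from h]
        exact Submodule.zero_mem _
      | succ K ih =>
        intro y h
        rw [pow_succ, Module.End.mul_apply] at h
        have h3 : y = Ψ (J y) - D y := by rw [hΨ, add_sub_cancel_right]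
        rw [h3]
        exact Submodule.sub_mem _ ⟨_, rfl⟩ (ih _ h)
    obtain ⟨K, hK⟩ := hD y
    exact h2 K y hK

end LocallyNilpotent

section

variable {k : Type u} [Field k] {V : Type u} [Quiver.{u} V] [Fintype V]
  {R : Quiver.Total V → Quiver.Total V → Prop}

namespace Unfolded

theorem IsGraphMap.smul {U U' : Unfolded k V} {g : U.ι → U'.ι} {x : U.ι → BoundAlgebra k R}
    (h : IsGraphMap U U' g x) (a : k) : IsGraphMap U U' g (fun i => a • x i) := by
  refine ⟨h.next, fun i => ?_, fun i => ?_, fun i hi => h.supp i fun h0 => hi ?_, fun i => ?_⟩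
  · rw [mul_smul_comm, smul_mul_assoc, h.dir]
  · rw [mul_smul_comm, smul_mul_assoc, h.inv]
  · rw [h0, smul_zero]
  · rw [mul_smul_comm, h.vert]

omit [Fintype V] in
theorem homotopyScalar_ne_zero (U : Unfolded k V) (hc : ∀ i, U.coeff i ≠ 0)
    (hl : ∀ i, U.letter i ≠ none) (i : U.ι) (j : ℕ) : U.homotopyScalar i j ≠ 0 := by
  induction j with
  | zero => exact one_ne_zero
  | succ j ih =>
    obtain ⟨x, hx⟩ := Option.ne_none_iff_exists'.1 (hl (U.next^[j] i))
    simp only [homotopyScalar, hx]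
    split_ifs
    · exact mul_ne_zero (neg_ne_zero.2 (inv_ne_zero (hc _))) ih
    · exact mul_ne_zero (neg_ne_zero.2 (hc _)) ih

open Classical in
theorem singleComponent_elt (U U' : Unfolded k V) (i : U.ι) (j : U'.ι) (a : BoundAlgebra k R)
    {n : ℤ} {b : U.ι} (hb : U.IsBullet b) (hd : U.degree b = n) (x : BoundAlgebra k R) :
    U.singleComponent R U' i j a n (U.elt n b x) =
      if b = i then U'.elt n j (x * idem k R (U.vert b) * a) else 0 := by
  rw [elt, dif_pos ⟨hb, hd⟩, singleComponent]
  erw [DirectSum.toModule_lof]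
  split_ifs
  · rw [into_apply]
  · rfl

/-- A map shifting the summands of an unfolded diagram is locally nilpotent if the shift decreases
some measure. -/
theorem lift_locally_nilpotent (U : Unfolded k V) (n : ℤ) (g : U.ι → U.ι)
    (x : U.ι → BoundAlgebra k R) (μ : U.ι → ℕ) (hx : ∀ i, μ i ≤ μ (g i) → x i = 0)
    (y : U.Obj R n) : ∃ K : ℕ, ((U.lift n (fun i => U.elt n (g i) (x i)) :
      Module.End (BoundAlgebra k R) (U.Obj R n)) ^ K) y = 0 := by
  set D : Module.End (BoundAlgebra k R) (U.Obj R n) :=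
    U.lift n (fun i => U.elt n (g i) (x i)) with hD
  have key : ∀ (K : ℕ) (i : U.ι) (a : BoundAlgebra k R), μ i < K →
      (D ^ K) (U.elt n i a) = 0 := by
    intro K
    induction K with
    | zero => intro i a h; omega
    | succ K ih =>
      intro i a h
      by_cases hi : U.IsBullet i ∧ U.degree i = n
      · rw [pow_succ, Module.End.mul_apply, hD, U.lift_elt n _ hi.1 hi.2, ← hD, map_smul]
        by_cases hμ : μ i ≤ μ (g i)
        · rw [hx i hμ, elt_zero, map_zero, smul_zero]
        · rw [ih _ _ (by omega), smul_zero]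
      · rw [U.elt_of_not hi, map_zero]
  refine U.obj_induction (C := fun y => ∃ K : ℕ, (D ^ K) y = 0) y ⟨0, map_zero _⟩ ?_ ?_
  · rintro y z ⟨K, hK⟩ ⟨L, hL⟩
    refine ⟨K + L, ?_⟩
    rw [map_add, pow_add, Module.End.mul_apply, Module.End.mul_apply, hL, map_zero, add_zero,
      ← Module.End.mul_apply, ← pow_add, add_comm, pow_add, Module.End.mul_apply, hK, map_zero]
  · exact fun i a _ _ => ⟨μ i + 1, key _ i a (Nat.lt_succ_self _)⟩

end Unfolded

end

/-! ### Specialised notation for the terms of string and band complexes. -/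

section Elements

variable {k : Type u} [Field k] {V : Type u} [Quiver.{u} V] [Fintype V]
  {R : Quiver.Total V → Quiver.Total V → Prop}

/-- The element `a` of the summand of the bullet `t` of a string complex. -/
def stringElt (s : PointedWord V) (n t : ℤ) (a : BoundAlgebra k R) :
    (stringDiagram k s).Obj R n := (stringDiagram k s).elt n t a

/-- A linear map out of a term of a string complex. -/
def stringLift (s : PointedWord V) (n : ℤ) {X : Type*} [AddCommGroup X]
    [Module (BoundAlgebra k R) X] (y : ℤ → X) :
    (stringDiagram k s).Obj R n →ₗ[BoundAlgebra k R] X := (stringDiagram k s).lift n y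

section

variable {s : PointedWord V} (n t : ℤ) (a b : BoundAlgebra k R)

theorem stringElt_of_not {n t : ℤ} (h : ¬ (s.IsBullet t ∧ s.degree t = n)) :
    stringElt s n t a = 0 := (stringDiagram k s).elt_of_not h a

theorem stringElt_add : stringElt s n t (a + b) = stringElt s n t a + stringElt s n t b :=
  (stringDiagram k s).elt_add n t a b

theorem stringElt_zero : stringElt s n t (0 : BoundAlgebra k R) = 0 :=
  (stringDiagram k s).elt_zero n t

theorem smul_stringElt : b • stringElt s n t a = stringElt s n t (b * a) :=
  (stringDiagram k s).smul_elt n t a b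

theorem stringElt_mul_idem : stringElt s n t (a * idem k R (s.vert t)) = stringElt s n t a :=
  (stringDiagram k s).elt_mul_idem n t a

theorem stringLift_elt {n t : ℤ} {X : Type*} [AddCommGroup X] [Module (BoundAlgebra k R) X]
    (y : ℤ → X) (hb : s.IsBullet t) (hd : s.degree t = n) :
    stringLift s n y (stringElt s n t a) = (a * idem k R (s.vert t)) • y t :=
  (stringDiagram k s).lift_elt n y hb hd a

theorem d_stringElt (hs : IsHomotopyString R s) :
    (stringDiagram k s).d R n (stringElt s n t a) =
      stringElt s (n + 1) (t + 1) (a * dirElt k R (s.letter t)) +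
        stringElt s (n + 1) (t - 1) (a * invElt k R (s.letter (t - 1))) := by
  have := (stringDiagram k s).d_elt (stringDiagram_coherent hs) n t a
  change _ = (stringDiagram k s).elt (n + 1) (t + 1) (a * ((1 : k) • dirElt k R (s.letter t))) +
    (stringDiagram k s).elt (n + 1) (t - 1)
      (a * ((1 : k) • invElt k R (s.letter (t - 1)))) at this
  rw [one_smul, one_smul] at this
  exact this

theorem string_induction {n : ℤ} {P : (stringDiagram k s).Obj R n → Prop} (zero : P 0)
    (add : ∀ x y, P x → P y → P (x + y))
    (elt : ∀ t a, s.IsBullet t → s.degree t = n → P (stringElt s n t a)) (x) : P x :=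
  (stringDiagram k s).obj_induction x zero add elt

end

section

variable {σ : List (Letter V)} {lam : k} {m : Fin σ.length} {deg : ℤ}

/-- The element `a` of the summand of the bullet `b` of a band complex. -/
def bandElt (σ : List (Letter V)) (lam : k) (m : Fin σ.length) (deg n : ℤ) (b : Fin σ.length)
    (a : BoundAlgebra k R) : (bandDiagram k σ lam m deg).Obj R n :=
  (bandDiagram k σ lam m deg).elt n b a

/-- A linear map out of a term of a band complex. -/
def bandLift (σ : List (Letter V)) (lam : k) (m : Fin σ.length) (deg n : ℤ) {X : Type*}
    [AddCommGroup X] [Module (BoundAlgebra k R) X] (y : Fin σ.length → X) :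
    (bandDiagram k σ lam m deg).Obj R n →ₗ[BoundAlgebra k R] X :=
  (bandDiagram k σ lam m deg).lift n y

variable (n : ℤ) (b : Fin σ.length) (a a' : BoundAlgebra k R)

theorem bandElt_of_not {n : ℤ} {b : Fin σ.length}
    (h : (bandDiagram k σ lam m deg).degree b ≠ n) : bandElt σ lam m deg n b a = 0 :=
  (bandDiagram k σ lam m deg).elt_of_not (fun h' => h h'.2) a

theorem smul_bandElt : a' • bandElt σ lam m deg n b a = bandElt σ lam m deg n b (a' * a) :=
  (bandDiagram k σ lam m deg).smul_elt n b a a'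

theorem bandElt_mul_idem : bandElt σ lam m deg n b (a * idem k R (σ.get b).leftVertex) =
    bandElt σ lam m deg n b a := (bandDiagram k σ lam m deg).elt_mul_idem n b a

theorem bandLift_elt {n : ℤ} {b : Fin σ.length} {X : Type*} [AddCommGroup X]
    [Module (BoundAlgebra k R) X] (y : Fin σ.length → X)
    (hd : (bandDiagram k σ lam m deg).degree b = n) :
    bandLift σ lam m deg n y (bandElt σ lam m deg n b a) =
      (a * idem k R (σ.get b).leftVertex) • y b :=
  (bandDiagram k σ lam m deg).lift_elt n y trivial hd a

theorem d_bandElt (hσ : IsHomotopyBand R σ) (i : Fin σ.length) (t : ℤ) :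
    (bandDiagram k σ lam m deg).d R n (bandElt σ lam m deg n (bandBullet i t) a) =
      bandElt σ lam m deg (n + 1) (bandBullet i (t + 1))
          (a * ((bandDiagram k σ lam m deg).coeff (bandBullet i t) •
            dirElt k R (some (σ.get (bandBullet i t))))) +
        bandElt σ lam m deg (n + 1) (bandBullet i (t - 1))
          (a * ((bandDiagram k σ lam m deg).coeff (bandBullet i (t - 1)) •
            invElt k R (some (σ.get (bandBullet i (t - 1)))))) := by
  rw [bandBullet_succ, ← finRotate_symm_bandBullet]
  exact (bandDiagram k σ lam m deg).d_elt (bandDiagram_coherent hσ lam m deg) n (bandBullet i t) a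

theorem band_induction (i : Fin σ.length) {n : ℤ}
    {P : (bandDiagram k σ lam m deg).Obj R n → Prop}
    (zero : P 0) (add : ∀ x y, P x → P y → P (x + y))
    (elt : ∀ t a, -(σ.length : ℤ) ≤ t → t ≤ -1 →
      (bandDiagram k σ lam m deg).degree (bandBullet i t) = n →
      P (bandElt σ lam m deg n (bandBullet i t) a)) (x) : P x := by
  refine (bandDiagram k σ lam m deg).obj_induction x zero add fun (b : Fin σ.length) a _ hd => ?_
  have h := bandIndex_mem i b
  have := elt (bandIndex i b) a h.1 h.2
  rw [bandBullet_bandIndex] at this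
  exact this hd

end

end Elements

/-! ### The component of the isomorphism on the band complex. -/

section ConeHomotopy

variable {k : Type u} [Field k] {V : Type u} [Quiver.{u} V]
  {R : Quiver.Total V → Quiver.Total V → Prop}
  {σ : List (Letter V)} {i : Fin σ.length} {τ : PointedWord V}
  {f : List (Quiver.Total V)} {hf : f ≠ []} {fL fR : List (Quiver.Total V)}
  {c : PointedWord V}

open Unfolded

theorem iterate_finRotate_bandBullet {N : ℕ} (i : Fin N) (t : ℤ) (j : ℕ) :
    (finRotate N)^[j] (bandBullet i t) = bandBullet i (t + j) := by
  induction j with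
  | zero => simp
  | succ j ih =>
    rw [Function.iterate_succ_apply', ih, ← bandBullet_succ]
    push_cast
    rw [add_assoc]

theorem bandDiagram_coeff_ne_zero {lam : k} (hlam : lam ≠ 0) (m : Fin σ.length) (deg : ℤ)
    (b : Fin σ.length) : (bandDiagram k σ lam m deg).coeff b ≠ 0 := by
  simp only [bandDiagram]
  split_ifs
  · exact hlam
  · exact one_ne_zero

/-- The scalars on the components of the band complex in the mapping cone. -/
def bandScalar (i : Fin σ.length) (lam : k) (m : Fin σ.length) (deg : ℤ) (t : ℤ) : k :=
  (bandDiagram k σ lam m deg).homotopyScalar (bandBullet i 0) (t + σ.length).toNat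

/-- The recursion starts at the bullet where the cut band begins. The accumulated signs and λ
therefore appear at bullet -1, in front of f. -/
theorem bandScalar_neg_length (i : Fin σ.length) (lam : k) (m : Fin σ.length) (deg : ℤ) :
    bandScalar i lam m deg (-σ.length) = 1 := by
  rw [bandScalar, neg_add_cancel]
  rfl

theorem bandScalar_ne_zero {lam : k} (hlam : lam ≠ 0) (m : Fin σ.length) (deg : ℤ) (t : ℤ) :
    bandScalar i lam m deg t ≠ 0 :=
  homotopyScalar_ne_zero _ (bandDiagram_coeff_ne_zero hlam m deg) (fun _ => by simp [bandDiagram])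
    _ _

theorem next_iterate_bandBullet (lam : k) (m : Fin σ.length) (deg : ℤ) {t : ℤ}
    (ht : -(σ.length : ℤ) ≤ t) :
    (bandDiagram k σ lam m deg).next^[(t + σ.length).toNat] (bandBullet i 0) = bandBullet i t := by
  rw [← bandBullet_neg_length]
  refine (iterate_finRotate_bandBullet i _ _).trans ?_
  congr 1
  omega

theorem bandScalar_direct {lam : k} (hlam : lam ≠ 0) (m : Fin σ.length) (deg : ℤ) {t : ℤ}
    (ht : -(σ.length : ℤ) ≤ t) (hd : (σ.get (bandBullet i t)).direct = true) :
    bandScalar i lam m deg t +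
      (bandDiagram k σ lam m deg).coeff (bandBullet i t) * bandScalar i lam m deg (t + 1) = 0 := by
  have h := homotopyScalar_direct (bandDiagram k σ lam m deg)
    (bandDiagram_coeff_ne_zero hlam m deg) (bandBullet i 0) (j := (t + σ.length).toNat)
    (x := σ.get (bandBullet i t)) (by rw [next_iterate_bandBullet lam m deg ht]; rfl) hd
  rw [next_iterate_bandBullet lam m deg ht] at h
  rw [bandScalar, bandScalar, show (t + 1 + σ.length).toNat = (t + σ.length).toNat + 1 by omega]
  exact h

theorem bandScalar_inverse (lam : k) (m : Fin σ.length) (deg : ℤ) {t : ℤ}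
    (ht : -(σ.length : ℤ) ≤ t) (hd : (σ.get (bandBullet i t)).direct = false) :
    bandScalar i lam m deg (t + 1) +
      (bandDiagram k σ lam m deg).coeff (bandBullet i t) * bandScalar i lam m deg t = 0 := by
  have h := homotopyScalar_inverse (bandDiagram k σ lam m deg)
    (bandBullet i 0) (j := (t + σ.length).toNat)
    (x := σ.get (bandBullet i t)) (by rw [next_iterate_bandBullet lam m deg ht]; rfl) hd
  rw [next_iterate_bandBullet lam m deg ht] at h
  rw [bandScalar, bandScalar, show (t + 1 + σ.length).toNat = (t + σ.length).toNat + 1 by omega]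
  exact h

variable [Fintype V] in
/-- The components of the map from the mapping cone on the summands of the band complex. -/
def coneHomotopy (R : Quiver.Total V → Quiver.Total V → Prop) (i : Fin σ.length) (c : PointedWord V)
    (lam : k) (m : Fin σ.length) (deg : ℤ) (p q : ℤ) :
    (bandDiagram k σ lam m deg).Obj R p →ₗ[BoundAlgebra k R] (stringDiagram k c).Obj R q :=
  bandLift σ lam m deg p fun b => stringElt c q (bandIndex i b)
    (bandScalar i lam m deg (bandIndex i b) • (1 : BoundAlgebra k R))

theorem IsConeWord.match_band' (hc : IsConeWord σ i τ f hf fL fR c)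
    (h : ConeSetup R σ i τ f hf fL fR) {lam : k} (m : Fin σ.length) (deg : ℤ)
    (hdeg : (bandDiagram k σ lam m deg).degree i = τ.deg) {t : ℤ} (h1 : -(σ.length : ℤ) ≤ t)
    (h2 : t ≤ -1) :
    c.IsBullet t ∧ c.vert t = (σ.get (bandBullet i t)).leftVertex ∧
      c.degree t = (bandDiagram k σ lam m deg).degree (bandBullet i t) - 1 := by
  have := hc.match_band h lam m deg hdeg (-1 - t).toNat (by omega)
  rwa [show -1 - ((-1 - t).toNat : ℤ) = t by omega] at this

variable [Fintype V] (hc : IsConeWord σ i τ f hf fL fR c) (h : ConeSetup R σ i τ f hf fL fR)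
  {lam : k} (m : Fin σ.length) (deg : ℤ) (hdeg : (bandDiagram k σ lam m deg).degree i = τ.deg)

include hc h hdeg

theorem coneHomotopy_elt (q : ℤ) {t : ℤ} (h1 : -(σ.length : ℤ) ≤ t) (h2 : t ≤ -1)
    (a : BoundAlgebra k R) :
    coneHomotopy R i c lam m deg (q + 1) q (bandElt σ lam m deg (q + 1) (bandBullet i t) a) =
      stringElt c q t (bandScalar i lam m deg t • a) := by
  obtain ⟨hb, hv, hd⟩ := hc.match_band' h m deg hdeg h1 h2
  by_cases hq : (bandDiagram k σ lam m deg).degree (bandBullet i t) = q + 1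
  · rw [coneHomotopy, bandLift_elt _ _ hq, bandIndex_bandBullet i h1 h2, ← hv, smul_stringElt,
      mul_smul_comm, mul_one, ← smul_mul_assoc, stringElt_mul_idem]
  · rw [bandElt_of_not _ hq, map_zero, stringElt_of_not]
    omega

open Classical in
-- Neighbouring bullets of the cut band remain neighbours in c, and the scalars make the two
-- contributions of each common letter cancel. The letter σR is cut: in c, bullet -1 has f to its
-- right, while in the band σR = f fR leads from it to bullet 0, which is bullet -N again. These two
-- terms remain.
theorem coneHomotopy_spec (hlam : lam ≠ 0) (q : ℤ) {t : ℤ} (h1 : -(σ.length : ℤ) ≤ t)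
    (h2 : t ≤ -1) :
    (stringDiagram k c).d R q (coneHomotopy R i c lam m deg (q + 1) q
        (bandElt σ lam m deg (q + 1) (bandBullet i t) 1)) +
      coneHomotopy R i c lam m deg (q + 1 + 1) (q + 1) ((bandDiagram k σ lam m deg).d R (q + 1)
        (bandElt σ lam m deg (q + 1) (bandBullet i t) 1)) =
      if t = -1 then
        stringElt c (q + 1) 0 (bandScalar i lam m deg (-1) • pathElt k R f) +
          stringElt c (q + 1) (-σ.length)
            ((bandDiagram k σ lam m deg).coeff i • pathElt k R (f ++ fR))
      else 0 := by
  have hN := h.two_le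
  rw [coneHomotopy_elt hc h m deg hdeg q h1 h2, d_stringElt _ _ _ (hc.isHomotopyString h),
    d_bandElt _ _ h.band, map_add, one_mul, one_mul, smul_one_mul, smul_one_mul, add_add_add_comm]
  have hL : stringElt c (q + 1) (t - 1)
        (bandScalar i lam m deg t • invElt k R (c.letter (t - 1))) +
      coneHomotopy R i c lam m deg (q + 1 + 1) (q + 1) (bandElt σ lam m deg
        (q + 1 + 1) (bandBullet i (t - 1))
        ((bandDiagram k σ lam m deg).coeff (bandBullet i (t - 1)) •
          invElt k R (some (σ.get (bandBullet i (t - 1)))))) = 0 := by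
    -- To the left of bullet -N there is σR in the band and the merged letter or nothing in c.
    -- Direct letters contribute nothing out of their right ends.
    rcases h1.eq_or_lt with rfl | h1
    · rw [hc.wrap]
      have e : bandBullet i (-σ.length - 1) = i := by
        rw [← bandBullet_add_length, show -(σ.length : ℤ) - 1 + σ.length = -1 by ring,
          bandBullet_neg_one]
      have e0 : bandElt σ lam m deg (q + 1 + 1) i (0 : BoundAlgebra k R) = 0 :=
        (bandDiagram k σ lam m deg).elt_zero _ _
      rw [e, invElt_of_direct h.right_direct, smul_zero, e0, map_zero, add_zero]
      rcases τ.letter 0 with _ | z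
      · simp [stringElt_zero]
      · rw [Option.map_some, invElt_of_direct rfl, smul_zero, stringElt_zero]
    · rw [coneHomotopy_elt hc h m deg hdeg (q + 1) (by omega) (by omega),
        hc.band (t - 1) (by omega) (by omega), ← stringElt_add, smul_smul, ← add_smul]
      rcases hd : (σ.get (bandBullet i (t - 1))).direct
      · have := bandScalar_inverse (i := i) lam m deg (t := t - 1) (by omega) hd
        rw [sub_add_cancel] at this
        rw [mul_comm (bandScalar _ _ _ _ _), this, zero_smul, stringElt_zero]
      · rw [invElt_of_direct hd, smul_zero, stringElt_zero]
  rw [hL, add_zero]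
  split_ifs with ht
  · subst ht
    have e : bandBullet i (-1 + 1) = bandBullet i (-σ.length) := by
      rw [bandBullet_neg_length]; rfl
    rw [hc.neg_one, dirElt_of_direct rfl, e,
      coneHomotopy_elt hc h m deg hdeg (q + 1) le_rfl (by omega), bandScalar_neg_length, one_smul,
      bandBullet_neg_one, dirElt_of_direct h.right_direct, h.right_arrows]
    rfl
  · rw [coneHomotopy_elt hc h m deg hdeg (q + 1) (by omega) (by omega), hc.band t h1 (by omega),
      ← stringElt_add, smul_smul, ← add_smul]
    rcases hd : (σ.get (bandBullet i t)).direct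
    · rw [dirElt_of_inverse hd, smul_zero, stringElt_zero]
    · rw [mul_comm (bandScalar _ _ _ _ _), bandScalar_direct hlam m deg h1 hd, zero_smul,
        stringElt_zero]

end ConeHomotopy

/-! ### The map from the mapping cone and its bijectivity. -/

section MappingCone

variable {k : Type u} [Field k] {V : Type u} [Quiver.{u} V] [Fintype V]
  {R : Quiver.Total V → Quiver.Total V → Prop}
  {σ : List (Letter V)} {i : Fin σ.length} {τ : PointedWord V}
  {f : List (Quiver.Total V)} {hf : f ≠ []} {fL fR : List (Quiver.Total V)}
  {c : PointedWord V}

open Unfolded CochainComplex HomComplex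

theorem exists_stringMap {s s' : PointedWord V} (hs : IsHomotopyString R s)
    (hs' : IsHomotopyString R s') {g : ℤ → ℤ} {x : ℤ → BoundAlgebra k R}
    (hx : IsGraphMap (stringDiagram k s).rev (stringDiagram k s') g x) :
    ∃ u : ∀ n, (stringDiagram k s).Obj R n →ₗ[BoundAlgebra k R] (stringDiagram k s').Obj R n,
      (∀ n, ((stringDiagram k s').d R n).comp (u n) = (u (n + 1)).comp ((stringDiagram k s).d R n)) ∧
      ∀ n r a, u n (stringElt s n r a) = stringElt s' n (g r) (a * x r) := by
  have hsc := stringDiagram_coherent (k := k) hs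
  refine ⟨fun n => (stringDiagram k s).rev.graphMap (stringDiagram k s') g x n, fun n => ?_,
    fun n r a => hx.graphMap_elt n r a⟩
  rw [← rev_d _ hsc]
  exact hx.comm hsc.rev (stringDiagram_coherent hs') (fun _ => rfl) (fun _ => rfl) n

theorem smul_stringElt_one {s : PointedWord V} (n t : ℤ) (a : BoundAlgebra k R) :
    (a * idem k R (s.vert t)) • stringElt s n t (1 : BoundAlgebra k R) = stringElt s n t a := by
  rw [smul_stringElt, mul_one, stringElt_mul_idem]

theorem singleComponent_bandElt {lam : k} {m : Fin σ.length} {deg n : ℤ} {b : Fin σ.length}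
    (r : ℤ) (a x : BoundAlgebra k R) (hd : (bandDiagram k σ lam m deg).degree b = n) :
    (bandDiagram k σ lam m deg).singleComponent R (stringDiagram k τ) i r a n
        (bandElt σ lam m deg n b x) =
      if b = i then stringElt τ n r (x * idem k R (σ.get b).leftVertex * a) else 0 := by
  have := singleComponent_elt (bandDiagram k σ lam m deg) (stringDiagram k τ) i r a trivial hd x
  by_cases hb : b = i
  · rw [if_pos hb]
    exact this.trans (if_pos hb)
  · rw [if_neg hb]
    exact this.trans (if_neg hb)

/-- On each bullet of τ one of the two graph maps is the identity part, while the other lands N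
steps closer to the band. Inverting the identity parts leaves an error that is locally nilpotent,
even if τ is infinite. -/
theorem ConeSetup.bijective_of_cone (h : ConeSetup R σ i τ f hf fL fR)
    (hc : IsConeWord σ i τ f hf fL fR c) {lam : k} (hlam : lam ≠ 0) (m : Fin σ.length) (deg : ℤ)
    (hdeg : (bandDiagram k σ lam m deg).degree i = τ.deg)
    {x₁ x₂ : ℤ → BoundAlgebra k R}
    (hx₂' : ∀ r ≤ 0, τ.IsBullet r → x₂ r = idem k R (τ.vert r))
    (hx₁' : ∀ r > 0, τ.IsBullet r → x₁ r = idem k R (τ.vert r))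
    (n : ℤ) {X : Type u} [AddCommGroup X] [Module (BoundAlgebra k R) X]
    (inlL : (bandDiagram k σ lam m deg).Obj R (n + 1) →ₗ[BoundAlgebra k R] X)
    (inrL : (stringDiagram k τ).Obj R n →ₗ[BoundAlgebra k R] X)
    (ψ : X →ₗ[BoundAlgebra k R] (stringDiagram k c).Obj R n)
    (hinl : ∀ x, ψ (inlL x) = coneHomotopy R i c lam m deg (n + 1) n x)
    (hinr : ∀ r a, ψ (inrL (stringElt τ n r a)) =
      stringElt c n (-r) (a * bandScalar i lam m deg (-1) • x₂ r) +
        stringElt c n (-(σ.length : ℤ) - r) (a * (bandDiagram k σ lam m deg).coeff i • x₁ r))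
    (hid : ∀ x, ∃ y z, x = inlL y + inrL z) : Function.Bijective ψ := by
  have hN := h.two_le
  let N : ℤ := σ.length
  let a₂ : k := bandScalar i lam m deg (-1)
  let a₁ : k := (bandDiagram k σ lam m deg).coeff i
  have ha₂ : a₂ ≠ 0 := bandScalar_ne_zero hlam m deg _
  have ha₁ : a₁ ≠ 0 := bandDiagram_coeff_ne_zero hlam m deg i
  have hs : ∀ (b b' : k) (x : BoundAlgebra k R), (b • (1 : BoundAlgebra k R)) * b' • x =
      b • b' • x := fun b b' x => by rw [smul_one_mul]
  -- `J` inverts the identity parts: each bullet of c goes back to the bullet of τ or of the band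
  -- from which it comes, with the inverse scalar.
  let J : (stringDiagram k c).Obj R n →ₗ[BoundAlgebra k R] X :=
    stringLift c n fun t => if 0 ≤ t then inrL (stringElt τ n (-t) (a₂⁻¹ • 1))
      else if -N ≤ t then
        inlL (bandElt σ lam m deg (n + 1) (bandBullet i t) ((bandScalar i lam m deg t)⁻¹ • 1))
      else inrL (stringElt τ n (-N - t) (a₁⁻¹ • 1))
  let g : ℤ → ℤ := fun t => if 0 ≤ t then -N + t else N + t
  let y : ℤ → BoundAlgebra k R := fun t => if 0 ≤ t then a₂⁻¹ • a₁ • x₁ (-t)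
    else if -N ≤ t then 0 else a₁⁻¹ • a₂ • x₂ (-N - t)
  -- The distance to the block -N, …, -1. The error moves outer bullets by N towards this block and
  -- is zero on the block, so the measure drops wherever the error is nonzero.
  let μ : ℤ → ℕ := fun t => if 0 ≤ t then (t + 1).toNat else if -N ≤ t then 0
    else (-N - t).toNat
  let D : Module.End (BoundAlgebra k R) ((stringDiagram k c).Obj R n) :=
    (stringDiagram k c).lift n fun t : ℤ => (stringDiagram k c).elt n (g t) (y t)
  have hDe : ∀ t a, c.IsBullet t → c.degree t = n → D (stringElt c n t a) =
      (a * idem k R (c.vert t)) • stringElt c n (g t) (y t) := fun t a hb hd =>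
    (stringDiagram k c).lift_elt n _ hb hd a
  have hD : ∀ x, ∃ K : ℕ, (D ^ K) x = 0 :=
    (stringDiagram k c).lift_locally_nilpotent n g y μ fun (t : ℤ) ht => by
      simp only [μ, g, y] at ht ⊢
      split_ifs at ht ⊢ <;> first | rfl | omega
  have hpos : ∀ t : ℤ, 0 ≤ t → c.IsBullet t →
      τ.IsBullet (-t) ∧ c.vert t = τ.vert (-t) := fun t ht hb => by
    obtain ⟨l, rfl⟩ := Int.eq_ofNat_of_zero_le ht
    have := hc.match_nonneg h l
    exact ⟨this.1.1 hb, (this.2 hb).1⟩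
  have hneg : ∀ t : ℤ, t < -N → c.IsBullet t →
      τ.IsBullet (-N - t) ∧ c.vert t = τ.vert (-N - t) := fun t ht hb => by
    obtain ⟨l, rfl⟩ : ∃ l : ℕ, t = -σ.length - (l + 1) := ⟨(-N - t - 1).toNat, by omega⟩
    have := hc.match_below h lam m deg hdeg l
    rw [show -N - (-(σ.length : ℤ) - (l + 1)) = l + 1 by ring]
    exact ⟨this.1.1 hb, (this.2 hb).1⟩
  have hψJ : ∀ x, ψ (J x) = x + D x := by
    refine string_induction ?_ ?_ ?_
    · rw [map_zero, map_zero, map_zero, add_zero]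
    · intro x z hx hz
      rw [map_add, map_add, map_add, hx, hz, add_add_add_comm]
    · intro t a hb hd
      rw [hDe t a hb hd, stringLift_elt _ _ hb hd, map_smul]
      conv_rhs => arg 1; rw [← smul_stringElt_one]
      rw [← smul_add]
      congr 1
      simp only [g, y]
      split_ifs with h1 h2
      · obtain ⟨hb', hv⟩ := hpos t h1 hb
        rw [hinr, hx₂' _ (by omega) hb', ← hv, neg_neg, sub_neg_eq_add, hs, hs,
          inv_smul_smul₀ ha₂]
        congr 1
        rw [← stringElt_mul_idem n t 1, one_mul]
      · rw [hinl, coneHomotopy_elt hc h m deg hdeg n h2 (by omega), smul_smul,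
          mul_inv_cancel₀ (bandScalar_ne_zero hlam m deg t), one_smul, stringElt_zero, add_zero]
      · obtain ⟨hb', hv⟩ := hneg t (by omega) hb
        rw [hinr, hx₁' _ (by omega) hb', ← hv, hs, hs, inv_smul_smul₀ ha₁, add_comm, sub_sub_cancel,
          neg_sub, sub_neg_eq_add, add_comm t]
        congr 1
        rw [← stringElt_mul_idem n t 1, one_mul]
  have hinr_mem : ∀ x, inrL x ∈ LinearMap.range J := by
    refine string_induction ?_ ?_ ?_
    · rw [map_zero]
      exact Submodule.zero_mem _
    · intro x z hx hz
      rw [map_add]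
      exact Submodule.add_mem _ hx hz
    · intro r a hb hd
      have key : ∀ (t : ℤ) (b : k), b ≠ 0 → c.IsBullet t → c.degree t = n →
          c.vert t = τ.vert r → J (stringElt c n t (b • a)) =
            ((b • a) * idem k R (c.vert t)) • inrL (stringElt τ n r (b⁻¹ • 1)) →
          inrL (stringElt τ n r a) ∈ LinearMap.range J := by
        intro t b hb0 _ _ hv hJ
        refine ⟨_, hJ.trans ?_⟩
        rw [← map_smul, smul_stringElt, hv, smul_mul_assoc, smul_mul_smul_comm,
          mul_inv_cancel₀ hb0, one_smul, mul_one, stringElt_mul_idem]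
      rcases le_or_gt r 0 with hr | hr
      · obtain ⟨l, rfl⟩ : ∃ l : ℕ, r = -l := ⟨(-r).toNat, by omega⟩
        have hm := hc.match_nonneg h l
        have hb' := hm.1.2 hb
        have hm' := hm.2 hb'
        refine key l a₂ ha₂ hb' (hm'.2.trans hd) hm'.1 ?_
        rw [stringLift_elt _ _ hb' (hm'.2.trans hd), if_pos (by positivity)]
      · obtain ⟨l, rfl⟩ : ∃ l : ℕ, r = l + 1 := ⟨(r - 1).toNat, by omega⟩
        have hm := hc.match_below h lam m deg hdeg l
        have hb' := hm.1.2 hb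
        have hm' := hm.2 hb'
        refine key (-σ.length - (l + 1)) a₁ ha₁ hb' (hm'.2.trans hd) hm'.1 ?_
        rw [stringLift_elt _ _ hb' (hm'.2.trans hd), if_neg (by omega), if_neg (by omega),
          show -N - (-(σ.length : ℤ) - (l + 1)) = l + 1 by ring]
  have hinl_mem : ∀ x, inlL x ∈ LinearMap.range J := by
    refine band_induction i ?_ ?_ ?_
    · rw [map_zero]
      exact Submodule.zero_mem _
    · intro x z hx hz
      rw [map_add]
      exact Submodule.add_mem _ hx hz
    · intro t a h1 h2 hd
      obtain ⟨hb, hv, hd'⟩ := hc.match_band' h m deg hdeg h1 h2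
      refine ⟨stringElt c n t (bandScalar i lam m deg t • a), ?_⟩
      rw [stringLift_elt _ _ hb (by omega), if_neg (by omega), if_pos h1, ← map_smul,
        smul_bandElt, hv, smul_mul_assoc, smul_mul_smul_comm,
        mul_inv_cancel₀ (bandScalar_ne_zero hlam m deg t), one_smul, mul_one, bandElt_mul_idem]
  have hJ : Function.Surjective J := fun x => by
    obtain ⟨y, z, rfl⟩ := hid x
    exact Submodule.add_mem _ (hinl_mem y) (hinr_mem z)
  exact bijective_of_locally_nilpotent (Y := (stringDiagram k c).Obj R n) ψ J D hJ hψJ hD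

/-- Composing f with the two graph maps at bullet 0 of τ gives f into bullet 0 and f fR into bullet
-N, precisely the terms left over by `coneHomotopy_spec`. This fixes the scalars of the two maps. -/
theorem ConeSetup.comp_singleComponent (h : ConeSetup R σ i τ f hf fL fR)
    (hc : IsConeWord σ i τ f hf fL fR c) {lam : k} (hlam : lam ≠ 0) (m : Fin σ.length) (deg : ℤ)
    (hdeg : (bandDiagram k σ lam m deg).degree i = τ.deg)
    {x₁ x₂ : ℤ → BoundAlgebra k R}
    (hx₂' : ∀ r ≤ 0, τ.IsBullet r → x₂ r = idem k R (τ.vert r))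
    (hx₁0 : x₁ 0 = idem k R τ.base * pathElt k R fR) {q : ℤ}
    (u : (stringDiagram k τ).Obj R (q + 1) →ₗ[BoundAlgebra k R]
      (stringDiagram k c).Obj R (q + 1))
    (hu : ∀ r a, u (stringElt τ (q + 1) r a) =
      stringElt c (q + 1) (-r) (a * bandScalar i lam m deg (-1) • x₂ r) +
        stringElt c (q + 1) (-(σ.length : ℤ) - r)
          (a * (bandDiagram k σ lam m deg).coeff i • x₁ r)) :
    u.comp ((bandDiagram k σ lam m deg).singleComponent R (stringDiagram k τ) i (0 : ℤ)
        (pathElt k R f) (q + 1)) =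
      ((stringDiagram k c).d R q).comp (coneHomotopy R i c lam m deg (q + 1) q) +
        (coneHomotopy R i c lam m deg (q + 1 + 1) (q + 1)).comp
          ((bandDiagram k σ lam m deg).d R (q + 1)) := by
  have hN := h.two_le
  refine LinearMap.ext fun y => ?_
  refine band_induction i (P := fun y => _ = _) ?_ ?_ ?_ y
  · rw [map_zero, map_zero]
  · intro y z hy hz
    rw [map_add, map_add, hy, hz]
  · intro t a h1 h2 hd
    rw [show bandElt σ lam m deg (q + 1) (bandBullet i t) a =
      a • bandElt σ lam m deg (q + 1) (bandBullet i t) 1 by rw [smul_bandElt, mul_one],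
      map_smul, map_smul]
    congr 1
    refine Eq.trans ?_ (coneHomotopy_spec hc h m deg hdeg hlam q h1 h2).symm
    rw [LinearMap.comp_apply, singleComponent_bandElt _ _ _ hd]
    by_cases ht : t = -1
    · have hv : idem k R (σ.get i).leftVertex * pathElt k R f = pathElt k R f := by
        rw [← h.ends]
        exact idem_mul_pathElt hf
      have hv' : pathElt k R f * idem k R τ.base = pathElt k R f := by
        rw [← h.starts]
        exact pathElt_mul_idem hf
      subst ht
      rw [bandBullet_neg_one, if_pos rfl, if_pos rfl, one_mul, hv, hu, hx₂' 0 le_rfl trivial, hx₁0,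
        mul_smul_comm, mul_smul_comm, τ.vert_zero, ← mul_assoc, hv', ← pathElt_append, neg_zero,
        sub_zero]
    · have hb : bandBullet i t ≠ i := fun hb => ht <| by
        have := bandIndex_bandBullet i h1 h2
        have h' := bandIndex_bandBullet i (t := -1) (by omega) le_rfl
        rw [bandBullet_neg_one] at h'
        rw [← this, hb, h']
      rw [if_neg hb, if_neg ht, map_zero]

theorem ConeSetup.nonempty_iso (h : ConeSetup R σ i τ f hf fL fR)
    (hc : IsConeWord σ i τ f hf fL fR c) {lam : k} (hlam : lam ≠ 0) (m : Fin σ.length) (deg : ℤ)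
    (hdeg : (bandDiagram k σ lam m deg).degree i = τ.deg)
    (hcs : IsHomotopyString R c)
    {x₁ x₂ : ℤ → BoundAlgebra k R}
    (hx₂ : IsGraphMap (stringDiagram k τ).rev (stringDiagram k c) (fun r : ℤ => -r) x₂)
    (hx₂' : ∀ r ≤ 0, τ.IsBullet r → x₂ r = idem k R (τ.vert r))
    (hx₁ : IsGraphMap (stringDiagram k τ).rev (stringDiagram k c)
      (fun r : ℤ => -(σ.length : ℤ) - r) x₁)
    (hx₁' : ∀ r > 0, τ.IsBullet r → x₁ r = idem k R (τ.vert r))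
    (hx₁0 : x₁ 0 = idem k R τ.base * pathElt k R fR)
    (hστ : IsHomotopyBand R σ) (hτ : IsHomotopyString R τ)
    (F : bandComplex k hστ lam m deg ⟶ stringComplex k hτ)
    (hF : ∀ n : ℤ, F.f n = ModuleCat.ofHom ((bandDiagram k σ lam m deg).singleComponent R
      (stringDiagram k τ) i (0 : ℤ) (pathElt k R f) n)) :
    Nonempty (mappingCone F ≅ stringComplex k hcs) := by
  classical
  have hN := h.two_le
  let N : ℤ := σ.length
  let a₂ : k := bandScalar i lam m deg (-1)
  let a₁ : k := (bandDiagram k σ lam m deg).coeff i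
  have ha₂ : a₂ ≠ 0 := bandScalar_ne_zero hlam m deg _
  have ha₁ : a₁ ≠ 0 := bandDiagram_coeff_ne_zero hlam m deg i
  obtain ⟨u₂, hu₂, hu₂e⟩ := exists_stringMap hτ hcs (hx₂.smul a₂)
  obtain ⟨u₁, hu₁, hu₁e⟩ := exists_stringMap hτ hcs (hx₁.smul a₁)
  let u : ∀ n, (stringDiagram k τ).Obj R n →ₗ[BoundAlgebra k R] (stringDiagram k c).Obj R n :=
    fun n => u₂ n + u₁ n
  have hu : ∀ n r a, u n (stringElt τ n r a) =
      stringElt c n (-r) (a * a₂ • x₂ r) + stringElt c n (-N - r) (a * a₁ • x₁ r) := by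
    intro n r a
    rw [LinearMap.add_apply, hu₂e, hu₁e]
  let W : stringComplex k hτ ⟶ stringComplex k hcs :=
    chainMap (stringDiagram_isReduced k hτ) (stringDiagram_isReduced k hcs) u fun n => by
      rw [LinearMap.comp_add, LinearMap.add_comp, hu₂, hu₁]
  let φ := coneHomotopy R i c lam m deg
  have hδ : δ (-1) 0 (cochain (bandDiagram_isReduced k hστ lam m deg)
      (stringDiagram_isReduced k hcs) φ) = Cochain.ofHom (F ≫ W) := by
    refine δ_cochain _ _ φ (F ≫ W) fun q => ?_
    refine (HomologicalComplex.comp_f F W (q + 1)).trans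
      ((congrArg (· ≫ W.f (q + 1)) (hF (q + 1))).trans ?_)
    exact congrArg (homOf (R := R) (U := bandDiagram k σ lam m deg) (U' := stringDiagram k c))
      (h.comp_singleComponent hc hlam m deg hdeg hx₂' hx₁0 (u (q + 1)) (hu (q + 1)))
  let Ψ : mappingCone F ⟶ stringComplex k hcs := mappingCone.desc F _ W hδ
  have hiso : ∀ n, IsIso (Ψ.f n) := by
    intro n
    let inlL : (bandDiagram k σ lam m deg).Obj R (n + 1) →ₗ[BoundAlgebra k R]
      (mappingCone F).X n := ((mappingCone.inl F).v (n + 1) n (by omega)).hom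
    let inrL : (stringDiagram k τ).Obj R n →ₗ[BoundAlgebra k R]
      (mappingCone F).X n := ((mappingCone.inr F).f n).hom
    let ψ : (mappingCone F).X n →ₗ[BoundAlgebra k R] (stringDiagram k c).Obj R n := (Ψ.f n).hom
    have hinl : ∀ x, ψ (inlL x) = φ (n + 1) n x := fun x =>
      LinearMap.congr_fun (congrArg ModuleCat.Hom.hom
        (mappingCone.inl_v_desc_f F _ W hδ (n + 1) n (by omega))) x
    have hinr : ∀ x, ψ (inrL x) = u n x := fun x =>
      LinearMap.congr_fun (congrArg ModuleCat.Hom.hom (mappingCone.inr_f_desc_f F _ W hδ n)) x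
    have hid : ∀ x : (mappingCone F).X n, ∃ y z, x = inlL y + inrL z := fun x =>
      ⟨((mappingCone.fst F).1.v n (n + 1) rfl).hom x, ((mappingCone.snd F).v n n (add_zero n)).hom x,
        (LinearMap.congr_fun (congrArg ModuleCat.Hom.hom
          (mappingCone.id_X F n (n + 1) rfl)) x).symm⟩
    exact (ConcreteCategory.isIso_iff_bijective (Ψ.f n)).2
      (h.bijective_of_cone hc hlam m deg hdeg hx₂' hx₁' n inlL inrL ψ hinl
        (fun r a => (hinr _).trans (hu n r a)) hid)
  have : IsIso Ψ := HomologicalComplex.Hom.isIso_of_components Ψ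
  exact ⟨asIso Ψ⟩

end MappingCone

/-! ### Situations in which the single map is null-homotopic. -/

section NullHomotopies

variable {k : Type u} [Field k] {V : Type u} [Quiver.{u} V] [Fintype V]
  {R : Quiver.Total V → Quiver.Total V → Prop}

theorem HalfMap.smul {p q : ℕ → Option (Letter V)} {a : ℕ → BoundAlgebra k R}
    (h : HalfMap k R p q a) (b : k) : HalfMap k R p q fun j => b • a j := by
  refine ⟨fun j => ?_, fun j => ?_, fun j hj => h.supp j fun h0 => hj ?_, fun j x hx => ?_, ?_⟩
  · rw [mul_smul_comm, smul_mul_assoc, h.dir]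
  · rw [mul_smul_comm, smul_mul_assoc, h.inv]
  · rw [h0, smul_zero]
  · rw [mul_smul_comm, h.vert j x hx]
  · obtain ⟨K, hK⟩ := h.finite
    exact ⟨K, fun j hj => by rw [hK j hj, smul_zero]⟩

namespace Unfolded

variable {U U' : Unfolded k V}

theorem single_add_eq_right {i i₁ i₂ : U.ι} {j j₁ j₂ : U'.ι} {a a₁ a₂ : BoundAlgebra k R}
    (ha : a = 0) (hi : i₁ = i₂) (hj : j₁ = j₂) (h : a₁ = a₂) (p q : ℤ) :
    U.single U' i j a p q + U.single U' i₁ j₁ a₁ p q = U.single U' i₂ j₂ a₂ p q := by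
  rw [ha, hi, hj, h, single_zero, zero_add]

theorem single_add_eq_left {i i₁ i₂ : U.ι} {j j₁ j₂ : U'.ι} {a a₁ a₂ : BoundAlgebra k R}
    (ha : a = 0) (hi : i₁ = i₂) (hj : j₁ = j₂) (h : a₁ = a₂) (p q : ℤ) :
    U.single U' i₁ j₁ a₁ p q + U.single U' i j a p q = U.single U' i₂ j₂ a₂ p q := by
  rw [ha, hi, hj, h, single_zero, add_zero]

/-- The null homotopy with a single component, from the bullet `i` to the bullet `j`. -/
theorem single_homotopy (hU : U.Coherent) (hU' : U'.Coherent) {i : U.ι} {j j' : U'.ι}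
    {a b : BoundAlgebra k R} (ha : idem k R (U.vert i) * a = a) (hj : U'.next j = j')
    (h1 : a * (U'.coeff j • dirElt k R (U'.letter j)) = b)
    (h2 : a * (U'.coeff (U'.next.symm j) • invElt k R (U'.letter (U'.next.symm j))) = 0)
    (h3 : U.coeff (U.next.symm i) • dirElt k R (U.letter (U.next.symm i)) * a = 0)
    (h4 : U.coeff i • invElt k R (U.letter i) * a = 0) (q : ℤ) :
    (U'.d R q).comp (U.single U' i j a (q + 1) q) +
      (U.single U' i j a (q + 1 + 1) (q + 1)).comp (U.d R (q + 1)) =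
    U.single U' i j' b (q + 1) (q + 1) := by
  rw [d_comp_single _ _ _ hU' ha, single_comp_d _ _ _ hU ha, h1, h2, h3, h4, hj, single_zero,
    single_zero, single_zero, add_zero, add_zero, add_zero]

theorem singleComponent_eq_single (U U' : Unfolded k V) (i : U.ι) (j : U'.ι)
    {a : BoundAlgebra k R} (ha : idem k R (U.vert i) * a = a) (n : ℤ) :
    U.singleComponent R U' i j a n = U.single U' i j a n n := by
  classical
  refine U.hom_ext_elt fun b hb hd => ?_
  rw [single_elt U U' j ha n n hb hd, U.singleComponent_elt U' i j a hb hd]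
  by_cases h : b = i
  · rw [if_pos h, if_pos h, h, mul_assoc, ha]
  · rw [if_neg h, if_neg h]

end Unfolded

open Unfolded

variable {σ : List (Letter V)} {i : Fin σ.length} {τ : PointedWord V}
  {f : List (Quiver.Total V)} {hf : f ≠ []} {fL fR : List (Quiver.Total V)}
  {lam : k} {m : Fin σ.length} {deg : ℤ}
  {hσ : IsHomotopyBand R σ} {hτ : IsHomotopyString R τ}
  {F : bandComplex k hσ lam m deg ⟶ stringComplex k hτ}

theorem nonempty_homotopy_zero {a : BoundAlgebra k R}
    (ha : idem k R (σ.get i).leftVertex * a = a)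
    (hF : ∀ n : ℤ, F.f n = ModuleCat.ofHom ((bandDiagram k σ lam m deg).singleComponent R
      (stringDiagram k τ) i (0 : ℤ) a n))
    (φ : ∀ p q : ℤ, (bandDiagram k σ lam m deg).Obj R p →ₗ[BoundAlgebra k R]
      (stringDiagram k τ).Obj R q)
    (hφ : ∀ q, ((stringDiagram k τ).d R q).comp (φ (q + 1) q) +
        (φ (q + 1 + 1) (q + 1)).comp ((bandDiagram k σ lam m deg).d R (q + 1)) =
      (bandDiagram k σ lam m deg).single (stringDiagram k τ) i (0 : ℤ) a (q + 1) (q + 1)) :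
    Nonempty (Homotopy F 0) := by
  refine homotopy_zero _ _ φ F fun q => (hF (q + 1)).trans ?_
  exact congrArg (homOf (R := R) (U := bandDiagram k σ lam m deg) (U' := stringDiagram k τ))
    ((singleComponent_eq_single _ _ _ _ ha (q + 1)).trans (hφ q).symm)

/-- A half map from the band beyond σR to the reversed left part of τ telescopes to its boundary
term along σR = f, which is the single map itself. The other boundary term would need an inverse
letter where the inverted τR is direct or missing. -/
theorem ConeSetup.homotopy_zero_of_halfMap_right (h : ConeSetup R σ i τ f hf fL fR)
    (hlam : lam ≠ 0)
    (hF : ∀ n : ℤ, F.f n = ModuleCat.ofHom ((bandDiagram k σ lam m deg).singleComponent R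
      (stringDiagram k τ) i (0 : ℤ) (pathElt k R f) n))
    (hfR : fR = []) {a : ℕ → BoundAlgebra k R}
    (ha : HalfMap k R (fun j : ℕ => some (σ.get (bandBullet i j)))
      (fun j : ℕ => (τ.letter (-j - 1)).map Letter.inv) a) (ha0 : a 0 = idem k R τ.base) :
    Nonempty (Homotopy F 0) := by
  have hv : idem k R (σ.get i).leftVertex * pathElt k R f = pathElt k R f := by
    rw [← h.ends]
    exact idem_mul_pathElt hf
  have hv' : pathElt k R f * idem k R τ.base = pathElt k R f := by
    rw [← h.starts]
    exact pathElt_mul_idem hf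
  have hσi : (σ.get i).arrows = f := by rw [h.right_arrows, hfR, List.append_nil]
  have hBc := bandDiagram_coherent (k := k) hσ lam m deg
  have hTc := stringDiagram_coherent (k := k) hτ
  have hcoeff := bandDiagram_coeff_ne_zero (σ := σ) hlam m deg
  have hvert : (σ.get (bandBullet i 0)).leftVertex = τ.base := by
    have h1 := (h.band.junction_bandBullet i (-1)).1
    rw [bandBullet_neg_one, neg_add_cancel, Letter.rightVertex_of_direct h.right_direct] at h1
    rw [← h1, ← h.starts]
    simp only [Letter.last, hσi]
  have hB : ∀ j : ℕ, (bandDiagram k σ lam m deg).next^[j] (bandBullet i 0) = bandBullet i j :=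
    fun j => (iterate_finRotate_bandBullet i 0 j).trans (by rw [zero_add])
  have hT : ∀ j : ℕ, (stringDiagram k τ).rev.next^[j] (0 : ℤ) = (-j : ℤ) := by
    intro j
    induction j with
    | zero => rfl
    | succ j ih =>
      refine (Function.iterate_succ_apply' _ _ _).trans ((congrArg _ ih).trans ?_)
      change (-(j : ℤ)) - 1 = -((j + 1 : ℕ) : ℤ)
      push_cast
      ring
  -- The boundary term carries the coefficient of σR, which may be λ; the half map is rescaled to
  -- remove it.
  let b : k := ((bandDiagram k σ lam m deg).coeff i)⁻¹
  obtain ⟨φ, hφ⟩ := exists_homotopy_of_halfMap (bandDiagram k σ lam m deg) (stringDiagram k τ).rev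
    hBc hTc.rev hcoeff (fun _ => rfl) (bandBullet i 0) (0 : ℤ) (a := fun j => b • a j)
    (by
      have := ha.smul b
      convert this using 2 with j j
      · rw [hB]; rfl
      · rw [hT]; rfl)
    (by
      change idem k R (σ.get (bandBullet i 0)).leftVertex * b • a 0 = b • a 0
      rw [hvert, ha0, mul_smul_comm, idem_mul_idem])
  refine nonempty_homotopy_zero hv hF φ fun q => ?_
  have := hφ (q + 1) q
  rw [rev_d _ hTc] at this
  refine this.trans (single_add_eq_right ?_ ?_ rfl ?_ _ _)
  · change b • a 0 * invElt k R ((τ.letter 0).map Letter.inv) = 0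
    rw [invElt_map_inv]
    rcases hz : τ.letter 0 with _ | z
    · simp
    · rw [dirElt_of_inverse (h.string_right z hz).1, mul_zero]
  · exact finRotate_symm_bandBullet i 0
  · have e : (bandDiagram k σ lam m deg).next.symm (bandBullet i 0) = i :=
      finRotate_symm_bandBullet i 0
    rw [e]
    change ((bandDiagram k σ lam m deg).coeff i • dirElt k R (some (σ.get i))) * b • a 0 = _
    rw [dirElt_of_direct h.right_direct, hσi, ha0, smul_mul_smul_comm,
      mul_inv_cancel₀ (hcoeff i), one_smul, hv']

/-- Now the boundary term lies along τR = f̄, whose coefficient is one. The homotopy starts at the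
source of f and at bullet 1 of τ, and the term along σR vanishes because σR is inverted. -/
theorem ConeSetup.homotopy_zero_of_halfMap_left (h : ConeSetup R σ i τ f hf fL fR)
    (hlam : lam ≠ 0)
    (hF : ∀ n : ℤ, F.f n = ModuleCat.ofHom ((bandDiagram k σ lam m deg).singleComponent R
      (stringDiagram k τ) i (0 : ℤ) (pathElt k R f) n))
    {x : Letter V} (hx : τ.letter 0 = some x) (hfL : fL = []) {a : ℕ → BoundAlgebra k R}
    (ha : HalfMap k R (fun j : ℕ => some (σ.get (bandBullet i (-2 - j))).inv)
      (fun j : ℕ => τ.letter (j + 1)) a) (ha0 : a 0 = idem k R x.rightVertex) :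
    Nonempty (Homotopy F 0) := by
  have hv : idem k R (σ.get i).leftVertex * pathElt k R f = pathElt k R f := by
    rw [← h.ends]
    exact idem_mul_pathElt hf
  obtain ⟨hxd, hxa⟩ := h.string_right x hx
  rw [hfL, List.nil_append] at hxa
  have hBc := bandDiagram_coherent (k := k) hσ lam m deg
  have hTc := stringDiagram_coherent (k := k) hτ
  have hcoeff := bandDiagram_coeff_ne_zero (σ := σ) hlam m deg
  have hvert : (σ.get i).leftVertex = x.rightVertex := by
    rw [← h.ends, Letter.rightVertex_of_inverse hxd]
    simp only [Letter.first, hxa]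
  have hB : ∀ j : ℕ, (bandDiagram k σ lam m deg).rev.next^[j] i = bandBullet i (-1 - j) := by
    intro j
    induction j with
    | zero => rfl
    | succ j ih =>
      refine (Function.iterate_succ_apply' _ _ _).trans ((congrArg _ ih).trans ?_)
      refine (finRotate_symm_bandBullet i (-1 - j)).trans ?_
      congr 1
      push_cast
      ring
  have hT : ∀ j : ℕ, (stringDiagram k τ).next^[j] (1 : ℤ) = (j + 1 : ℤ) := by
    intro j
    induction j with
    | zero => rfl
    | succ j ih =>
      refine (Function.iterate_succ_apply' _ _ _).trans ((congrArg _ ih).trans ?_)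
      change (j : ℤ) + 1 + 1 = ((j + 1 : ℕ) : ℤ) + 1
      push_cast
      ring
  obtain ⟨φ, hφ⟩ := exists_homotopy_of_halfMap (bandDiagram k σ lam m deg).rev (stringDiagram k τ)
    hBc.rev hTc (fun b => hcoeff _) (fun _ => rfl) i (1 : ℤ) (a := a)
    (by
      convert ha using 2 with j j
      · rw [hB]
        change some (σ.get ((finRotate _).symm (bandBullet i (-1 - j)))).inv = _
        rw [finRotate_symm_bandBullet, show (-1 - (j : ℤ) - 1) = -2 - j by ring]
      · rw [hT]; rfl)
    (by
      change idem k R (σ.get i).leftVertex * a 0 = a 0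
      rw [hvert, ha0, idem_mul_idem])
  refine nonempty_homotopy_zero hv hF φ fun q => ?_
  have := hφ (q + 1) q
  rw [rev_d _ hBc] at this
  refine this.trans (single_add_eq_left ?_ rfl ?_ ?_ _ _)
  · have e : (bandDiagram k σ lam m deg).rev.letter
        ((bandDiagram k σ lam m deg).rev.next.symm i) = some (σ.get i).inv := by
      change some (σ.get ((finRotate _).symm (finRotate _ i))).inv = _
      rw [Equiv.symm_apply_apply]
    rw [e, dirElt_of_inverse (by rw [Letter.inv_direct, h.right_direct]; rfl), smul_zero, zero_mul]
  · rfl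
  · change a 0 * invElt k R (τ.letter 0) = _
    rw [ha0, hx, invElt_of_inverse hxd, hxa, ← hvert, hv]

/-- Paths with the same last arrow are comparable, so f = g τL with g nontrivial, and g into the
left end of τL is a null homotopy. Its other boundary terms vanish: by gentleness beyond τL, by the
relation with σL if σL is direct, and because σR is direct. -/
theorem homotopy_zero_of_suffix (hR : IsGentle R) (hf : f ≠ []) (hpath : IsPath R f)
    (hends : (f.head hf).right = (σ.get i).leftVertex)
    (hright : (σ.get i).direct = true)
    (hleft : Junction R (σ.get ((finRotate _).symm i)) ⟨f, hf, true⟩)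
    (hF : ∀ n : ℤ, F.f n = ModuleCat.ofHom ((bandDiagram k σ lam m deg).singleComponent R
      (stringDiagram k τ) i (0 : ℤ) (pathElt k R f) n))
    {y : Letter V} (hy : τ.letter (-1) = some y) (hyd : y.direct = true)
    (hlast : f.getLast hf = y.last) (hsuff : ¬ f <:+ y.arrows) : Nonempty (Homotopy F 0) := by
  have hv : idem k R (σ.get i).leftVertex * pathElt k R f = pathElt k R f := by
    rw [← hends]
    exact idem_mul_pathElt hf
  have hBc := bandDiagram_coherent (k := k) hσ lam m deg
  have hTc := stringDiagram_coherent (k := k) hτ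
  obtain ⟨g, hg⟩ : y.arrows <:+ f :=
    (hR.suffix_of_getLast_eq hpath (hτ.path _ y hy) hf y.ne_nil hlast).resolve_left hsuff
  have hg0 : g ≠ [] := by
    rintro rfl
    exact hsuff ⟨[], hg.symm⟩
  have hgy := (hg.symm ▸ hpath : IsPath R (g ++ y.arrows)).getLast_head hg0 y.ne_nil
  have hhead : f.head hf = g.head hg0 := by
    simp only [← hg]
    exact List.head_append_of_ne_nil _
  have hgv : idem k R (σ.get i).leftVertex * pathElt k R g = pathElt k R g := by
    rw [← hends, hhead]
    exact idem_mul_pathElt hg0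
  refine nonempty_homotopy_zero hv hF
    (fun p q => (bandDiagram k σ lam m deg).single (stringDiagram k τ) i (-1 : ℤ)
      (pathElt k R g) p q) fun q => ?_
  have h1 : pathElt k R g * ((stringDiagram k τ).coeff (-1 : ℤ) •
      dirElt k R ((stringDiagram k τ).letter (-1 : ℤ))) = pathElt k R f := by
    change pathElt k R g * ((1 : k) • dirElt k R (τ.letter (-1))) = _
    rw [one_smul, hy, dirElt_of_direct hyd, ← pathElt_append, hg]
  have h2 : pathElt k R g * ((stringDiagram k τ).coeff ((stringDiagram k τ).next.symm (-1 : ℤ)) •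
      invElt k R ((stringDiagram k τ).letter ((stringDiagram k τ).next.symm (-1 : ℤ)))) = 0 := by
    change pathElt k R g * ((1 : k) • invElt k R (τ.letter (-2))) = _
    rw [one_smul]
    rcases hz : τ.letter (-2) with _ | z
    · simp
    · rcases hzd : z.direct
      · rw [invElt_of_inverse hzd]
        have hj := hτ.junction _ _ _ hz hy
        refine pathElt_mul_pathElt_eq_zero hg0 z.ne_nil ?_
        refine hR.rel_of_ne_right (a := y.first) (hj.2.2.2.2 hzd hyd).symm hgy.1 hgy.2 ?_
        have := hj.1
        rw [Letter.rightVertex_of_inverse hzd, Letter.leftVertex_of_direct hyd] at this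
        exact hgy.1.trans this.symm
      · rw [invElt_of_direct hzd, mul_zero]
  have h3 : (bandDiagram k σ lam m deg).coeff ((bandDiagram k σ lam m deg).next.symm i) •
      dirElt k R ((bandDiagram k σ lam m deg).letter ((bandDiagram k σ lam m deg).next.symm i)) *
        pathElt k R g = 0 := by
    change _ • dirElt k R (some (σ.get ((finRotate _).symm i))) * _ = _
    rcases hd : (σ.get ((finRotate _).symm i)).direct
    · rw [dirElt_of_inverse hd, smul_zero, zero_mul]
    · rw [dirElt_of_direct hd, smul_mul_assoc, pathElt_mul_pathElt_eq_zero (Letter.ne_nil _) hg0,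
        smul_zero]
      exact hhead ▸ hleft.2.1 hd rfl
  have h4 : (bandDiagram k σ lam m deg).coeff i •
      invElt k R ((bandDiagram k σ lam m deg).letter i) * pathElt k R g = 0 := by
    change _ • invElt k R (some (σ.get i)) * _ = _
    rw [invElt_of_direct hright, smul_zero, zero_mul]
  exact single_homotopy hBc hTc hgv rfl h1 h2 h3 h4 q

end NullHomotopies

/-! ### The explicit words of the theorem are cone words. -/

section ConeWords

variable {V : Type u} [Quiver.{u} V] {R : Quiver.Total V → Quiver.Total V → Prop}

theorem get?_ofList_append {α : Type*} (l : List α) (s : Stream'.Seq α) (n : ℕ) :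
    ((Stream'.Seq.ofList l).append s).get? n =
      if n < l.length then l[n]? else s.get? (n - l.length) := by
  induction l generalizing n with
  | nil => simp
  | cons a l ih =>
    rw [Stream'.Seq.ofList_cons, Stream'.Seq.cons_append]
    rcases n with _ | n
    · simp
    · rw [Stream'.Seq.get?_cons_succ, ih]
      simp

variable {β α : List (Letter V)} {σL σR : Letter V} {i : Fin (β ++ σL :: σR :: α).length}

/-- Moving left from f one meets σL, then β from its right end, and then, after passing the end of
the cyclic word, α from its right end. -/
theorem getElem?_bandBullet (hi : (i : ℕ) = β.length + 1) (x : Letter V) {n : ℕ} (hn : 1 ≤ n)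
    (hn' : n < (β ++ σL :: σR :: α).length) :
    (x :: σL :: (β.reverse ++ α.reverse))[n]? =
      some ((β ++ σL :: σR :: α).get (bandBullet i (Int.negSucc n))) := by
  have hN : (β ++ σL :: σR :: α).length = β.length + α.length + 2 := by simp; omega
  have hv := val_bandBullet i (Int.negSucc n)
  rw [List.get_eq_getElem, ← List.getElem?_eq_getElem]
  generalize (bandBullet i (Int.negSucc n) : ℕ) = b at hv ⊢
  rw [hi, hN, Int.negSucc_eq] at hv
  rw [hN] at hn'
  obtain ⟨n, rfl⟩ : ∃ n', n = n' + 1 := ⟨n - 1, by omega⟩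
  rw [List.getElem?_cons_succ]
  rcases n with _ | n
  · have hb : b = β.length := by
      rw [Int.emod_eq_of_lt (by push_cast; omega) (by push_cast; omega)] at hv
      push_cast at hv
      omega
    rw [hb, List.getElem?_append_right le_rfl]
    simp
  · rw [List.getElem?_cons_succ]
    rcases lt_or_ge n β.length with h | h
    · have hb : b = β.length - 1 - n := by
        rw [Int.emod_eq_of_lt (by push_cast; omega) (by push_cast; omega)] at hv
        push_cast at hv
        omega
      rw [hb, List.getElem?_append_left (by simpa using h), List.getElem?_reverse h,
        List.getElem?_append_left (by omega)]
    · have hb : b = β.length + (α.length - 1 - (n - β.length) + 2) := by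
        rw [← Int.add_emod_right, Int.emod_eq_of_lt (by push_cast; omega) (by push_cast; omega)]
          at hv
        push_cast at hv
        omega
      rw [hb, List.getElem?_append_right (by simpa using h), List.length_reverse,
        List.getElem?_reverse (by omega), List.getElem?_append_right (by omega),
        Nat.add_sub_cancel_left, List.getElem?_cons_succ, List.getElem?_cons_succ]

variable {τ : PointedWord V} {f : List (Quiver.Total V)} {hf : f ≠ []}
  {fL fR : List (Quiver.Total V)}

/-- The common part of the cases with and without τR; the entry `n` of the left half is the letter
`-n - 1`. -/
theorem isConeWord_of_left (hi : (i : ℕ) = β.length + 1) {left : Stream'.Seq (Letter V)}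
    (hget : ∀ n < (β ++ σL :: σR :: α).length,
      left.get? n = (⟨f, hf, true⟩ :: σL :: (β.reverse ++ α.reverse))[n]?)
    (hwrap : left.get? (β ++ σL :: σR :: α).length =
      (τ.right.get? 0).map fun _ => ⟨fL ++ f ++ fR, by simp [hf], true⟩)
    (hbelow : ∀ n, left.get? ((β ++ σL :: σR :: α).length + 1 + n) =
      (τ.right.get? (n + 1)).map Letter.inv) :
    IsConeWord (β ++ σL :: σR :: α) i τ f hf fL fR
      { base := τ.base
        deg := τ.deg
        left := left
        right := τ.left.map Letter.inv } where
  base := rfl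
  deg := rfl
  nonneg t ht := by
    obtain ⟨n, rfl⟩ := Int.eq_ofNat_of_zero_le ht
    rw [show (-(n : ℤ) - 1) = Int.negSucc n by rw [Int.negSucc_eq]; ring]
    exact Stream'.Seq.map_get? _ _ _
  neg_one := by
    refine (hget 0 (by simp)).trans ?_
    simp
  band t h1 h2 := by
    obtain ⟨n, rfl⟩ := Int.eq_negSucc_of_lt_zero (show t < 0 by omega)
    rw [Int.negSucc_eq] at h1 h2
    refine (hget n (by omega)).trans (getElem?_bandBullet hi _ (by omega) (by omega))
  wrap := by
    rw [show (-((β ++ σL :: σR :: α).length : ℤ) - 1) = Int.negSucc (β ++ σL :: σR :: α).length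
      by rw [Int.negSucc_eq]; ring]
    exact hwrap
  below t ht := by
    obtain ⟨n, rfl⟩ : ∃ n : ℕ, t = -((β ++ σL :: σR :: α).length : ℤ) - 2 - n :=
      ⟨(-((β ++ σL :: σR :: α).length : ℤ) - 2 - t).toNat, by omega⟩
    rw [show (-((β ++ σL :: σR :: α).length : ℤ) - 2 - n) =
        Int.negSucc ((β ++ σL :: σR :: α).length + 1 + n) by
      rw [Int.negSucc_eq]; push_cast; ring]
    rw [show (-((β ++ σL :: σR :: α).length : ℤ) -
        Int.negSucc ((β ++ σL :: σR :: α).length + 1 + n) - 1) = Int.ofNat (n + 1) by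
      rw [Int.negSucc_eq, Int.ofNat_eq_natCast]; push_cast; ring]
    exact hbelow n

theorem isConeWord_of_none (hi : (i : ℕ) = β.length + 1) (hτ : τ.right.get? 0 = none) :
    IsConeWord (β ++ σL :: σR :: α) i τ f hf fL fR
      { base := τ.base
        deg := τ.deg
        left := Stream'.Seq.ofList (⟨f, hf, true⟩ :: σL :: (β.reverse ++ α.reverse))
        right := τ.left.map Letter.inv } := by
  have hN : (β ++ σL :: σR :: α).length = β.length + α.length + 2 := by simp; omega
  refine isConeWord_of_left hi (fun n _ => Stream'.Seq.ofList_get? _ _) ?_ fun n => ?_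
  · rw [hτ, Stream'.Seq.ofList_get?, List.getElem?_eq_none (by simp; omega)]
    rfl
  · rw [τ.right.le_stable (Nat.zero_le _) hτ, Stream'.Seq.ofList_get?,
      List.getElem?_eq_none (by simp; omega)]
    rfl

theorem isConeWord_of_ne_none (hi : (i : ℕ) = β.length + 1) (hτ : τ.right.get? 0 ≠ none) :
    IsConeWord (β ++ σL :: σR :: α) i τ f hf fL fR
      { base := τ.base
        deg := τ.deg
        left := (Stream'.Seq.ofList (⟨f, hf, true⟩ :: σL :: (β.reverse ++ α.reverse ++
          [⟨fL ++ f ++ fR, by simp [hf], true⟩]))).append (τ.right.tail.map Letter.inv)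
        right := τ.left.map Letter.inv } := by
  have hN : (β ++ σL :: σR :: α).length = β.length + α.length + 2 := by simp; omega
  have hl : (⟨f, hf, true⟩ :: σL :: (β.reverse ++ α.reverse ++
      [(⟨fL ++ f ++ fR, by simp [hf], true⟩ : Letter V)])).length =
        (β ++ σL :: σR :: α).length + 1 := by
    simp; omega
  have hc : (⟨f, hf, true⟩ :: σL :: (β.reverse ++ α.reverse ++
      [(⟨fL ++ f ++ fR, by simp [hf], true⟩ : Letter V)])) =
      (⟨f, hf, true⟩ :: σL :: (β.reverse ++ α.reverse)) ++
        [(⟨fL ++ f ++ fR, by simp [hf], true⟩ : Letter V)] := rfl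
  refine isConeWord_of_left hi (fun n hn => ?_) ?_ fun n => ?_
  · rw [get?_ofList_append, if_pos (by omega), hc, List.getElem?_append_left (by simp; omega)]
  · obtain ⟨x, hx⟩ := Option.ne_none_iff_exists'.1 hτ
    rw [get?_ofList_append, if_pos (by omega), hc, List.getElem?_append_right (by simp; omega), hx]
    simp [hN]
  · rw [get?_ofList_append, if_neg (by omega), hl, Nat.add_sub_cancel_left,
      Stream'.Seq.map_get?, Stream'.Seq.get?_tail]

end ConeWords

/-! ### From the hypotheses of the theorem to the standing assumptions. -/

section Setup

variable {k : Type u} [Field k] {V : Type u} [Quiver.{u} V] [Fintype V]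
  {R : Quiver.Total V → Quiver.Total V → Prop}
  {σ : List (Letter V)} {i : Fin σ.length} {τ : PointedWord V}
  {f : List (Quiver.Total V)} {fL fR : List (Quiver.Total V)}
  {lam : k} {m : Fin σ.length} {deg : ℤ}
  {hσ : IsHomotopyBand R σ} {hτ : IsHomotopyString R τ}
  {F : bandComplex k hσ lam m deg ⟶ stringComplex k hτ}

/-- The content lies in the two junctions at f. An inverse σL is reduced against f because it is
reduced against σR, which begins with f. Direct σL and inverse τL give relations by compatible
orientation. A direct τL with the last arrow of f would make the map null-homotopic. -/
theorem coneSetup_of_not_homotopy (hR : IsGentle R) (hf : f ≠ []) (h2 : 2 ≤ σ.length)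
    (hsingle : IsSingleMap R (σ.get ((finRotate _).symm i)).rightVertex τ.base
      (some (σ.get ((finRotate _).symm i))) (some (σ.get i)) (τ.left.get? 0) (τ.right.get? 0) f)
    (hcompat : CompatiblyOriented R (some (σ.get ((finRotate _).symm i))) (some (σ.get i))
      (τ.left.get? 0) (τ.right.get? 0) f fL fR)
    (hF : ∀ n : ℤ, F.f n = ModuleCat.ofHom ((bandDiagram k σ lam m deg).singleComponent R
      (stringDiagram k τ) i (0 : ℤ) (pathElt k R f) n))
    (hne : IsEmpty (Homotopy F 0)) : ConeSetup R σ i τ f hf fL fR := by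
  have hj := hσ.junction ((finRotate _).symm i)
  rw [Equiv.apply_symm_apply] at hj
  obtain ⟨hd, ha⟩ := hcompat.σR_eq _ rfl
  have hfirst : (σ.get i).first = f.head hf := by
    simp only [Letter.first, ha]
    exact List.head_append_of_ne_nil _
  have hends : (f.head hf).right = (σ.get i).leftVertex := (hsingle.ends hf).trans hj.1
  have hleft : Junction R (σ.get ((finRotate _).symm i)) ⟨f, hf, true⟩ := by
    refine ⟨(hsingle.ends hf).symm, fun hl _ => ?_, by simp, by simp, fun hl _ => ?_⟩
    · refine (hcompat.zero_σL _ rfl hl).junction (hσ.path _ (List.get_mem _ _)) hsingle.path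
        (Letter.ne_nil _) hf ?_
      rw [hsingle.ends hf, Letter.rightVertex_of_direct hl]
      rfl
    · exact fun he => hj.2.2.2.2 hl hd (he.trans hfirst.symm)
  refine ⟨h2, hσ, hτ, hsingle.path, hends, hsingle.starts hf, hd, ha,
    fun x hx => hcompat.τR_eq x hx, hleft, fun x hx => ?_⟩
  have hb := hτ.base_left x hx
  refine ⟨?_, fun _ hxd => ?_, by simp, fun _ hxd he => ?_, by simp⟩
  · rw [Letter.inv_leftVertex, hb, Letter.rightVertex_of_direct rfl]
    exact hsingle.starts hf
  · have hxd' : x.direct = false := by simpa using hxd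
    refine (hcompat.zero_τL x hx hxd').junction hsingle.path (hτ.path _ x hx) hf x.ne_nil ?_
    rw [hsingle.starts hf, ← hb, Letter.rightVertex_of_inverse hxd']
    rfl
  · have hxd' : x.direct = true := by simpa using hxd
    exact not_isEmpty_iff.2 (homotopy_zero_of_suffix hR hf hsingle.path hends hd hleft hF hx hxd'
      he (hcompat.not_in_τL x hx hxd')) hne

theorem ConeSetup.nonempty_iso_of_not_homotopy (hR : IsGentle R) {hf : f ≠ []}
    (h : ConeSetup R σ i τ f hf fL fR) {c : PointedWord V} (hc : IsConeWord σ i τ f hf fL fR c)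
    (hlam : lam ≠ 0) (hdeg : (bandDiagram k σ lam m deg).degree i = τ.deg)
    (hF : ∀ n : ℤ, F.f n = ModuleCat.ofHom ((bandDiagram k σ lam m deg).singleComponent R
      (stringDiagram k τ) i (0 : ℤ) (pathElt k R f) n))
    (hne : IsEmpty (Homotopy F 0)) (hcs : IsHomotopyString R c) :
    Nonempty (CochainComplex.mappingCone F ≅ stringComplex k hcs) := by
  obtain ⟨l₁, hl₁, hl₁0⟩ := h.exists_halfMap_right (k := k) hR hc fun hfR ⟨a, ha, ha0⟩ =>
    not_isEmpty_iff.2 (h.homotopy_zero_of_halfMap_right hlam hF hfR ha ha0) hne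
  obtain ⟨l₂, hl₂, hl₂0, hl₂1⟩ := h.exists_halfMap_left (k := k) hR hc
    fun x hx hfL ⟨a, ha, ha0⟩ =>
      not_isEmpty_iff.2 (h.homotopy_zero_of_halfMap_left hlam hF hx hfL ha ha0) hne
  obtain ⟨x₁, hx₁, hx₁', hx₁0⟩ := exists_graphMap_right hc h lam m deg hdeg hl₁ hl₁0
  obtain ⟨x₂, hx₂, hx₂'⟩ := exists_graphMap_left hc h lam m deg hdeg hl₂ hl₂0 hl₂1
  exact h.nonempty_iso hc hlam m deg hdeg hcs hx₂ hx₂' hx₁ hx₁' hx₁0 hσ hτ F hF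

end Setup

/-! ### Transport along the Morita equivalence. -/

section Transport

variable {C D : Type*} [Category C] [Category D] [Preadditive C] [Preadditive D]

theorem isEmpty_homotopy_of_map_ne_zero (H : C ⥤ D) [H.Additive] {K L : CochainComplex C ℤ}
    (F : K ⟶ L) (hne : (HomotopyCategory.quotient D (ComplexShape.up ℤ)).map
      ((H.mapHomologicalComplex (ComplexShape.up ℤ)).map F) ≠ 0) : IsEmpty (Homotopy F 0) := by
  refine ⟨fun h => hne ?_⟩
  rw [HomotopyCategory.eq_of_homotopy _ _ (H.mapHomotopy h), Functor.map_zero, Functor.map_zero]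

variable [Limits.HasBinaryBiproducts C] [Limits.HasBinaryBiproducts D]

theorem nonempty_quotient_iso (H : C ⥤ D) [H.Additive] {K L M : CochainComplex C ℤ}
    (F : K ⟶ L) (e : Nonempty (CochainComplex.mappingCone F ≅ M)) :
    Nonempty ((HomotopyCategory.quotient D (ComplexShape.up ℤ)).obj
        (CochainComplex.mappingCone ((H.mapHomologicalComplex (ComplexShape.up ℤ)).map F)) ≅
      (HomotopyCategory.quotient D (ComplexShape.up ℤ)).obj
        ((H.mapHomologicalComplex (ComplexShape.up ℤ)).obj M)) :=
  e.map fun e => (HomotopyCategory.quotient D (ComplexShape.up ℤ)).mapIso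
    ((CochainComplex.mappingCone.mapHomologicalComplexIso F H).symm ≪≫
      (H.mapHomologicalComplex (ComplexShape.up ℤ)).mapIso e)

end Transport

end

end GentleCone

theorem mainTheorem10 {k : Type u} [Field k] {V : Type u} [Quiver.{u} V] [Fintype V]
    [Finite (Quiver.Total V)] (R : Quiver.Total V → Quiver.Total V → Prop)
    (hR : GentleCone.IsGentle R)
    -- `Λ` is a gentle algebra, Morita equivalent to `kQ/I`
    {Λ : Type u} [Ring Λ] [Algebra k Λ] (E : MoritaEquivalence k (GentleCone.BoundAlgebra k R) Λ)
    -- the homotopy band `σ = β σL σR α` and the band complex of `σ` and `lam`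
    (β α : List (GentleCone.Letter V)) (σL σR : GentleCone.Letter V)
    (hσ : GentleCone.IsHomotopyBand R (β ++ σL :: σR :: α))
    (lam : k) (hlam : lam ≠ 0) (m : Fin (β ++ σL :: σR :: α).length) (deg : ℤ)
    -- the homotopy string `τ = δ τL τR γ`, marked at the bullet between `τL` and `τR`
    (τ : GentleCone.PointedWord V) (hτ : GentleCone.IsHomotopyString R τ)
    -- the single map with single component `f`, from the bullet `i` between `σL` and `σR`
    (f fL fR : List (Quiver.Total V)) (hf : f ≠ [])
    (i : Fin (β ++ σL :: σR :: α).length) (hi : (i : ℕ) = β.length + 1)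
    (hdeg : (GentleCone.bandDiagram k (β ++ σL :: σR :: α) lam m deg).degree i = τ.deg)
    (hsingle : GentleCone.IsSingleMap R σL.rightVertex τ.base (some σL) (some σR)
      (τ.left.get? 0) (τ.right.get? 0) f)
    (hcompat : GentleCone.CompatiblyOriented R (some σL) (some σR)
      (τ.left.get? 0) (τ.right.get? 0) f fL fR)
    (F : GentleCone.bandComplex k hσ lam m deg ⟶ GentleCone.stringComplex k hτ)
    (hF : ∀ n : ℤ, F.f n = ModuleCat.ofHom (GentleCone.Unfolded.singleComponent R
      (GentleCone.bandDiagram k (β ++ σL :: σR :: α) lam m deg) (GentleCone.stringDiagram k τ)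
      i (0 : ℤ) (GentleCone.pathElt k R f) n))
    -- the single map is nonzero in the homotopy category
    (hne : (HomotopyCategory.quotient (ModuleCat.{u} Λ) (ComplexShape.up ℤ)).map
      ((E.eqv.functor.mapHomologicalComplex (ComplexShape.up ℤ)).map F) ≠ 0) :
    (τ.right.get? 0 = none →
      ∃ hc : GentleCone.IsHomotopyString R
          -- the word `α β σL f τ̄L δ̄`, marked at the right end of `f`
          { base := τ.base
            deg := τ.deg
            left := Stream'.Seq.ofList (⟨f, hf, true⟩ :: σL :: (β.reverse ++ α.reverse))
            right := τ.left.map GentleCone.Letter.inv },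
        Nonempty
          ((HomotopyCategory.quotient (ModuleCat.{u} Λ) (ComplexShape.up ℤ)).obj
              (CochainComplex.mappingCone
                ((E.eqv.functor.mapHomologicalComplex (ComplexShape.up ℤ)).map F)) ≅
            (HomotopyCategory.quotient (ModuleCat.{u} Λ) (ComplexShape.up ℤ)).obj
              ((E.eqv.functor.mapHomologicalComplex (ComplexShape.up ℤ)).obj
                (GentleCone.stringComplex k hc)))) ∧
    (τ.right.get? 0 ≠ none →
      ∃ hc : GentleCone.IsHomotopyString R
          -- the word `γ̄ (fL f fR) α β σL f τ̄L δ̄`, marked at the right end of the last `f`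
          { base := τ.base
            deg := τ.deg
            left := (Stream'.Seq.ofList (⟨f, hf, true⟩ :: σL :: (β.reverse ++ α.reverse ++
              [⟨fL ++ f ++ fR, by simp [hf], true⟩]))).append
                (τ.right.tail.map GentleCone.Letter.inv)
            right := τ.left.map GentleCone.Letter.inv },
        Nonempty
          ((HomotopyCategory.quotient (ModuleCat.{u} Λ) (ComplexShape.up ℤ)).obj
              (CochainComplex.mappingCone
                ((E.eqv.functor.mapHomologicalComplex (ComplexShape.up ℤ)).map F)) ≅
            (HomotopyCategory.quotient (ModuleCat.{u} Λ) (ComplexShape.up ℤ)).obj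
              ((E.eqv.functor.mapHomologicalComplex (ComplexShape.up ℤ)).obj
                (GentleCone.stringComplex k hc)))) := by
  have hN : (β ++ σL :: σR :: α).length = β.length + α.length + 2 := by simp; omega
  have hget : (β ++ σL :: σR :: α).get i = σR := by
    rw [List.get_eq_getElem, ← Option.some_inj, ← List.getElem?_eq_getElem, hi,
      List.getElem?_append_right (by omega), Nat.add_sub_cancel_left]
    rfl
  have hprev : (β ++ σL :: σR :: α).get ((finRotate _).symm i) = σL := by
    -- Bullet `i` is the left end of the letter at position `i`, so σR stands at `i` and σL at its
    -- cyclic predecessor.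
    have hb : (((finRotate _).symm i : Fin (β ++ σL :: σR :: α).length) : ℕ) = β.length := by
      have h := GentleCone.finRotate_val ((finRotate _).symm i)
      rw [Equiv.apply_symm_apply, hi] at h
      split_ifs at h
      omega
    rw [List.get_eq_getElem, ← Option.some_inj, ← List.getElem?_eq_getElem, hb,
      List.getElem?_append_right le_rfl, Nat.sub_self]
    rfl
  have hnull := GentleCone.isEmpty_homotopy_of_map_ne_zero E.eqv.functor F hne
  have h : GentleCone.ConeSetup R (β ++ σL :: σR :: α) i τ f hf fL fR :=
    GentleCone.coneSetup_of_not_homotopy hR hf (by omega) (by rw [hget, hprev]; exact hsingle)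
      (by rw [hget, hprev]; exact hcompat) hF hnull
  refine ⟨fun hτ0 => ?_, fun hτ0 => ?_⟩
  · have hc := GentleCone.isConeWord_of_none (σL := σL) (σR := σR) (hf := hf) (fL := fL)
      (fR := fR) hi hτ0
    exact ⟨hc.isHomotopyString h, GentleCone.nonempty_quotient_iso E.eqv.functor F
      (h.nonempty_iso_of_not_homotopy hR hc hlam hdeg hF hnull _)⟩
  · have hc := GentleCone.isConeWord_of_ne_none (σL := σL) (σR := σR) (hf := hf) (fL := fL)
      (fR := fR) hi hτ0
    exact ⟨hc.isHomotopyString h, GentleCone.nonempty_quotient_iso E.eqv.functor F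
      (h.nonempty_iso_of_not_homotopy hR hc hlam hdeg hF hnull _)⟩
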